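/- A \emph{partial field} is a set $P$ with distinguished elements $0,1$, a multiplication, and a partially defined addition such that: $P\setminus\{0\}$ is an abelian group under multiplication with identity $1$, and $0\cdot p=0$ for all $p$; $p+0=p$; every $p$ has a unique additive inverse $-p$; addition is commutative; for $p\neq 0$, $p(q+r)$ is defined if and only if $pq+pr$ is defined, and then they are equal; and the associative law holds: whenever a finite multiset $S$ can be summed to a value $r$ along some binary tree with all intermediate sums defined (an \emph{association} of $S$), then for every splitting of $S$ into two non-empty parts having associations with values $u$ and $w$, the sum $u+w$ is defined and equals $r$. A finite sum $p_1+\cdots+p_n$ is \emph{defined}, with value $r$, if for some $z_1,\dots,z_k\in P$ the multiset $\{p_1,\dots,p_n,z_1,-z_1,\dots,z_k,-z_k\}$ has an association with value $r$. Determinants are defined by the usual sum over permutations. A matrix over $P$ is a \emph{$P$-matrix} if the determinants of all its square submatrices are defined; its \emph{rank} is the largest order of a square submatrix with nonzero determinant. A finite matroid $M$ with ground set $E$ is \emph{representable over $P$} if there are $r\ge 0$ and a $P$-matrix $A$ of rank $r$, with $r$ rows and with columns indexed by $E$, such that the bases of $M$ are exactly the sets $B\subseteq E$ with $|B|=r$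 for which the $r\times r$ submatrix of $A$ with column set $B$ has nonzero determinant. Every field is a partial field (with its total addition). For a nonzero commutative ring $R$ and a set $S$ of units of $R$, the partial field $\mathbb P(R,S)$ has underlying set $\langle S\cup\{-1\}\rangle\cup\{0\}$, where $\langle\cdot\rangle$ denotes the generated multiplicative group, and the operations of $R$, a sum being defined if and only if it lies in this set. For partial fields $P_1,P_2$, the partial field $P_1\otimes P_2$ has underlying set $\{(p_1,p_2)\in P_1\times P_2 : p_1\neq 0 \Leftrightarrow p_2\neq 0\}$, with componentwise operations, a sum being defined if and only if both component sums are defined and either both or neither of them is $0$. \textbf{Theorem (Whittle).} Let $M$ be a finite matroid. The following are equivalent: \begin{enumerate} \item $M$ is representable over $\mathrm{GF}(3)\otimes\mathrm{GF}(5)$; \item $M$ is representable over the dyadic partial field $\mathbb P(\mathbb Q,\{2\})$; \item $M$ is representable over every field whose characteristic is not $2$. \end{enumerate} -/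

import Mathlib

universe u v w

/-- `Association padd S r`: there is a vertex-labelled binary tree whose leaves are labelled with
the elements of the multiset `S`, in which every non-leaf node is labelled with the (defined) sum
of the labels of its two children, and whose root has label `r`. Here `r ∈ padd p q` means that
`p + q` is defined and equal to `r`. -/
inductive Association {P : Type u} (padd : P → P → Part P) : Multiset P → P → Prop
  | leaf (p : P) : Association padd {p} p
  | node {S T : Multiset P} {u w r : P} : Association padd S u → Association padd T w →
      r ∈ padd u w → Association padd (S + T) r

/-- A partial field: `P` without `0` is an abelian group under multiplication, `0` is absorbing,
and `padd` is a partial addition. A pre-association of a multiset is a splitting of it into two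
parts together with associations of the parts, with root labels `u` and `w`; it is compatible
with an association with root label `r` if `u + w` is defined and equal to `r`.
Distributivity (`p * (q + r)` is defined if and only if `p * q + p * r` is) is required for `p ≠ 0`;
for `p = 0` the sum `0 + 0` is always defined, while `q + r` need not be. -/
class PartialField (P : Type u) extends CommGroupWithZero P, Neg P where
  /-- The partial addition. -/
  padd : P → P → Part P
  padd_zero : ∀ p : P, padd p 0 = Part.some p
  zero_mem_padd_iff : ∀ p q : P, 0 ∈ padd p q ↔ q = -p
  padd_comm : ∀ p q : P, padd p q = padd q p
  mul_padd : ∀ p q r : P, p ≠ 0 → (padd q r).map (fun x => p * x) = padd (p * q) (p * r)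
  associative_law : ∀ (S : Multiset P) (r : P), Association padd S r →
    ∀ (S₁ S₂ : Multiset P) (u w : P), S₁ + S₂ = S →
      Association padd S₁ u → Association padd S₂ w → r ∈ padd u w

namespace PartialField

/-! ### Fields as partial fields -/

theorem association_field_sum {F : Type u} [AddCommMonoid F] {S : Multiset F} {r : F}
    (h : Association (fun p q : F => Part.some (p + q)) S r) : S.sum = r := by
  induction h with
  | leaf p => simp
  | node _ _ hr hu hw =>
    rw [Multiset.sum_add, hu, hw]
    exact (Part.mem_some_iff.1 hr).symm

/-- Every field is a partial field, with the total addition. -/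
instance instOfField (F : Type u) [Field F] : PartialField F where
  padd p q := Part.some (p + q)
  padd_zero p := by simp
  zero_mem_padd_iff p q := by
    rw [Part.mem_some_iff, eq_comm, eq_neg_iff_add_eq_zero, add_comm]
  padd_comm p q := by rw [add_comm]
  mul_padd p q r _ := by simp [mul_add]
  associative_law S r h S₁ S₂ u w hS h₁ h₂ := by
    rw [Part.mem_some_iff, ← association_field_sum h, ← hS, Multiset.sum_add,
      association_field_sum h₁, association_field_sum h₂]

/-! ### The partial field of a ring and a set of units -/

/-- The underlying set `⟨S ∪ {-1}⟩ ∪ {0}` of the partial field of a ring `R` and a set `S` of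
units of `R`. -/
def ringCarrier (R : Type u) [CommRing R] (S : Set Rˣ) : Set R :=
  {x | x = 0 ∨ ∃ g ∈ Subgroup.closure (S ∪ {-1}), (g : R) = x}

/-- The partial field of a (nonzero commutative) ring `R` and a set `S` of units of `R`, as a
type. -/
@[ext]
structure OfRing (R : Type u) [CommRing R] (S : Set Rˣ) : Type u where
  val : R
  mem : val ∈ ringCarrier R S

section OfRing

variable {R : Type u} [CommRing R] {S : Set Rˣ}

theorem ringCarrier_mul {x y : R} (hx : x ∈ ringCarrier R S) (hy : y ∈ ringCarrier R S) :
    x * y ∈ ringCarrier R S := by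
  rcases hx with rfl | ⟨g, hg, rfl⟩
  · exact Or.inl (zero_mul _)
  rcases hy with rfl | ⟨k, hk, rfl⟩
  · exact Or.inl (mul_zero _)
  · exact Or.inr ⟨g * k, mul_mem hg hk, by simp⟩

theorem ringCarrier_one : (1 : R) ∈ ringCarrier R S :=
  Or.inr ⟨1, one_mem _, by simp⟩

theorem ringCarrier_inverse {x : R} (hx : x ∈ ringCarrier R S) :
    Ring.inverse x ∈ ringCarrier R S := by
  rcases hx with rfl | ⟨g, hg, rfl⟩
  · exact Or.inl (Ring.inverse_zero R)
  · exact Or.inr ⟨g⁻¹, inv_mem hg, by simp⟩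

theorem ringCarrier_neg {x : R} (hx : x ∈ ringCarrier R S) : -x ∈ ringCarrier R S := by
  rcases hx with rfl | ⟨g, hg, rfl⟩
  · exact Or.inl neg_zero
  · exact Or.inr ⟨-1 * g, mul_mem (Subgroup.subset_closure (Or.inr rfl)) hg, by simp⟩

/-- Multiplication in `OfRing R S` is the restriction of that of `R`. -/
noncomputable instance [Nontrivial R] : CommGroupWithZero (OfRing R S) where
  mul x y := ⟨x.val * y.val, ringCarrier_mul x.mem y.mem⟩
  one := ⟨1, ringCarrier_one⟩
  zero := ⟨0, Or.inl rfl⟩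
  inv x := ⟨Ring.inverse x.val, ringCarrier_inverse x.mem⟩
  mul_assoc x y z := OfRing.ext (mul_assoc x.val y.val z.val)
  mul_comm x y := OfRing.ext (mul_comm x.val y.val)
  one_mul x := OfRing.ext (one_mul x.val)
  mul_one x := OfRing.ext (mul_one x.val)
  zero_mul x := OfRing.ext (zero_mul x.val)
  mul_zero x := OfRing.ext (mul_zero x.val)
  exists_pair_ne := ⟨⟨0, Or.inl rfl⟩, ⟨1, ringCarrier_one⟩,
    fun h => zero_ne_one (α := R) (congrArg OfRing.val h)⟩
  inv_zero := OfRing.ext (Ring.inverse_zero R)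
  mul_inv_cancel x hx := by
    refine OfRing.ext ?_
    obtain ⟨x, hx' | ⟨g, hg, rfl⟩⟩ := x
    · exact absurd (OfRing.ext hx') hx
    · exact Ring.mul_inverse_cancel _ g.isUnit

theorem association_ofRing_sum {padd : OfRing R S → OfRing R S → Part (OfRing R S)}
    (hp : ∀ p q r, r ∈ padd p q → r.val = p.val + q.val) {T : Multiset (OfRing R S)} {r : OfRing R S}
    (h : Association padd T r) : (T.map OfRing.val).sum = r.val := by
  induction h with
  | leaf p => exact Multiset.sum_singleton _
  | node _ _ hr hu hw =>
    rw [Multiset.map_add, Multiset.sum_add, hu, hw]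
    exact (hp _ _ _ hr).symm

theorem mem_ofRing_padd {p q r : OfRing R S} :
    r ∈ (⟨p.val + q.val ∈ ringCarrier R S, fun h => ⟨p.val + q.val, h⟩⟩ : Part (OfRing R S)) ↔
      r.val = p.val + q.val :=
  ⟨fun ⟨_, h⟩ => (congrArg OfRing.val h).symm,
    fun h => ⟨show p.val + q.val ∈ ringCarrier R S from h ▸ r.mem, OfRing.ext h.symm⟩⟩

/-- Addition in `OfRing R S` is the restriction of that of `R`: `p + q` is defined if and only if
the sum in `R` lies in `⟨S ∪ {-1}⟩ ∪ {0}`. -/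
noncomputable instance [Nontrivial R] : PartialField (OfRing R S) where
  neg x := ⟨-x.val, ringCarrier_neg x.mem⟩
  padd p q := ⟨p.val + q.val ∈ ringCarrier R S, fun h => ⟨p.val + q.val, h⟩⟩
  padd_zero p := Part.eq_some_iff.2 (mem_ofRing_padd.2 (add_zero p.val).symm)
  zero_mem_padd_iff p q := by
    rw [mem_ofRing_padd]
    change (0 : R) = p.val + q.val ↔ _
    rw [eq_comm, add_comm, ← eq_neg_iff_add_eq_zero]
    exact ⟨fun h => OfRing.ext h, fun h => congrArg OfRing.val h⟩
  padd_comm p q := by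
    ext r
    rw [mem_ofRing_padd, mem_ofRing_padd, add_comm]
  mul_padd p q r hp := by
    ext s
    rw [Part.mem_map_iff, mem_ofRing_padd]
    change _ ↔ s.val = p.val * q.val + p.val * r.val
    constructor
    · rintro ⟨t, ht, rfl⟩
      rw [mem_ofRing_padd] at ht
      change p.val * t.val = _
      rw [ht, mul_add]
    · intro h
      have hps : p * (p⁻¹ * s) = s := by rw [← mul_assoc, mul_inv_cancel₀ hp, one_mul]
      refine ⟨p⁻¹ * s, mem_ofRing_padd.2 ?_, hps⟩
      have hpp : (p⁻¹).val * p.val = 1 := congrArg OfRing.val (inv_mul_cancel₀ hp)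
      change (p⁻¹).val * s.val = _
      rw [h, ← mul_add, ← mul_assoc, hpp, one_mul]
  associative_law T r h T₁ T₂ u w hT h₁ h₂ := by
    have key := fun p q r : OfRing R S => (mem_ofRing_padd (p := p) (q := q) (r := r)).1
    rw [mem_ofRing_padd, ← association_ofRing_sum key h, ← hT, Multiset.map_add,
      Multiset.sum_add, association_ofRing_sum key h₁, association_ofRing_sum key h₂]

end OfRing

/-! ### The direct product of two partial fields -/

/-- The direct product `P ⊗ Q` of two partial fields, as a type. -/
@[ext]
structure DirectProduct (P : Type u) (Q : Type v) [PartialField P] [PartialField Q] :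
    Type (max u v) where
  fst : P
  snd : Q
  nonzero_iff : fst ≠ 0 ↔ snd ≠ 0

section DirectProduct

variable {P : Type u} {Q : Type v} [PartialField P] [PartialField Q]

theorem DirectProduct.eq_zero_iff (x : DirectProduct P Q) : x.fst = 0 ↔ x.snd = 0 :=
  not_iff_not.1 x.nonzero_iff

/-- Multiplication in the direct product is componentwise. -/
instance : CommGroupWithZero (DirectProduct P Q) where
  mul x y := ⟨x.fst * y.fst, x.snd * y.snd, by
    simp only [ne_eq, mul_eq_zero, x.eq_zero_iff, y.eq_zero_iff]⟩
  one := ⟨1, 1, by simp⟩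
  zero := ⟨0, 0, by simp⟩
  inv x := ⟨x.fst⁻¹, x.snd⁻¹, by simp only [ne_eq, inv_eq_zero, x.eq_zero_iff]⟩
  mul_assoc x y z := (DirectProduct.ext (mul_assoc _ _ _) (mul_assoc _ _ _))
  mul_comm x y := (DirectProduct.ext (mul_comm _ _) (mul_comm _ _))
  one_mul x := (DirectProduct.ext (one_mul _) (one_mul _))
  mul_one x := (DirectProduct.ext (mul_one _) (mul_one _))
  zero_mul x := (DirectProduct.ext (zero_mul _) (zero_mul _))
  mul_zero x := (DirectProduct.ext (mul_zero _) (mul_zero _))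
  exists_pair_ne := ⟨⟨0, 0, by simp⟩, ⟨1, 1, by simp⟩,
    fun h => zero_ne_one (α := P) (congrArg (fun x => x.fst) h)⟩
  inv_zero := (DirectProduct.ext inv_zero inv_zero)
  mul_inv_cancel x hx := by
    have h₁ : x.fst ≠ 0 := fun h => hx (DirectProduct.ext h (x.eq_zero_iff.1 h))
    exact (DirectProduct.ext (mul_inv_cancel₀ h₁) (mul_inv_cancel₀ (x.nonzero_iff.1 h₁)))

theorem neg_eq_zero_iff' (p : P) : -p = 0 ↔ p = 0 := by
  rw [eq_comm, ← zero_mem_padd_iff, padd_zero, Part.mem_some_iff, eq_comm]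

/-- Addition in the direct product is componentwise: the sum is defined if and only if both
component sums are defined, and either both or none of them are zero. -/
def DirectProduct.add (p q : DirectProduct P Q) : Part (DirectProduct P Q) where
  Dom := ∃ (h₁ : (padd p.fst q.fst).Dom) (h₂ : (padd p.snd q.snd).Dom),
    (padd p.fst q.fst).get h₁ ≠ 0 ↔ (padd p.snd q.snd).get h₂ ≠ 0
  get h := ⟨(padd p.fst q.fst).get h.1, (padd p.snd q.snd).get h.2.1, h.2.2⟩

theorem DirectProduct.mem_add {p q r : DirectProduct P Q} :
    r ∈ DirectProduct.add p q ↔ r.fst ∈ padd p.fst q.fst ∧ r.snd ∈ padd p.snd q.snd := by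
  constructor
  · rintro ⟨h, rfl⟩
    exact ⟨Part.get_mem _, Part.get_mem _⟩
  · rintro ⟨⟨h₁, e₁⟩, ⟨h₂, e₂⟩⟩
    refine ⟨⟨h₁, h₂, ?_⟩, (DirectProduct.ext e₁ e₂)⟩
    rw [e₁, e₂]
    exact r.nonzero_iff

theorem DirectProduct.association_fst {T : Multiset (DirectProduct P Q)} {r : DirectProduct P Q}
    (h : Association DirectProduct.add T r) :
    Association padd (T.map fun x => x.fst) r.fst := by
  induction h with
  | leaf p => exact Association.leaf _
  | node _ _ hr hu hw =>
    rw [Multiset.map_add]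
    exact Association.node hu hw (DirectProduct.mem_add.1 hr).1

theorem DirectProduct.association_snd {T : Multiset (DirectProduct P Q)} {r : DirectProduct P Q}
    (h : Association DirectProduct.add T r) :
    Association padd (T.map fun x => x.snd) r.snd := by
  induction h with
  | leaf p => exact Association.leaf _
  | node _ _ hr hu hw =>
    rw [Multiset.map_add]
    exact Association.node hu hw (DirectProduct.mem_add.1 hr).2

theorem mem_mul_padd {p q r s : P} (hp : p ≠ 0) :
    s ∈ padd (p * q) (p * r) ↔ p⁻¹ * s ∈ padd q r := by
  rw [← mul_padd p q r hp, Part.mem_map_iff]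
  constructor
  · rintro ⟨t, ht, rfl⟩
    rwa [inv_mul_cancel_left₀ hp]
  · intro h
    exact ⟨_, h, mul_inv_cancel_left₀ hp s⟩

/-- The direct product of two partial fields is a partial field. -/
instance : PartialField (DirectProduct P Q) where
  neg x := ⟨-x.fst, -x.snd, by simp only [ne_eq, neg_eq_zero_iff', x.eq_zero_iff]⟩
  padd := DirectProduct.add
  padd_zero p := by
    refine Part.eq_some_iff.2 (DirectProduct.mem_add.2 ⟨?_, ?_⟩)
    · change p.fst ∈ padd p.fst 0
      simp [padd_zero]
    · change p.snd ∈ padd p.snd 0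
      simp [padd_zero]
  zero_mem_padd_iff p q := by
    rw [DirectProduct.mem_add]
    change (0 : P) ∈ padd p.fst q.fst ∧ (0 : Q) ∈ padd p.snd q.snd ↔ _
    rw [zero_mem_padd_iff, zero_mem_padd_iff]
    exact ⟨fun h => (DirectProduct.ext h.1 h.2), fun h => by subst h; exact ⟨rfl, rfl⟩⟩
  padd_comm p q := by
    ext r
    rw [DirectProduct.mem_add, DirectProduct.mem_add, padd_comm p.fst, padd_comm p.snd]
  mul_padd p q r hp := by
    have h₁ : p.fst ≠ 0 := fun h => hp ((DirectProduct.ext h (p.eq_zero_iff.1 h)))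
    have h₂ : p.snd ≠ 0 := p.nonzero_iff.1 h₁
    ext s
    rw [Part.mem_map_iff, DirectProduct.mem_add]
    change _ ↔ s.fst ∈ padd (p.fst * q.fst) (p.fst * r.fst) ∧
      s.snd ∈ padd (p.snd * q.snd) (p.snd * r.snd)
    rw [mem_mul_padd h₁, mem_mul_padd h₂]
    constructor
    · rintro ⟨t, ht, rfl⟩
      have e : p⁻¹ * (p * t) = t := inv_mul_cancel_left₀ hp t
      rw [← e] at ht
      exact DirectProduct.mem_add.1 ht
    · intro h
      exact ⟨p⁻¹ * s, DirectProduct.mem_add.2 h, mul_inv_cancel_left₀ hp s⟩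
  associative_law T r h T₁ T₂ u w hT h₁ h₂ := by
    subst hT
    refine DirectProduct.mem_add.2 ⟨?_, ?_⟩
    · exact associative_law _ _ (DirectProduct.association_fst h) _ _ _ _
        (Multiset.map_add _ _ _).symm
        (DirectProduct.association_fst h₁) (DirectProduct.association_fst h₂)
    · exact associative_law _ _ (DirectProduct.association_snd h) _ _ _ _
        (Multiset.map_add _ _ _).symm
        (DirectProduct.association_snd h₁) (DirectProduct.association_snd h₂)

end DirectProduct

/-! ### Sums and determinants -/

/-- `SumsTo S r`: the sum of the elements of the finite multiset `S` is defined and equal to `r`,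
that is, `S ∪ {z₁, -z₁, …, zₖ, -zₖ}` has an association with root label `r` for some
`z₁, …, zₖ`. -/
def SumsTo {P : Type u} [PartialField P] (S : Multiset P) (r : P) : Prop :=
  ∃ Z : Multiset P, Association padd (S + (Z + Z.map fun z => -z)) r

/-- `p` for an even sign and `-p` for an odd one. -/
def signed {P : Type u} [PartialField P] (ε : ℤˣ) (p : P) : P :=
  if ε = 1 then p else -p

/-- `HasDet A d`: the determinant of the square matrix `A`, as the sum over all permutations, is
defined and equal to `d`. -/
def HasDet {P : Type u} [PartialField P] {n : ℕ} (A : Matrix (Fin n) (Fin n) P) (d : P) : Prop :=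
  SumsTo ((Finset.univ : Finset (Equiv.Perm (Fin n))).val.map
    fun σ => signed (Equiv.Perm.sign σ) (∏ i, A i (σ i))) d

/-- The determinant of `A` is defined and nonzero. -/
def HasNonzeroDet {P : Type u} [PartialField P] {n : ℕ} (A : Matrix (Fin n) (Fin n) P) : Prop :=
  ∃ d : P, d ≠ 0 ∧ HasDet A d

/-- A matrix with entries in a partial field `P` is a `P`-matrix if the determinant of every square
submatrix is defined. (The rows and columns of the submatrix may be listed in any order; this only
changes the determinant by a sign.) -/
def IsPMatrix {P : Type u} [PartialField P] {X : Type v} {Y : Type w} (A : Matrix X Y P) : Prop :=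
  ∀ (n : ℕ) (f : Fin n ↪ X) (g : Fin n ↪ Y), ∃ d : P, HasDet (A.submatrix f g) d

/-- The rank of a matrix (with finitely many rows): the largest order of a square submatrix with
nonzero determinant. -/
noncomputable def rank {P : Type u} [PartialField P] {X : Type v} {Y : Type w}
    (A : Matrix X Y P) : ℕ :=
  sSup {k : ℕ | ∃ (f : Fin k ↪ X) (g : Fin k ↪ Y), HasNonzeroDet (A.submatrix f g)}

/-! ### Representable matroids -/

/-- The sets `B` of columns with `|B| = r` for which the submatrix with all rows and with columns
`B` has nonzero determinant. -/
def bases {P : Type u} [PartialField P] {r : ℕ} {E : Type v} (A : Matrix (Fin r) E P) :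
    Set (Set E) :=
  {B | ∃ g : Fin r ↪ E, Set.range g = B ∧ HasNonzeroDet (A.submatrix id g)}

/-- A matroid `M` with ground set `E` is representable over `P` if there is an `r × E`
`P`-matrix `A` of rank `r` such that `M = M[A]`, i.e. the bases of `M` are those of `A`. -/
def IsRepresentable (P : Type u) [PartialField P] {α : Type v} (M : Matroid α) : Prop :=
  ∃ (r : ℕ) (A : Matrix (Fin r) M.E P), IsPMatrix A ∧ rank A = r ∧
    ∀ B : Set M.E, M.IsBase (Subtype.val '' B) ↔ B ∈ bases A

end PartialField

/-- The dyadic partial field: the partial field of the ring `ℚ` and the set `{2}`. -/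
abbrev DyadicPartialField : Type :=
  PartialField.OfRing ℚ {Units.mk0 (2 : ℚ) two_ne_zero}

instance fact_prime_five' : Fact (Nat.Prime 5) := ⟨by norm_num⟩

/-!
A matrix over `GF(3) ⊗ GF(5)` is lifted to `ℤ[1/2]`, which maps to `ℚ` and to every field of
characteristic other than `2`. The elements `p ≠ 0` for which `1 - p` also belongs to the partial
field (`1`, `-1`, `2` and `1/2`) lift uniquely, and such an element is what a `2 × 2` submatrix with
three or four nonzero entries amounts to after scaling. A larger connected matrix has two columns
whose deletion, separately or together, leaves it connected; the two lifts without one of these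
columns agree, after scaling, without both of them, so they can be glued. If some minor of the glued
matrix behaved differently from its image, pivoting would bring this down to two rows; when these
rows have no common nonzero column, the chains linking them are shortened by further pivots.

That sums of the ring and of the partial field agree is not automatic, since a partial sum may be
undefined. It holds as soon as `-1` and `2` generate the partial field: modulo the sums that are
defined, every formal sum is an integral multiple of some `2⁻ᵐ`.

Conversely, representations over `GF(3)` and `GF(5)` with a common identity submatrix have their
nonzero minors in the same places, since these minors are up to sign the maximal ones, and together
they form a matrix over `GF(3) ⊗ GF(5)`.
-/

namespace PartialField

open Matrix
open scoped Ring

section RingCarrier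

variable {R : Type*} [CommRing R] {S : Set Rˣ}

theorem zero_mem_ringCarrier : (0 : R) ∈ ringCarrier R S := Or.inl rfl

theorem isUnit_of_mem_ringCarrier {x : R} (hx : x ∈ ringCarrier R S) (hx₀ : x ≠ 0) :
    IsUnit x := by
  rcases hx with h | ⟨g, -, rfl⟩
  · exact absurd h hx₀
  · exact g.isUnit

theorem neg_mem_ringCarrier_iff {x : R} : -x ∈ ringCarrier R S ↔ x ∈ ringCarrier R S :=
  ⟨fun h => neg_neg x ▸ ringCarrier_neg h, ringCarrier_neg⟩

theorem sub_mem_ringCarrier_comm {x y : R} :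
    x - y ∈ ringCarrier R S ↔ y - x ∈ ringCarrier R S := by
  rw [← neg_mem_ringCarrier_iff, neg_sub]

theorem mul_mem_ringCarrier_iff {x y : R} (hx : x ∈ ringCarrier R S) (hu : IsUnit x) :
    x * y ∈ ringCarrier R S ↔ y ∈ ringCarrier R S := by
  refine ⟨fun h => ?_, ringCarrier_mul hx⟩
  rw [← Ring.inverse_mul_cancel_left x y hu]
  exact ringCarrier_mul (ringCarrier_inverse hx) h

theorem prod_mem_ringCarrier {ι : Type*} {I : Finset ι} {f : ι → R}
    (h : ∀ i ∈ I, f i ∈ ringCarrier R S) : ∏ i ∈ I, f i ∈ ringCarrier R S :=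
  Finset.prod_induction f (· ∈ ringCarrier R S) (fun _ _ => ringCarrier_mul) ringCarrier_one h

theorem sign_mul_mem_ringCarrier_iff (ε : ℤˣ) {x : R} :
    ((ε : ℤ) : R) * x ∈ ringCarrier R S ↔ x ∈ ringCarrier R S := by
  rcases Int.units_eq_one_or ε with rfl | rfl
  · simp
  · simp [neg_mem_ringCarrier_iff]

theorem neg_one_pow_mul_mem_ringCarrier (n : ℕ) {x : R} (hx : x ∈ ringCarrier R S) :
    (-1) ^ n * x ∈ ringCarrier R S := by
  rcases neg_one_pow_eq_or R n with h | h
  · rwa [h, one_mul]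
  · rw [h, neg_one_mul]
    exact ringCarrier_neg hx

end RingCarrier

section Minors

variable {R : Type*} [CommRing R] {S : Set Rˣ} {X Y : Type*}

/-- All minors of `A` with rows in `s` and columns in `t` lie in `D`. Rows and columns are listed by
arbitrary functions, so that minors with a repeated row or column are included. -/
def MinorsIn (D : Set R) (s : Set X) (t : Set Y) (A : Matrix X Y R) : Prop :=
  ∀ (n : ℕ) (f : Fin n → X) (g : Fin n → Y), (∀ i, f i ∈ s) → (∀ j, g j ∈ t) →
    (A.submatrix f g).det ∈ D

section

variable {D : Set R} {s s' : Set X} {t t' : Set Y} {A B : Matrix X Y R}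

theorem MinorsIn.mono (h : MinorsIn D s t A) (hs : s' ⊆ s) (ht : t' ⊆ t) :
    MinorsIn D s' t' A :=
  fun n f g hf hg => h n f g (fun i => hs (hf i)) fun i => ht (hg i)

theorem MinorsIn.congr (h : MinorsIn D s t A) (hAB : ∀ x ∈ s, ∀ y ∈ t, A x y = B x y) :
    MinorsIn D s t B := by
  intro n f g hf hg
  have hsub : A.submatrix f g = B.submatrix f g := ext fun i j => hAB _ (hf i) _ (hg j)
  exact hsub ▸ h n f g hf hg

theorem MinorsIn.transpose (h : MinorsIn D s t A) : MinorsIn D t s Aᵀ := by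
  intro n f g hf hg
  rw [← det_transpose]
  exact h n g f hg hf

theorem MinorsIn.entry (h : MinorsIn D s t A) {x : X} (hx : x ∈ s) {y : Y} (hy : y ∈ t) :
    A x y ∈ D := by
  simpa using h 1 (fun _ => x) (fun _ => y) (fun _ => hx) (fun _ => hy)

theorem MinorsIn.two (h : MinorsIn D s t A) {x z : X} (hx : x ∈ s) (hz : z ∈ s) {y w : Y}
    (hy : y ∈ t) (hw : w ∈ t) : A x y * A z w - A x w * A z y ∈ D := by
  have hdet := h 2 ![x, z] ![y, w] (by simp [Fin.forall_fin_two, hx, hz])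
    (by simp [Fin.forall_fin_two, hy, hw])
  rw [det_fin_two] at hdet
  simpa using hdet

theorem det_submatrix_eq_zero_of_not_injective {n : ℕ} {f : Fin n → X} {g : Fin n → Y}
    (h : ¬ (Function.Injective f ∧ Function.Injective g)) : (A.submatrix f g).det = 0 := by
  simp only [not_and_or, Function.Injective, not_forall] at h
  obtain ⟨i, j, hij, hne⟩ | ⟨i, j, hij, hne⟩ := h
  · exact det_zero_of_row_eq hne (by ext k; simp [hij])
  · exact det_zero_of_column_eq hne (by simp [hij])

end

section

variable {s : Set X} {t : Set Y} {A : Matrix X Y R}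

theorem MinorsIn.scale (h : MinorsIn (ringCarrier R S) s t A) {r : X → R} {c : Y → R}
    (hr : ∀ x, r x ∈ ringCarrier R S) (hc : ∀ y, c y ∈ ringCarrier R S) :
    MinorsIn (ringCarrier R S) s t (of fun x y => r x * A x y * c y) := by
  intro n f g hf hg
  have hsub : (of fun x y => r x * A x y * c y).submatrix f g =
      diagonal (r ∘ f) * A.submatrix f g * diagonal (c ∘ g) := by
    ext i j
    simp [mul_diagonal, diagonal_mul]
  rw [hsub, det_mul, det_mul, det_diagonal, det_diagonal]
  exact ringCarrier_mul (ringCarrier_mul (prod_mem_ringCarrier fun i _ => hr _) (h n f g hf hg))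
    (prod_mem_ringCarrier fun i _ => hc _)

theorem minorsIn_pair {u v : Y} (hu : ∀ x ∈ s, A x u ∈ ringCarrier R S)
    (hv : ∀ x ∈ s, A x v ∈ ringCarrier R S)
    (huv : ∀ x ∈ s, ∀ z ∈ s, A x u * A z v - A x v * A z u ∈ ringCarrier R S) :
    MinorsIn (ringCarrier R S) s {u, v} A := by
  intro n f g hf hg
  by_cases hinj : Function.Injective f ∧ Function.Injective g
  swap
  · rw [det_submatrix_eq_zero_of_not_injective hinj]
    exact zero_mem_ringCarrier
  have hcard : n ≤ 2 := by
    classical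
    have himage : Finset.univ.image g ⊆ {u, v} := by
      intro y hy
      obtain ⟨j, -, rfl⟩ := Finset.mem_image.1 hy
      simpa using hg j
    simpa [Finset.card_image_of_injective _ hinj.2] using
      (Finset.card_le_card himage).trans Finset.card_le_two
  interval_cases n
  · rw [det_fin_zero]
    exact ringCarrier_one
  · rw [det_fin_one, submatrix_apply]
    rcases hg 0 with h₀ | h₀ <;> rw [h₀]
    exacts [hu _ (hf 0), hv _ (hf 0)]
  · have hne : g 0 ≠ g 1 := hinj.2.ne zero_ne_one
    rw [det_fin_two]
    simp only [submatrix_apply]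
    rcases hg 0 with h₀ | h₀ <;> rcases hg 1 with h₁ | h₁
    · exact absurd (h₀.trans h₁.symm) hne
    · rw [h₀, h₁]
      exact huv _ (hf 0) _ (hf 1)
    · rw [h₀, h₁, sub_mem_ringCarrier_comm]
      exact huv _ (hf 0) _ (hf 1)
    · exact absurd (h₀.trans h₁.symm) hne

theorem MinorsIn.insert_unit_column (h : MinorsIn (ringCarrier R S) s t A) {x₀ : X} {y₀ : Y}
    (h₀ : ∀ x ∈ s, x ≠ x₀ → A x y₀ = 0) (h₁ : A x₀ y₀ ∈ ringCarrier R S) :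
    MinorsIn (ringCarrier R S) s (insert y₀ t) A := by
  intro n
  induction n with
  | zero =>
    intro f g _ _
    rw [det_fin_zero]
    exact ringCarrier_one
  | succ n ih =>
    intro f g hf hg
    by_cases hinj : Function.Injective f ∧ Function.Injective g
    swap
    · rw [det_submatrix_eq_zero_of_not_injective hinj]
      exact zero_mem_ringCarrier
    by_cases hgt : ∀ i, g i ∈ t
    · exact h _ f g hf hgt
    obtain ⟨j, hj⟩ := not_forall.1 hgt
    obtain rfl : g j = y₀ := (hg j).resolve_right hj
    rw [det_succ_column _ j]
    by_cases hx : ∃ i, f i = x₀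
    · obtain ⟨i, rfl⟩ := hx
      rw [Finset.sum_eq_single i _ (by simp), mul_assoc]
      · exact neg_one_pow_mul_mem_ringCarrier _ (ringCarrier_mul h₁
          (ih (f ∘ i.succAbove) (g ∘ j.succAbove) (fun _ => hf _) fun _ => hg _))
      · intro k _ hk
        simp [h₀ _ (hf k) (hinj.1.ne hk)]
    · rw [Finset.sum_eq_zero fun k _ => by simp [h₀ _ (hf k) fun hk => hx ⟨k, hk⟩]]
      exact zero_mem_ringCarrier

theorem MinorsIn.insert_unit_row (h : MinorsIn (ringCarrier R S) s t A) {x₀ : X} {y₀ : Y}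
    (h₀ : ∀ y ∈ t, y ≠ y₀ → A x₀ y = 0) (h₁ : A x₀ y₀ ∈ ringCarrier R S) :
    MinorsIn (ringCarrier R S) (insert x₀ s) t A :=
  (h.transpose.insert_unit_column h₀ h₁).transpose

end

end Minors

section Pivot

variable {R : Type*} [CommRing R] {S : Set Rˣ} {X Y : Type*} {A : Matrix X Y R}
  {x i : X} {y j : Y}

open Classical in
/-- The matrix obtained from `A` by pivoting on the entry `A x y`: if `[I A]` represents a matroid,
then `[I (pivot A x y)]` represents it as well, with the basis elements `x` and `y` exchanged. It is
meaningful only if `A x y` is a unit. -/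
noncomputable def pivot (A : Matrix X Y R) (x : X) (y : Y) : Matrix X Y R :=
  of fun i j =>
    if i = x then if j = y then (A x y)⁻¹ʳ else (A x y)⁻¹ʳ * A x j
    else if j = y then -(A i y * (A x y)⁻¹ʳ) else A i j - A i y * (A x y)⁻¹ʳ * A x j

theorem pivot_apply_of_ne (A : Matrix X Y R) (hi : i ≠ x) (hj : j ≠ y) :
    pivot A x y i j = A i j - A i y * (A x y)⁻¹ʳ * A x j := by
  simp [pivot, hi, hj]

theorem pivot_apply_row (A : Matrix X Y R) (hj : j ≠ y) :
    pivot A x y x j = (A x y)⁻¹ʳ * A x j := by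
  simp [pivot, hj]

theorem pivot_apply_col (A : Matrix X Y R) (hi : i ≠ x) :
    pivot A x y i y = -(A i y * (A x y)⁻¹ʳ) := by
  simp [pivot, hi]

theorem pivot_apply_self (A : Matrix X Y R) : pivot A x y x y = (A x y)⁻¹ʳ := by
  simp [pivot]

theorem pivot_apply_of_row_eq_zero (hj : j ≠ y) (h : A x j = 0) : pivot A x y i j = A i j := by
  by_cases hi : i = x
  · rw [hi, pivot_apply_row _ hj, h, mul_zero]
  · rw [pivot_apply_of_ne _ hi hj, h, mul_zero, sub_zero]

theorem pivot_apply_of_col_eq_zero (hi : i ≠ x) (h : A i y = 0) : pivot A x y i j = A i j := by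
  by_cases hj : j = y
  · rw [hj, pivot_apply_col _ hi, h, zero_mul, neg_zero]
  · rw [pivot_apply_of_ne _ hi hj, h, zero_mul, zero_mul, sub_zero]

theorem pivot_congr {B : Matrix X Y R} (hxy : A x y = B x y) (hij : A i j = B i j)
    (hiy : A i y = B i y) (hxj : A x j = B x j) : pivot A x y i j = pivot B x y i j := by
  simp only [pivot, of_apply, hxy, hij, hiy, hxj]

theorem map_ringInverse_of_isUnit {K : Type*} [CommRing K] (π : R →+* K) {a : R}
    (ha : IsUnit a) : π a⁻¹ʳ = (π a)⁻¹ʳ := by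
  obtain ⟨u, rfl⟩ := ha
  rw [Ring.inverse_unit]
  exact (Ring.inverse_unit (Units.map (π : R →* K) u)).symm

theorem pivot_map {K : Type*} [CommRing K] (π : R →+* K) (h : IsUnit (A x y)) :
    (pivot A x y).map π = pivot (A.map π) x y := by
  ext i j
  simp only [pivot, map_apply, of_apply, ← map_ringInverse_of_isUnit π h]
  split_ifs <;> simp

theorem pivot_pivot (h : IsUnit (A x y)) : pivot (pivot A x y) x y = A := by
  have hinv := Ring.mul_inverse_cancel _ h
  ext i j
  by_cases hi : i = x <;> by_cases hj : j = y
  · subst hi hj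
    rw [pivot_apply_self, pivot_apply_self, Ring.inverse_inverse h]
  · subst hi
    rw [pivot_apply_row _ hj, pivot_apply_row _ hj, pivot_apply_self, Ring.inverse_inverse h,
      ← mul_assoc, hinv, one_mul]
  · subst hj
    rw [pivot_apply_col _ hi, pivot_apply_col _ hi, pivot_apply_self, Ring.inverse_inverse h]
    linear_combination A i j * hinv
  · rw [pivot_apply_of_ne _ hi hj, pivot_apply_of_ne _ hi hj, pivot_apply_col _ hi,
      pivot_apply_row _ hj, pivot_apply_self, Ring.inverse_inverse h]
    linear_combination A i y * (A x y)⁻¹ʳ * A x j * hinv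

theorem det_eq_mul_det_schur_complement {n : ℕ} {M : Matrix (Fin (n + 1)) (Fin (n + 1)) R}
    (h : IsUnit (M 0 0)) :
    M.det = M 0 0 *
      (of fun i j : Fin n => M i.succ j.succ - M i.succ 0 * (M 0 0)⁻¹ʳ * M 0 j.succ).det := by
  have hrow : M.det = (of fun i j =>
      M i j + (if i = 0 then 0 else -M i 0 * (M 0 0)⁻¹ʳ) * M 0 j).det :=
    (det_eq_of_forall_row_eq_smul_add_const
      (fun i => if i = 0 then 0 else -M i 0 * (M 0 0)⁻¹ʳ) 0 (by simp) fun i j => by simp).symm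
  rw [hrow, det_succ_column_zero, Finset.sum_eq_single 0 _ (by simp)]
  · simp only [Fin.val_zero, pow_zero, of_apply, if_true, zero_mul, add_zero, one_mul]
    congr 2
    ext i j
    simp only [submatrix_apply, of_apply, Fin.zero_succAbove, Fin.succ_ne_zero, if_false]
    ring
  · intro i _ hi
    have hclear : M i 0 + -M i 0 * (M 0 0)⁻¹ʳ * M 0 0 = 0 := by
      linear_combination -M i 0 * Ring.inverse_mul_cancel _ h
    simp only [of_apply, hi, if_false, hclear, mul_zero, zero_mul]

theorem det_submatrix_cons_eq_mul_det_pivot (h : IsUnit (A x y)) {n : ℕ} {f : Fin n → X}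
    {g : Fin n → Y} (hf : ∀ i, f i ≠ x) (hg : ∀ j, g j ≠ y) :
    (A.submatrix (Fin.cons x f : Fin (n + 1) → X) (Fin.cons y g : Fin (n + 1) → Y)).det =
      A x y * ((pivot A x y).submatrix f g).det := by
  rw [det_eq_mul_det_schur_complement (by simpa using h)]
  congr 2
  ext i j
  simp [pivot_apply_of_ne _ (hf i) (hg j)]

open Classical in
/-- The matrix `A` bordered by a unit column with its `1` in row `x`, and by the negative of a unit
row with its `-1` in column `y`. Every minor of `pivot A x y` is, up to the factor `A x y`, a minor
of this matrix: a row or column of the pivot is represented by its new counterpart `none`. -/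
noncomputable def pivotBorder (A : Matrix X Y R) (x : X) (y : Y) :
    Matrix (Option X) (Option Y) R :=
  of fun i j => i.elim (j.elim 0 fun j => if j = y then -1 else 0)
    fun i => j.elim (if i = x then 1 else 0) fun j => A i j

theorem MinorsIn.pivotBorder {s : Set X} {t : Set Y} (h : MinorsIn (ringCarrier R S) s t A)
    (x : X) (y : Y) :
    MinorsIn (ringCarrier R S) (insert none (some '' s)) (insert none (some '' t))
      (pivotBorder A x y) := by
  have hA : MinorsIn (ringCarrier R S) (some '' s) (some '' t)
      (PartialField.pivotBorder A x y) := by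
    intro n f g hf hg
    choose f' hf' hff using hf
    choose g' hg' hgg using hg
    have hsub : (PartialField.pivotBorder A x y).submatrix f g = A.submatrix f' g' := by
      ext i j
      simp [PartialField.pivotBorder, ← hff, ← hgg]
    exact hsub ▸ h n f' g' hf' hg'
  refine (hA.insert_unit_column (x₀ := some x) ?_ ?_).insert_unit_row (y₀ := some y) ?_ ?_
  · rintro _ ⟨i, -, rfl⟩ hi
    have hix : i ≠ x := fun h => hi (h ▸ rfl)
    simp [PartialField.pivotBorder, hix]
  · simpa [PartialField.pivotBorder] using ringCarrier_one
  · rintro _ (rfl | ⟨j, -, rfl⟩) hj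
    · simp [PartialField.pivotBorder]
    · have hjy : j ≠ y := fun h => hj (h ▸ rfl)
      simp [PartialField.pivotBorder, hjy]
  · simpa [PartialField.pivotBorder] using ringCarrier_neg ringCarrier_one

open Classical in
theorem det_pivotBorder_submatrix (h : IsUnit (A x y)) {n : ℕ} (f : Fin n → X) (g : Fin n → Y) :
    ((pivotBorder A x y).submatrix
      (Fin.cons (some x) fun i => if f i = x then none else some (f i) : Fin (n + 1) → Option X)
      (Fin.cons (some y) fun j => if g j = y then none else some (g j) :
        Fin (n + 1) → Option Y)).det =
      A x y * ((pivot A x y).submatrix f g).det := by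
  rw [det_eq_mul_det_schur_complement (by simpa [pivotBorder] using h)]
  congr 2
  ext i j
  by_cases hi : f i = x <;> by_cases hj : g j = y <;> simp [pivotBorder, pivot, hi, hj]

theorem MinorsIn.pivot {s : Set X} {t : Set Y} (h : MinorsIn (ringCarrier R S) s t A)
    (hx : x ∈ s) (hy : y ∈ t) (hu : IsUnit (A x y)) :
    MinorsIn (ringCarrier R S) s t (pivot A x y) := by
  classical
  intro n f g hf hg
  rw [← mul_mem_ringCarrier_iff (h.entry hx hy) hu, ← det_pivotBorder_submatrix hu]
  refine h.pivotBorder x y _ _ _ (Fin.cases ?_ fun i => ?_) (Fin.cases ?_ fun j => ?_)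
  · exact Or.inr ⟨x, hx, rfl⟩
  · by_cases hi : f i = x
    · simp [hi]
    · simp [hi, hf i]
  · exact Or.inr ⟨y, hy, rfl⟩
  · by_cases hj : g j = y
    · simp [hj]
    · simp [hj, hg j]

theorem cons_comp_succAbove {Z : Type*} {n : ℕ} (f : Fin (n + 1) → Z) (k : Fin (n + 1)) :
    (Fin.cons (f k) (f ∘ k.succAbove) : Fin (n + 1) → Z) = f ∘ k.cycleRange.symm := by
  ext i
  cases i using Fin.cases <;> simp

theorem det_submatrix_mem_ringCarrier_iff_cons_succAbove {n : ℕ} (f : Fin (n + 1) → X)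
    (g : Fin (n + 1) → Y) (k l : Fin (n + 1)) :
    (A.submatrix f g).det ∈ ringCarrier R S ↔
      (A.submatrix (Fin.cons (f k) (f ∘ k.succAbove) : Fin (n + 1) → X)
        (Fin.cons (g l) (g ∘ l.succAbove) : Fin (n + 1) → Y)).det ∈ ringCarrier R S := by
  have hsub : A.submatrix (f ∘ k.cycleRange.symm) (g ∘ l.cycleRange.symm) =
      ((A.submatrix f g).submatrix k.cycleRange.symm id).submatrix id l.cycleRange.symm := rfl
  rw [cons_comp_succAbove f k, cons_comp_succAbove g l, hsub, det_permute', det_permute,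
    sign_mul_mem_ringCarrier_iff, sign_mul_mem_ringCarrier_iff]

theorem det_submatrix_mem_of_pivot {n : ℕ} {f : Fin (n + 1) → X} {g : Fin (n + 1) → Y}
    (hf : Function.Injective f) (hg : Function.Injective g) (k l : Fin (n + 1))
    (hA : A (f k) (g l) ∈ ringCarrier R S) (hu : IsUnit (A (f k) (g l)))
    (h : ((pivot A (f k) (g l)).submatrix (f ∘ k.succAbove) (g ∘ l.succAbove)).det ∈
      ringCarrier R S) :
    (A.submatrix f g).det ∈ ringCarrier R S := by
  rw [det_submatrix_mem_ringCarrier_iff_cons_succAbove f g k l,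
    det_submatrix_cons_eq_mul_det_pivot (f := f ∘ k.succAbove) (g := g ∘ l.succAbove) hu
      (fun i => hf.ne (k.succAbove_ne i)) fun j => hg.ne (l.succAbove_ne j)]
  exact ringCarrier_mul hA h

theorem det_submatrix_mem_of_forall_pivot {n : ℕ} {f : Fin (n + 1) → X} {g : Fin (n + 1) → Y}
    (l : Fin (n + 1)) (hA : ∀ k, A (f k) (g l) ∈ ringCarrier R S)
    (h : ∀ k, IsUnit (A (f k) (g l)) →
      ((pivot A (f k) (g l)).submatrix (f ∘ k.succAbove) (g ∘ l.succAbove)).det ∈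
        ringCarrier R S) :
    (A.submatrix f g).det ∈ ringCarrier R S := by
  by_cases hinj : Function.Injective f ∧ Function.Injective g
  swap
  · rw [det_submatrix_eq_zero_of_not_injective hinj]
    exact zero_mem_ringCarrier
  by_cases hcol : ∀ k, A (f k) (g l) = 0
  · rw [det_eq_zero_of_column_eq_zero l hcol]
    exact zero_mem_ringCarrier
  · obtain ⟨k, hk⟩ := not_forall.1 hcol
    have hunit := isUnit_of_mem_ringCarrier (hA k) hk
    exact det_submatrix_mem_of_pivot hinj.1 hinj.2 k l (hA k) hunit (h k hunit)

end Pivot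

section Connectivity

variable {R : Type*} [Zero R] {X Y : Type*} {A : Matrix X Y R} {s : Set X} {t : Set Y}

/-- The bipartite graph of the nonzero entries of `A` with rows in `s` and columns in `t` is
connected. This is expressed without paths: a nonempty set of rows and columns that is closed under
adjacency is everything. -/
def ConnOn (A : Matrix X Y R) (s : Set X) (t : Set Y) : Prop :=
  ∀ S ⊆ s, ∀ T ⊆ t, (S.Nonempty ∨ T.Nonempty) →
    (∀ x ∈ s, ∀ y ∈ t, A x y ≠ 0 → (x ∈ S ↔ y ∈ T)) → S = s ∧ T = t

theorem ConnOn.transpose (h : ConnOn A s t) : ConnOn Aᵀ t s := fun T hT S hS hne hST =>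
  (h S hS T hT hne.symm fun x hx y hy hxy => (hST y hy x hx hxy).symm).symm

theorem ConnOn.congr {R' : Type*} [Zero R'] {B : Matrix X Y R'} (h : ConnOn A s t)
    (hAB : ∀ x ∈ s, ∀ y ∈ t, A x y ≠ 0 → B x y ≠ 0) : ConnOn B s t :=
  fun S hS T hT hne hST => h S hS T hT hne fun x hx y hy hxy => hST x hx y hy (hAB x hx y hy hxy)

/-- There is a chain of `n + 1` rows in `s` from `x` to `z`, any two consecutive ones of which share
a column in `t` where both are nonzero. -/
inductive Linked (A : Matrix X Y R) (s : Set X) (t : Set Y) : ℕ → X → X → Prop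
  | refl (x : X) : x ∈ s → Linked A s t 0 x x
  | step {n : ℕ} {x p z : X} {y : Y} : x ∈ s → y ∈ t → A x y ≠ 0 → A p y ≠ 0 →
      Linked A s t n p z → Linked A s t (n + 1) x z

variable {n : ℕ} {x z : X}

theorem Linked.left_mem (h : Linked A s t n x z) : x ∈ s := by
  cases h <;> assumption

theorem Linked.right_mem (h : Linked A s t n x z) : z ∈ s := by
  induction h <;> assumption

theorem Linked.eq (h : Linked A s t 0 x z) : x = z := by
  cases h
  rfl

theorem Linked.exists_step (h : Linked A s t (n + 1) x z) :
    ∃ p, ∃ y ∈ t, A x y ≠ 0 ∧ A p y ≠ 0 ∧ Linked A s t n p z := by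
  cases h with
  | step _ hy hxy hpy hp => exact ⟨_, _, hy, hxy, hpy, hp⟩

theorem Linked.exists_common_column (h : Linked A s t 1 x z) :
    ∃ y ∈ t, A x y ≠ 0 ∧ A z y ≠ 0 := by
  obtain ⟨p, y, hy, hxy, hpy, hp⟩ := h.exists_step
  exact ⟨y, hy, hxy, hp.eq ▸ hpy⟩

theorem ConnOn.exists_linked (h : ConnOn A s t) (hx : x ∈ s) (hz : z ∈ s) :
    ∃ n, Linked A s t n x z := by
  let S : Set X := {x | ∃ n, Linked A s t n x z}
  let T : Set Y := {y ∈ t | ∃ x ∈ S, A x y ≠ 0}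
  have hS : S = s :=
    (h S (fun x ⟨n, hn⟩ => hn.left_mem) T (fun y hy => hy.1) (Or.inl ⟨z, 0, .refl z hz⟩)
      fun i hi j hj hij => ⟨fun hiS => ⟨hj, i, hiS, hij⟩,
        fun ⟨_, p, ⟨n, hn⟩, hpj⟩ => ⟨n + 1, .step hi hj hij hpj hn⟩⟩).1
  rw [← hS] at hx
  exact hx

theorem ConnOn.insert_column (h : ConnOn A s t) (hx : x ∈ s) {y : Y} (hxy : A x y ≠ 0) :
    ConnOn A s (insert y t) := by
  intro S hS T hT hne hST
  have hxS : x ∈ S ↔ y ∈ T := hST x hx y (Set.mem_insert _ _) hxy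
  have hne' : S.Nonempty ∨ (T ∩ t).Nonempty := by
    refine or_iff_not_imp_left.2 fun hS₀ => ?_
    obtain ⟨j, hj⟩ := hne.resolve_left hS₀
    refine ⟨j, hj, (hT hj).resolve_left ?_⟩
    rintro rfl
    exact hS₀ ⟨x, hxS.2 hj⟩
  obtain ⟨rfl, hTt⟩ := h S hS (T ∩ t) Set.inter_subset_right hne' fun i hi j hj hij => by
    rw [hST i hi j (Set.mem_insert_of_mem _ hj) hij, Set.mem_inter_iff, and_iff_left hj]
  exact ⟨rfl, hT.antisymm (Set.insert_subset (hxS.1 hx) (Set.inter_eq_right.1 hTt))⟩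

theorem ConnOn.insert_row (h : ConnOn A s t) {y : Y} (hy : y ∈ t) (hxy : A x y ≠ 0) :
    ConnOn A (insert x s) t :=
  (h.transpose.insert_column hy hxy).transpose

theorem connOn_singleton_row (h : ∀ y ∈ t, A x y ≠ 0) : ConnOn A {x} t := by
  intro S hS T hT hne hST
  have hxy : ∀ y ∈ t, x ∈ S ↔ y ∈ T := fun y hy => hST x rfl y hy (h y hy)
  have hx : x ∈ S := by
    obtain ⟨z, hz⟩ | ⟨y, hy⟩ := hne
    · exact hS hz ▸ hz
    · exact (hxy y (hT hy)).2 hy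
  exact ⟨hS.antisymm (Set.singleton_subset_iff.2 hx), hT.antisymm fun y hy => (hxy y hy).1 hx⟩

theorem ConnOn.induction_on {Q : Set X → Set Y → Prop} (h : ConnOn A s t) (hs : s.Finite)
    (ht : t.Finite) {s₀ : Set X} (hs₀ : s₀ ⊆ s) {t₀ : Set Y} (ht₀ : t₀ ⊆ t) (hne : s₀.Nonempty)
    (base : Q s₀ t₀)
    (insert_row : ∀ ⦃S T p y⦄, insert p S ⊆ s → T ⊆ t → p ∉ S → y ∈ T → A p y ≠ 0 → Q S T →
      Q (insert p S) T)
    (insert_column : ∀ ⦃S T p y⦄, S ⊆ s → insert y T ⊆ t → p ∈ S → y ∉ T → A p y ≠ 0 → Q S T →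
      Q S (insert y T)) : Q s t := by
  let C : Set (Set X × Set Y) := {q | (q.1 ⊆ s ∧ q.2 ⊆ t) ∧ q.1.Nonempty ∧ Q q.1 q.2}
  have hC : C.Finite :=
    (hs.finite_subsets.prod ht.finite_subsets).subset fun q hq => Set.mem_prod.2 hq.1
  obtain ⟨⟨S, T⟩, ⟨⟨hS, hT⟩, hne, hQ⟩, hmax⟩ :=
    hC.exists_maximal ⟨(s₀, t₀), ⟨hs₀, ht₀⟩, hne, base⟩
  obtain ⟨rfl, rfl⟩ := h S hS T hT (.inl hne) fun p hp y hy hpy => by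
    refine ⟨fun hpS => ?_, fun hyT => ?_⟩
    · by_contra hyT
      have hyt : insert y T ⊆ t := Set.insert_subset hy hT
      exact hyT ((hmax (y := (S, insert y T))
        ⟨⟨hS, hyt⟩, hne, insert_column hS hyt hpS hyT hpy hQ⟩
        ⟨subset_rfl, Set.subset_insert y T⟩).2 (Set.mem_insert y T))
    · by_contra hpS
      have hps : insert p S ⊆ s := Set.insert_subset hp hS
      exact hpS ((hmax (y := (insert p S, T))
        ⟨⟨hps, hT⟩, Set.insert_nonempty p S, insert_row hps hT hpS hyT hpy hQ⟩
        ⟨Set.subset_insert p S, subset_rfl⟩).1 (Set.mem_insert p S))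
  exact hQ

/-- Any rows from `M` and columns from `N` can be deleted without disconnecting `A` on `s × t`. -/
def Removable (A : Matrix X Y R) (s : Set X) (t : Set Y) (M : Set X) (N : Set Y) : Prop :=
  ∀ M' ⊆ M, ∀ N' ⊆ N, ConnOn A (s \ M') (t \ N')

variable {M : Set X} {N : Set Y}

theorem Removable.transpose (h : Removable A s t M N) : Removable Aᵀ t s N M :=
  fun N' hN' M' hM' => (h M' hM' N' hN').transpose

theorem Removable.insert_row (h : Removable A s t M N) {p : X} (hp : p ∉ s) {y : Y} (hy : y ∈ t)
    (hpy : A p y ≠ 0) : Removable A (insert p s) t (insert p M) (N \ {y}) := by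
  intro M' hM' N' hN'
  have hN'N : N' ⊆ N := hN'.trans Set.sdiff_subset
  by_cases hpM : p ∈ M'
  · rw [show insert p s \ M' = s \ (M' \ {p}) by ext i; grind]
    exact h _ (Set.sdiff_singleton_subset_iff.2 hM') N' hN'N
  · rw [Set.insert_sdiff_of_notMem s hpM]
    exact (h M' ((Set.subset_insert_iff_of_notMem hpM).1 hM') N' hN'N).insert_row
      ⟨hy, fun hyN => (hN' hyN).2 rfl⟩ hpy

theorem Removable.insert_column (h : Removable A s t M N) {p : X} (hp : p ∈ s) {y : Y} (hy : y ∉ t)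
    (hpy : A p y ≠ 0) : Removable A s (insert y t) (M \ {p}) (insert y N) :=
  (h.transpose.insert_row hy hp hpy).transpose

-- Grow `s × t` from the star at `x`; each new vertex takes over from the neighbour it is attached
-- to.
theorem ConnOn.exists_removable (h : ConnOn A s t) (hs : s.Finite) (ht : t.Finite) (hx : x ∈ s)
    (hN : N ⊆ t) (hxN : ∀ y ∈ N, A x y ≠ 0) :
    ∃ M ⊆ s, ∃ N' ⊆ t, Removable A s t M N' ∧ N.encard ≤ M.encard + N'.encard := by
  refine h.induction_on (Q := fun s t => ∃ M ⊆ s, ∃ N' ⊆ t, Removable A s t M N' ∧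
    N.encard ≤ M.encard + N'.encard) hs ht (Set.singleton_subset_iff.2 hx) hN
    (Set.singleton_nonempty x) ?_ ?_ ?_
  · refine ⟨∅, Set.empty_subset _, N, subset_rfl, fun M' hM' N' _ => ?_, by simp⟩
    rw [Set.subset_empty_iff.1 hM', Set.sdiff_empty]
    exact connOn_singleton_row fun y hy => hxN y hy.1
  · rintro S T p y - - hp hy hpy ⟨M, hM, N', hN', hrem, hcard⟩
    refine ⟨insert p M, Set.insert_subset_insert hM, N' \ {y}, Set.sdiff_subset.trans hN',
      hrem.insert_row hp hy hpy, hcard.trans ?_⟩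
    rw [Set.encard_insert_of_notMem fun hpM => hp (hM hpM), add_assoc, add_comm 1]
    gcongr
    exact tsub_le_iff_right.1 (Set.encard_tsub_one_le_encard_sdiff_singleton N' y)
  · rintro S T p y - - hp hy hpy ⟨M, hM, N', hN', hrem, hcard⟩
    refine ⟨M \ {p}, Set.sdiff_subset.trans hM, insert y N', Set.insert_subset_insert hN',
      hrem.insert_column hp hy hpy, hcard.trans ?_⟩
    rw [Set.encard_insert_of_notMem fun hyN => hy (hN' hyN), add_comm N'.encard, ← add_assoc]
    gcongr
    exact tsub_le_iff_right.1 (Set.encard_tsub_one_le_encard_sdiff_singleton M p)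

theorem ConnOn.exists_two_removable (h : ConnOn A s t) (hs : s.Finite) (ht : t.Finite) (hx : x ∈ s)
    (hN : N ⊆ t) (hxN : ∀ y ∈ N, A x y ≠ 0) (hcard : 2 < N.encard) :
    (∃ u ∈ s, ∃ v ∈ s, u ≠ v ∧ ConnOn A (s \ {u, v}) t) ∨
      ∃ u ∈ t, ∃ v ∈ t, u ≠ v ∧ ConnOn A s (t \ {u, v}) := by
  obtain ⟨M, hM, N', hN', hrem, hle⟩ := h.exists_removable hs ht hx hN hxN
  obtain hc | hc : 1 < M.encard ∨ 1 < N'.encard := by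
    by_contra! hc
    exact ((hcard.trans_le hle).trans_le (add_le_add hc.1 hc.2)).ne (by norm_num)
  · obtain ⟨u, v, hu, hv, huv⟩ := Set.one_lt_encard_iff.1 hc
    refine .inl ⟨u, hM hu, v, hM hv, huv, ?_⟩
    simpa using hrem {u, v} (Set.pair_subset hu hv) ∅ (Set.empty_subset _)
  · obtain ⟨u, v, hu, hv, huv⟩ := Set.one_lt_encard_iff.1 hc
    refine .inr ⟨u, hN' hu, v, hN' hv, huv, ?_⟩
    simpa using hrem ∅ (Set.empty_subset _) {u, v} (Set.pair_subset hu hv)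

theorem ConnOn.exists_row_nonzero_at_two (h : ConnOn A s t) (ht : t.Nontrivial) {y : Y}
    (hy : y ∈ t) : ∃ x ∈ s, ∃ w ∈ t, w ≠ y ∧ A x y ≠ 0 ∧ A x w ≠ 0 := by
  by_contra! hno
  refine ht.ne_singleton (x := y) (h {x ∈ s | A x y ≠ 0} (Set.sep_subset _ _) {y}
    (Set.singleton_subset_iff.2 hy) (.inr (Set.singleton_nonempty y))
    fun i hi j hj hij => ?_).2.symm
  refine ⟨fun hiS => ?_, ?_⟩
  · by_contra hjy
    exact hij (hno i hi j hj hjy hiS.2)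
  · rintro rfl
    exact ⟨hi, hij⟩

theorem ConnOn.exists_path (h : ConnOn A s t) (hs : s.Nontrivial) (ht : t.Nontrivial) :
    ∃ x ∈ s, ∃ z ∈ s, ∃ y ∈ t, ∃ w ∈ t, x ≠ z ∧ y ≠ w ∧ A x y ≠ 0 ∧ A x w ≠ 0 ∧ A z y ≠ 0 := by
  obtain ⟨x₀, hx₀⟩ := hs.nonempty
  obtain ⟨y, hy, x₁, hx₁, hne, hx₀y, hx₁y⟩ := h.transpose.exists_row_nonzero_at_two hs hx₀
  obtain ⟨x, hx, w, hw, hwy, hxy, hxw⟩ := h.exists_row_nonzero_at_two ht hy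
  obtain hxx₀ | rfl := ne_or_eq x x₀
  · exact ⟨x, hx, x₀, hx₀, y, hy, w, hw, hxx₀, hwy.symm, hxy, hxw, hx₀y⟩
  · exact ⟨x, hx, x₁, hx₁, y, hy, w, hw, hne.symm, hwy.symm, hxy, hxw, hx₁y⟩

end Connectivity

section PivotConnectivity

variable {R : Type*} [CommRing R] {S : Set Rˣ} {X Y : Type*} {A : Matrix X Y R} {s : Set X}
  {t : Set Y}

theorem ConnOn.pivot [Nontrivial R] (h : ConnOn A s t) {x : X} (hx : x ∈ s) {y : Y} (hy : y ∈ t)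
    (hu : IsUnit (A x y)) : ConnOn (pivot A x y) s t := by
  intro S hS T hT hne hST
  have hrow : ∀ j ∈ t, A x j ≠ 0 → (x ∈ S ↔ j ∈ T) := by
    intro j hj hAj
    refine hST x hx j hj ?_
    by_cases hjy : j = y
    · rw [hjy, pivot_apply_self]
      exact hu.ringInverse.ne_zero
    · rwa [pivot_apply_row _ hjy, Ne, hu.ringInverse.mul_right_eq_zero]
  have hcol : ∀ i ∈ s, A i y ≠ 0 → (i ∈ S ↔ y ∈ T) := by
    intro i hi hAi
    by_cases hix : i = x
    · exact hix ▸ hrow y hy hu.ne_zero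
    refine hST i hi y hy ?_
    rwa [pivot_apply_col _ hix, neg_ne_zero, Ne, hu.ringInverse.mul_left_eq_zero]
  refine h S hS T hT hne fun i hi j hj hij => ?_
  by_cases hix : i = x
  · exact hix ▸ hrow j hj (hix ▸ hij)
  by_cases hjy : j = y
  · exact hjy ▸ hcol i hi (hjy ▸ hij)
  by_cases h₀ : A i y ≠ 0 ∧ A x j ≠ 0
  · rw [hcol i hi h₀.1, ← hrow y hy hu.ne_zero, hrow j hj h₀.2]
  · refine hST i hi j hj ?_
    rw [pivot_apply_of_ne _ hix hjy]
    rw [not_and_or, not_not, not_not] at h₀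
    rcases h₀ with h₀ | h₀ <;> simpa [h₀] using hij

theorem Linked.pivot_of_avoids {n : ℕ} {p z x₁ : X} {y₁ : Y} (hxy : A x₁ y₁ ≠ 0)
    (h : Linked A s t n p z) (hav : ∀ m ≤ n, ∀ q, Linked A s t m q z → A q y₁ = 0) :
    Linked (pivot A x₁ y₁) s t n p z := by
  induction h with
  | refl x hx => exact .refl x hx
  | @step n x p z y hx hy hxy' hpy hp ih =>
    have hx₀ : A x y₁ = 0 := hav _ le_rfl _ (.step hx hy hxy' hpy hp)
    have hp₀ : A p y₁ = 0 := hav n n.le_succ p hp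
    have hx₁ : x ≠ x₁ := by rintro rfl; exact hxy hx₀
    have hp₁ : p ≠ x₁ := by rintro rfl; exact hxy hp₀
    refine .step hx hy (y := y) ?_ ?_ (ih fun m hm => hav m (hm.trans n.le_succ))
    · rwa [pivot_apply_of_col_eq_zero hx₁ hx₀]
    · rwa [pivot_apply_of_col_eq_zero hp₁ hp₀]

/-- The pivot makes the third row of a shortest chain meet the first one in a common column. -/
theorem Linked.exists_pivot_shorter (hA : ∀ x ∈ s, ∀ y ∈ t, A x y ∈ ringCarrier R S) {n : ℕ}
    {x z : X} (h : Linked A s t (n + 2) x z) (hmin : ∀ m < n + 2, ¬ Linked A s t m x z) :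
    ∃ x₁ ∈ s, ∃ y₁ ∈ t, A x y₁ ≠ 0 ∧ A x₁ y₁ ≠ 0 ∧ Linked A s t (n + 1) x₁ z ∧
      Linked (PartialField.pivot A x₁ y₁) s t (n + 1) x z := by
  have hx := h.left_mem
  obtain ⟨x₁, y₁, hy₁, hxy₁, hx₁y₁, h₁⟩ := h.exists_step
  refine ⟨x₁, h₁.left_mem, y₁, hy₁, hxy₁, hx₁y₁, h₁, ?_⟩
  obtain ⟨x₂, y₂, hy₂, hx₁y₂, hx₂y₂, h₂⟩ := h₁.exists_step
  have hav : ∀ m ≤ n, ∀ q, Linked A s t m q z → A q y₁ = 0 := by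
    intro m hm q hq
    by_contra hqy₁
    exact hmin (m + 1) (by omega) (.step hx hy₁ hxy₁ hqy₁ hq)
  have hx₂y₁ : A x₂ y₁ = 0 := hav n le_rfl _ h₂
  have hxx₁ : x ≠ x₁ := by
    rintro rfl
    exact hmin (n + 1) (by omega) (.step hx hy₂ hx₁y₂ hx₂y₂ h₂)
  have hxy₂ : A x y₂ = 0 := by
    by_contra hxy₂
    exact hmin (n + 1) (by omega) (.step hx hy₂ hxy₂ hx₂y₂ h₂)
  have hyy : y₂ ≠ y₁ := by rintro rfl; exact hxy₁ hxy₂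
  have hx₂x₁ : x₂ ≠ x₁ := by rintro rfl; exact hx₁y₁ hx₂y₁
  have hu₁ := isUnit_of_mem_ringCarrier (hA x₁ h₁.left_mem y₁ hy₁) hx₁y₁
  have hu := isUnit_of_mem_ringCarrier (hA x hx y₁ hy₁) hxy₁
  refine .step hx hy₂ (p := x₂) ?_ ?_ (h₂.pivot_of_avoids hx₁y₁ hav)
  · rwa [pivot_apply_of_ne _ hxx₁ hyy, hxy₂, zero_sub, neg_ne_zero, Ne,
      (hu.mul hu₁.ringInverse).mul_right_eq_zero]
  · rwa [pivot_apply_of_col_eq_zero hx₂x₁ hx₂y₁]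

theorem Linked.exists_pivot_shorter_avoiding_ends
    (hA : ∀ x ∈ s, ∀ y ∈ t, A x y ∈ ringCarrier R S) {n : ℕ} {x z : X}
    (h : Linked A s t (n + 3) x z) (hmin : ∀ m < n + 3, ¬ Linked A s t m x z) :
    ∃ x₂ ∈ s, ∃ y₂ ∈ t, A x₂ y₂ ≠ 0 ∧ A x y₂ = 0 ∧ A z y₂ = 0 ∧
      Linked (PartialField.pivot A x₂ y₂) s t (n + 2) x z := by
  have hx := h.left_mem
  have hz := h.right_mem
  obtain ⟨x₁, y₁, hy₁, hxy₁, hx₁y₁, h₁⟩ := h.exists_step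
  have hx₁ := h₁.left_mem
  obtain ⟨x₂, hx₂, y₂, hy₂, hx₁y₂, hx₂y₂, h₂, hpivot⟩ := h₁.exists_pivot_shorter hA fun m hm hl =>
    hmin (m + 1) (by omega) (.step hx hy₁ hxy₁ hx₁y₁ hl)
  have hxy₂ : A x y₂ = 0 := by
    by_contra h₀
    exact hmin (n + 2) (by omega) (.step hx hy₂ h₀ hx₂y₂ h₂)
  have hx₂y₁ : A x₂ y₁ = 0 := by
    by_contra h₀
    exact hmin (n + 2) (by omega) (.step hx hy₁ hxy₁ h₀ h₂)
  have hzy₂ : A z y₂ = 0 := by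
    by_contra h₀
    exact hmin 2 (by omega) (.step hx hy₁ hxy₁ hx₁y₁ (.step hx₁ hy₂ hx₁y₂ h₀ (.refl z hz)))
  have hxx₂ : x ≠ x₂ := by rintro rfl; exact hx₂y₂ hxy₂
  have hy₁y₂ : y₁ ≠ y₂ := by rintro rfl; exact hxy₁ hxy₂
  refine ⟨x₂, hx₂, y₂, hy₂, hx₂y₂, hxy₂, hzy₂, .step hx hy₁ ?_ ?_ hpivot⟩
  · rwa [pivot_apply_of_col_eq_zero hxx₂ hxy₂]
  · rwa [pivot_apply_of_row_eq_zero hy₁y₂ hx₂y₁]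

end PivotConnectivity

section Lifting

variable {R K : Type*} [CommRing R] [CommRing K] {S : Set Rˣ} {T : Set Kˣ} {π : R →+* K}

/-- The fundamental elements of a set `D` closed under the operations of a partial field: the units
`p` for which `1 - p` is again in `D`. -/
def IsFundamental (D : Set R) (p : R) : Prop := p ∈ D ∧ IsUnit p ∧ 1 - p ∈ D

/-- The possible ratios `A x u * A z v / (A z u * A x v)`, up to a common factor, of two rows `x`
and `z` in which a column of `A` is nonzero, when `A` contains a chain of at most three rows from
`x` to `z`. -/
def IsChainRatio (D : Set R) (p : R) : Prop :=
  IsFundamental D p ∨ IsFundamental D (-p) ∨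
    ∃ a b, IsFundamental D a ∧ IsFundamental D b ∧ a * b - a + 1 ∈ D ∧ p = a * b

/-- The properties of a homomorphism `π` between two carriers which ensure that matrices lift along
`π`: fundamental elements lift uniquely, and so do differences of chain ratios. -/
structure IsLifting (S : Set Rˣ) (T : Set Kˣ) (π : R →+* K) : Prop where
  map_mem : ∀ {x}, x ∈ ringCarrier R S → π x ∈ ringCarrier K T
  surj : ∀ p ∈ ringCarrier K T, ∃ x ∈ ringCarrier R S, π x = p
  fundamental_inj : ∀ {p q}, IsFundamental (ringCarrier R S) p →
    IsFundamental (ringCarrier R S) q → π p = π q → p = q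
  fundamental_surj : ∀ {p}, IsFundamental (ringCarrier K T) p →
    ∃ q, IsFundamental (ringCarrier R S) q ∧ π q = p
  chainRatio_sub : ∀ {p q}, IsChainRatio (ringCarrier R S) p → IsChainRatio (ringCarrier R S) q →
    π (q - p) ∈ ringCarrier K T → q - p ∈ ringCarrier R S

theorem map_eq_zero_iff_of_mem_ringCarrier [Nontrivial K] {x : R} (hx : x ∈ ringCarrier R S) :
    π x = 0 ↔ x = 0 := by
  refine ⟨fun h => ?_, fun h => by rw [h, map_zero]⟩
  by_contra hx₀
  exact ((isUnit_of_mem_ringCarrier hx hx₀).map π).ne_zero h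

theorem eq_zero_iff_eq_zero_of_map_eq [Nontrivial K] {x y : R} (hx : x ∈ ringCarrier R S)
    (hy : y ∈ ringCarrier R S) (h : π x = π y) : x = 0 ↔ y = 0 := by
  rw [← map_eq_zero_iff_of_mem_ringCarrier (π := π) hx, h, map_eq_zero_iff_of_mem_ringCarrier hy]

theorem mul_ringInverse_eq_mul_ringInverse_iff {a b c d : R} (hb : IsUnit b) (hd : IsUnit d) :
    a * b⁻¹ʳ = c * d⁻¹ʳ ↔ a * d = c * b := by
  rw [Ring.eq_mul_inverse_iff_mul_eq _ _ _ hd, mul_right_comm, eq_comm,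
    Ring.eq_mul_inverse_iff_mul_eq _ _ _ hb, eq_comm]

theorem isFundamental_div {a b : R} (ha : a ∈ ringCarrier R S) (hb : b ∈ ringCarrier R S)
    (hua : IsUnit a) (hub : IsUnit b) (h : b - a ∈ ringCarrier R S) :
    IsFundamental (ringCarrier R S) (a * b⁻¹ʳ) := by
  refine ⟨ringCarrier_mul ha (ringCarrier_inverse hb), hua.mul hub.ringInverse, ?_⟩
  rw [← Ring.mul_inverse_cancel b hub, ← sub_mul]
  exact ringCarrier_mul h (ringCarrier_inverse hb)

theorem IsLifting.div_inj (hL : IsLifting S T π) {a b a' b' : R} (ha : a ∈ ringCarrier R S)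
    (hb : b ∈ ringCarrier R S) (ha' : a' ∈ ringCarrier R S) (hb' : b' ∈ ringCarrier R S)
    (hua : IsUnit a) (hub : IsUnit b) (hua' : IsUnit a') (hub' : IsUnit b')
    (h : b - a ∈ ringCarrier R S) (h' : b' - a' ∈ ringCarrier R S)
    (hπ : π (a * b') = π (a' * b)) : a * b' = a' * b := by
  rw [map_mul, map_mul, ← mul_ringInverse_eq_mul_ringInverse_iff (hub.map π) (hub'.map π),
    ← map_ringInverse_of_isUnit π hub, ← map_ringInverse_of_isUnit π hub', ← map_mul,
    ← map_mul] at hπ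
  rw [← mul_ringInverse_eq_mul_ringInverse_iff hub hub']
  exact hL.fundamental_inj (isFundamental_div ha hb hua hub h)
    (isFundamental_div ha' hb' hua' hub' h') hπ

theorem isChainRatio_div {r₀ r₁ r₂ : R} (h₀ : r₀ ∈ ringCarrier R S) (h₁ : r₁ ∈ ringCarrier R S)
    (h₂ : r₂ ∈ ringCarrier R S) (hu₀ : IsUnit r₀) (hu₂ : IsUnit r₂)
    (h₀₁ : r₀ - r₁ ∈ ringCarrier R S) (h₁₂ : r₁ - r₂ ∈ ringCarrier R S)
    (h₀₁₂ : r₀ - r₁ + r₂ ∈ ringCarrier R S) :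
    IsChainRatio (ringCarrier R S) (r₂ * r₀⁻¹ʳ) := by
  by_cases hr₁ : r₁ = 0
  · rw [hr₁, sub_zero, ← sub_neg_eq_add] at h₀₁₂
    rw [IsChainRatio, ← neg_mul]
    exact .inr (.inl (isFundamental_div (ringCarrier_neg h₂) h₀ hu₂.neg hu₀ h₀₁₂))
  have hu₁ := isUnit_of_mem_ringCarrier h₁ hr₁
  have hcancel := Ring.inverse_mul_cancel r₁ hu₁
  refine .inr (.inr ⟨r₁ * r₀⁻¹ʳ, r₂ * r₁⁻¹ʳ, isFundamental_div h₁ h₀ hu₁ hu₀ h₀₁,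
    isFundamental_div h₂ h₁ hu₂ hu₁ h₁₂, ?_, ?_⟩)
  · have hsum : r₁ * r₀⁻¹ʳ * (r₂ * r₁⁻¹ʳ) - r₁ * r₀⁻¹ʳ + 1 = (r₀ - r₁ + r₂) * r₀⁻¹ʳ := by
      linear_combination r₀⁻¹ʳ * r₂ * hcancel - Ring.mul_inverse_cancel r₀ hu₀
    rw [hsum]
    exact ringCarrier_mul h₀₁₂ (ringCarrier_inverse h₀)
  · linear_combination -r₀⁻¹ʳ * r₂ * hcancel

theorem IsLifting.cross_mul_sub_mem (hL : IsLifting S T π) {a b a' b' : R}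
    (hb : b ∈ ringCarrier R S) (hb' : b' ∈ ringCarrier R S) (hub : IsUnit b) (hub' : IsUnit b')
    (h : IsChainRatio (ringCarrier R S) (a * b⁻¹ʳ))
    (h' : IsChainRatio (ringCarrier R S) (a' * b'⁻¹ʳ))
    (hπ : π (a' * b - a * b') ∈ ringCarrier K T) : a' * b - a * b' ∈ ringCarrier R S := by
  have hdiff : a' * b'⁻¹ʳ - a * b⁻¹ʳ = b⁻¹ʳ * b'⁻¹ʳ * (a' * b - a * b') := by
    linear_combination a * b⁻¹ʳ * Ring.inverse_mul_cancel b' hub' -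
      a' * b'⁻¹ʳ * Ring.inverse_mul_cancel b hub
  have hbb := ringCarrier_mul (ringCarrier_inverse hb) (ringCarrier_inverse hb')
  rw [← mul_mem_ringCarrier_iff hbb (hub.ringInverse.mul hub'.ringInverse), ← hdiff]
  refine hL.chainRatio_sub h h' ?_
  rw [hdiff, map_mul]
  exact ringCarrier_mul (hL.map_mem hbb) hπ

end Lifting

section ColumnProportional

variable {R K : Type*} [CommRing R] [CommRing K] {S : Set Rˣ} {T : Set Kˣ} {π : R →+* K}
  {X Y : Type*} {s : Set X} {t : Set Y} {u : Y} {B B' : Matrix X Y R} {x z : X}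

/-- `B` and `B'` lift the same matrix with the columns `t` and `u`, and they agree on `t`. -/
structure IsLiftPair (S : Set Rˣ) (π : R →+* K) (s : Set X) (t : Set Y) (u : Y)
    (B B' : Matrix X Y R) : Prop where
  notMem : u ∉ t
  left : MinorsIn (ringCarrier R S) s (insert u t) B
  right : MinorsIn (ringCarrier R S) s (insert u t) B'
  eq : ∀ x ∈ s, ∀ y ∈ t, B x y = B' x y
  map_eq : ∀ x ∈ s, π (B x u) = π (B' x u)

theorem IsLiftPair.eq_zero_iff [Nontrivial K] (h : IsLiftPair S π s t u B B') (hx : x ∈ s) :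
    B x u = 0 ↔ B' x u = 0 :=
  eq_zero_iff_eq_zero_of_map_eq (h.left.entry hx (Set.mem_insert u t))
    (h.right.entry hx (Set.mem_insert u t)) (h.map_eq x hx)

theorem IsLiftPair.pivot_apply [Nontrivial K] (h : IsLiftPair S π s t u B B') (hx : x ∈ s) {y : Y}
    (hy : y ∈ t) (hxu : B x u = 0) (i : X) :
    PartialField.pivot B x y i u = B i u ∧ PartialField.pivot B' x y i u = B' i u := by
  have huy : u ≠ y := by
    rintro rfl
    exact h.notMem hy
  exact ⟨pivot_apply_of_row_eq_zero huy hxu,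
    pivot_apply_of_row_eq_zero huy ((h.eq_zero_iff hx).1 hxu)⟩

theorem IsLiftPair.pivot [Nontrivial K] (h : IsLiftPair S π s t u B B') (hx : x ∈ s) {y : Y}
    (hy : y ∈ t) (hxy : B x y ≠ 0) (hxu : B x u = 0) :
    IsLiftPair S π s t u (PartialField.pivot B x y) (PartialField.pivot B' x y) := by
  have hyt : y ∈ insert u t := Set.mem_insert_of_mem _ hy
  have hunit := isUnit_of_mem_ringCarrier (h.left.entry hx hyt) hxy
  exact
    { notMem := h.notMem
      left := h.left.pivot hx hyt hunit
      right := h.right.pivot hx hyt (h.eq x hx y hy ▸ hunit)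
      eq := fun i hi j hj =>
        pivot_congr (h.eq x hx y hy) (h.eq i hi j hj) (h.eq i hi y hy) (h.eq x hx j hj)
      map_eq := fun i hi => by
        rw [(h.pivot_apply hx hy hxu i).1, (h.pivot_apply hx hy hxu i).2, h.map_eq i hi] }

theorem IsLiftPair.column_proportional_of_common_column [Nontrivial K]
    (h : IsLiftPair S π s t u B B') (hL : IsLifting S T π) (hx : x ∈ s) (hz : z ∈ s) {y : Y}
    (hy : y ∈ t) (hxy : B x y ≠ 0) (hzy : B z y ≠ 0) (hxu : B x u ≠ 0) (hzu : B z u ≠ 0) :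
    B' x u * B z u = B x u * B' z u := by
  have hut : u ∈ insert u t := Set.mem_insert _ _
  have hyt : y ∈ insert u t := Set.mem_insert_of_mem _ hy
  have hxyD := h.left.entry hx hyt
  have hzyD := h.left.entry hz hyt
  have hxuD := h.left.entry hx hut
  have hzuD := h.left.entry hz hut
  have hxuD' := h.right.entry hx hut
  have hzuD' := h.right.entry hz hut
  have hxyU := isUnit_of_mem_ringCarrier hxyD hxy
  have hzyU := isUnit_of_mem_ringCarrier hzyD hzy
  have hminor := h.right.two hx hz hyt hut
  rw [← h.eq x hx y hy, ← h.eq z hz y hy] at hminor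
  have hcross : B x u * B z y * (B x y * B' z u) = B' x u * B z y * (B x y * B z u) :=
    hL.div_inj (ringCarrier_mul hxuD hzyD) (ringCarrier_mul hxyD hzuD)
      (ringCarrier_mul hxuD' hzyD) (ringCarrier_mul hxyD hzuD')
      ((isUnit_of_mem_ringCarrier hxuD hxu).mul hzyU)
      (hxyU.mul (isUnit_of_mem_ringCarrier hzuD hzu))
      ((isUnit_of_mem_ringCarrier hxuD' ((h.eq_zero_iff hx).not.1 hxu)).mul hzyU)
      (hxyU.mul (isUnit_of_mem_ringCarrier hzuD' ((h.eq_zero_iff hz).not.1 hzu)))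
      (h.left.two hx hz hyt hut) hminor (by simp only [map_mul, h.map_eq x hx, h.map_eq z hz])
  exact (hxyU.mul hzyU).mul_left_cancel (by linear_combination -hcross)

theorem IsLiftPair.column_proportional [Nontrivial K] (h : IsLiftPair S π s t u B B')
    (hL : IsLifting S T π) {n : ℕ} (hlink : Linked B s t n x z) (hxu : B x u ≠ 0)
    (hzu : B z u ≠ 0) : B' x u * B z u = B x u * B' z u := by
  induction n using Nat.strong_induction_on generalizing B B' x z with
  | _ n ih =>
  by_cases hmin : ∃ m < n, Linked B s t m x z
  · obtain ⟨m, hm, hlink'⟩ := hmin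
    exact ih m hm h hlink' hxu hzu
  obtain _ | _ | n := n
  · rw [hlink.eq, mul_comm]
  · obtain ⟨y, hy, hxy, hzy⟩ := hlink.exists_common_column
    exact h.column_proportional_of_common_column hL hlink.left_mem hlink.right_mem hy hxy hzy hxu
      hzu
  push Not at hmin
  obtain ⟨x₁, hx₁, y₁, hy₁, hxy₁, hx₁y₁, hlink₁, hpivot⟩ := hlink.exists_pivot_shorter
    (fun i hi j hj => h.left.entry hi (Set.mem_insert_of_mem _ hj)) hmin
  by_cases hx₁u : B x₁ u = 0
  · have hpu := fun i => (h.pivot_apply hx₁ hy₁ hx₁u i).1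
    have hpu' := fun i => (h.pivot_apply hx₁ hy₁ hx₁u i).2
    have hprop := ih (n + 1) (by omega) (h.pivot hx₁ hy₁ hx₁y₁ hx₁u) hpivot (by rwa [hpu])
      (by rwa [hpu])
    rwa [hpu, hpu, hpu', hpu'] at hprop
  · have hfirst := ih 1 (by omega) h (.step hlink.left_mem hy₁ hxy₁ hx₁y₁ (.refl x₁ hx₁)) hxu hx₁u
    have hrest := ih (n + 1) (by omega) h hlink₁ hx₁u hzu
    have hunit :=
      isUnit_of_mem_ringCarrier (h.left.entry hx₁ (Set.mem_insert u t)) hx₁u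
    refine hunit.mul_left_cancel ?_
    linear_combination B z u * hfirst + B x u * hrest

end ColumnProportional

section Gluing

variable {R K : Type*} [CommRing R] [CommRing K] {S : Set Rˣ} {T : Set Kˣ} {π : R →+* K}
  {X Y : Type*} {s : Set X} {t : Set Y} {u v : Y} {B : Matrix X Y R} {x z : X}

theorem two_mem_ringCarrier_of_eq_zero {a b c d : R} (ha : a ∈ ringCarrier R S)
    (hb : b ∈ ringCarrier R S) (hc : c ∈ ringCarrier R S) (hd : d ∈ ringCarrier R S)
    (h : a = 0 ∨ b = 0 ∨ c = 0 ∨ d = 0) : a * d - b * c ∈ ringCarrier R S := by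
  obtain h | h : a * d = 0 ∨ b * c = 0 := by rcases h with rfl | rfl | rfl | rfl <;> simp
  · rw [h, zero_sub]
    exact ringCarrier_neg (ringCarrier_mul hb hc)
  · rw [h, sub_zero]
    exact ringCarrier_mul ha hd

theorem MinorsIn.three {D : Set R} (h : MinorsIn D s t B) {x y z : X} (hx : x ∈ s) (hy : y ∈ s)
    (hz : z ∈ s) {i j k : Y} (hi : i ∈ t) (hj : j ∈ t) (hk : k ∈ t) :
    B x i * B y j * B z k - B x i * B y k * B z j - B x j * B y i * B z k +
      B x j * B y k * B z i + B x k * B y i * B z j - B x k * B y j * B z i ∈ D := by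
  have hdet := h 3 ![x, y, z] ![i, j, k] (by simp [Fin.forall_fin_succ, hx, hy, hz])
    (by simp [Fin.forall_fin_succ, hi, hj, hk])
  rw [det_fin_three] at hdet
  simpa using hdet

theorem MinorsIn.isChainRatio_of_common_column (h : MinorsIn (ringCarrier R S) s t B) (hx : x ∈ s)
    (hz : z ∈ s) {y w : Y} (hy : y ∈ t) (hw : w ∈ t) (hxy : B x y ≠ 0) (hzy : B z y ≠ 0)
    (hxw : B x w ≠ 0) (hzw : B z w ≠ 0) :
    IsChainRatio (ringCarrier R S) (B x y * B z w * (B z y * B x w)⁻¹ʳ) := by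
  have hunit : ∀ {i j}, i ∈ s → j ∈ t → B i j ≠ 0 → IsUnit (B i j) := fun hi hj =>
    isUnit_of_mem_ringCarrier (h.entry hi hj)
  have hminor : B z y * B x w - B x y * B z w ∈ ringCarrier R S := by
    rw [sub_mem_ringCarrier_comm, mul_comm (B z y)]
    exact h.two hx hz hy hw
  exact .inl (isFundamental_div (ringCarrier_mul (h.entry hx hy) (h.entry hz hw))
    (ringCarrier_mul (h.entry hz hy) (h.entry hx hw)) ((hunit hx hy hxy).mul (hunit hz hw hzw))
    ((hunit hz hy hzy).mul (hunit hx hw hxw)) hminor)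

theorem MinorsIn.isChainRatio_of_chain (h : MinorsIn (ringCarrier R S) s t B) {p : X} (hx : x ∈ s)
    (hp : p ∈ s) (hz : z ∈ s) {y₁ y₂ w : Y} (hy₁ : y₁ ∈ t) (hy₂ : y₂ ∈ t) (hw : w ∈ t)
    (hxy₁ : B x y₁ ≠ 0) (hpy₁ : B p y₁ ≠ 0) (hpy₂ : B p y₂ ≠ 0) (hzy₂ : B z y₂ ≠ 0)
    (hxy₂ : B x y₂ = 0) (hzy₁ : B z y₁ = 0) (hxw : B x w ≠ 0) (hzw : B z w ≠ 0) :
    IsChainRatio (ringCarrier R S)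
      (B x y₁ * B p y₂ * B z w * (B p y₁ * B z y₂ * B x w)⁻¹ʳ) := by
  have hunit : ∀ {i j}, i ∈ s → j ∈ t → B i j ≠ 0 → IsUnit (B i j) := fun hi hj =>
    isUnit_of_mem_ringCarrier (h.entry hi hj)
  refine isChainRatio_div (r₁ := B x y₁ * B z y₂ * B p w)
    (ringCarrier_mul (ringCarrier_mul (h.entry hp hy₁) (h.entry hz hy₂)) (h.entry hx hw))
    (ringCarrier_mul (ringCarrier_mul (h.entry hx hy₁) (h.entry hz hy₂)) (h.entry hp hw))
    (ringCarrier_mul (ringCarrier_mul (h.entry hx hy₁) (h.entry hp hy₂)) (h.entry hz hw))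
    (((hunit hp hy₁ hpy₁).mul (hunit hz hy₂ hzy₂)).mul (hunit hx hw hxw))
    (((hunit hx hy₁ hxy₁).mul (hunit hp hy₂ hpy₂)).mul (hunit hz hw hzw)) ?_ ?_ ?_
  · rw [sub_mem_ringCarrier_comm]
    convert ringCarrier_mul (h.entry hz hy₂) (h.two hx hp hy₁ hw) using 1
    ring
  · rw [sub_mem_ringCarrier_comm]
    convert ringCarrier_mul (h.entry hx hy₁) (h.two hp hz hy₂ hw) using 1
    ring
  · have hdet := h.three hx hp hz hy₁ hy₂ hw
    rw [hxy₂, hzy₁] at hdet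
    convert hdet using 1
    ring

/-- `B` lifts its image under `π` as far as the columns `t` together with only one of the two
further columns `u` and `v` are concerned. -/
structure IsPartialLift (S : Set Rˣ) (T : Set Kˣ) (π : R →+* K) (s : Set X) (t : Set Y) (u v : Y)
    (B : Matrix X Y R) : Prop where
  left_notMem : u ∉ t
  right_notMem : v ∉ t
  left : MinorsIn (ringCarrier R S) s (insert u t) B
  right : MinorsIn (ringCarrier R S) s (insert v t) B
  map : MinorsIn (ringCarrier K T) s (insert u (insert v t)) (B.map π)

theorem IsPartialLift.entry (h : IsPartialLift S T π s t u v B) (hx : x ∈ s) {y : Y} (hy : y ∈ t) :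
    B x y ∈ ringCarrier R S :=
  h.left.entry hx (Set.mem_insert_of_mem u hy)

theorem IsPartialLift.pivot (h : IsPartialLift S T π s t u v B) (hx : x ∈ s) {y : Y} (hy : y ∈ t)
    (hxy : IsUnit (B x y)) : IsPartialLift S T π s t u v (pivot B x y) where
  left_notMem := h.left_notMem
  right_notMem := h.right_notMem
  left := h.left.pivot hx (Set.mem_insert_of_mem _ hy) hxy
  right := h.right.pivot hx (Set.mem_insert_of_mem _ hy) hxy
  map := by
    rw [pivot_map π hxy]
    exact h.map.pivot hx (Set.mem_insert_of_mem _ (Set.mem_insert_of_mem _ hy)) (hxy.map π)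

theorem IsPartialLift.two_mem_of_isChainRatio (h : IsPartialLift S T π s t u v B)
    (hL : IsLifting S T π) (hx : x ∈ s) (hz : z ∈ s) {k l : R} (hk : k ∈ ringCarrier R S)
    (hl : l ∈ ringCarrier R S) (hku : IsUnit k) (hlu : IsUnit l) (hxu : B x u ≠ 0)
    (hxv : B x v ≠ 0) (hu : IsChainRatio (ringCarrier R S) (k * B z u * (l * B x u)⁻¹ʳ))
    (hv : IsChainRatio (ringCarrier R S) (k * B z v * (l * B x v)⁻¹ʳ)) :
    B x u * B z v - B x v * B z u ∈ ringCarrier R S := by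
  have hut : u ∈ insert u t := Set.mem_insert _ _
  have hvt : v ∈ insert v t := Set.mem_insert _ _
  have hcross : k * B z v * (l * B x u) - k * B z u * (l * B x v) =
      k * l * (B x u * B z v - B x v * B z u) := by ring
  have hmap : π (B x u * B z v - B x v * B z u) ∈ ringCarrier K T := by
    simpa using h.map.two hx hz (Set.mem_insert u _) (Set.mem_insert_of_mem u hvt)
  rw [← mul_mem_ringCarrier_iff (ringCarrier_mul hk hl) (hku.mul hlu), ← hcross]
  refine hL.cross_mul_sub_mem (ringCarrier_mul hl (h.left.entry hx hut))
    (ringCarrier_mul hl (h.right.entry hx hvt))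
    (hlu.mul (isUnit_of_mem_ringCarrier (h.left.entry hx hut) hxu))
    (hlu.mul (isUnit_of_mem_ringCarrier (h.right.entry hx hvt) hxv)) hu hv ?_
  rw [hcross, map_mul]
  exact ringCarrier_mul (hL.map_mem (ringCarrier_mul hk hl)) hmap

theorem IsPartialLift.two_mem_of_common_column (h : IsPartialLift S T π s t u v B)
    (hL : IsLifting S T π) (hx : x ∈ s) (hz : z ∈ s) {y : Y} (hy : y ∈ t) (hxy : B x y ≠ 0)
    (hzy : B z y ≠ 0) (hxu : B x u ≠ 0) (hxv : B x v ≠ 0) (hzu : B z u ≠ 0) (hzv : B z v ≠ 0) :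
    B x u * B z v - B x v * B z u ∈ ringCarrier R S := by
  have hxyD := h.entry hx hy
  have hzyD := h.entry hz hy
  exact h.two_mem_of_isChainRatio hL hx hz hxyD hzyD (isUnit_of_mem_ringCarrier hxyD hxy)
    (isUnit_of_mem_ringCarrier hzyD hzy) hxu hxv
    (h.left.isChainRatio_of_common_column hx hz (Set.mem_insert_of_mem _ hy)
      (Set.mem_insert _ _) hxy hzy hxu hzu)
    (h.right.isChainRatio_of_common_column hx hz (Set.mem_insert_of_mem _ hy)
      (Set.mem_insert _ _) hxy hzy hxv hzv)

theorem IsPartialLift.two_mem_of_chain (h : IsPartialLift S T π s t u v B)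
    (hL : IsLifting S T π) (hlink : Linked B s t 2 x z) (hmin : ¬ Linked B s t 1 x z)
    (hxu : B x u ≠ 0) (hxv : B x v ≠ 0) (hzu : B z u ≠ 0) (hzv : B z v ≠ 0) :
    B x u * B z v - B x v * B z u ∈ ringCarrier R S := by
  have hx := hlink.left_mem
  have hz := hlink.right_mem
  obtain ⟨p, y₁, hy₁, hxy₁, hpy₁, hlink₁⟩ := hlink.exists_step
  have hp := hlink₁.left_mem
  obtain ⟨y₂, hy₂, hpy₂, hzy₂⟩ := hlink₁.exists_common_column
  have hxy₂ : B x y₂ = 0 := by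
    by_contra h₀
    exact hmin (.step hx hy₂ h₀ hzy₂ (.refl z hz))
  have hzy₁ : B z y₁ = 0 := by
    by_contra h₀
    exact hmin (.step hx hy₁ hxy₁ h₀ (.refl z hz))
  have hunit : ∀ {i j}, i ∈ s → j ∈ t → B i j ≠ 0 → IsUnit (B i j) := fun hi hj =>
    isUnit_of_mem_ringCarrier (h.entry hi hj)
  have hchain : ∀ {w}, MinorsIn (ringCarrier R S) s (insert w t) B → B x w ≠ 0 → B z w ≠ 0 →
      IsChainRatio (ringCarrier R S)
        (B x y₁ * B p y₂ * B z w * (B p y₁ * B z y₂ * B x w)⁻¹ʳ) := fun hB =>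
    hB.isChainRatio_of_chain hx hp hz (Set.mem_insert_of_mem _ hy₁) (Set.mem_insert_of_mem _ hy₂)
      (Set.mem_insert _ _) hxy₁ hpy₁ hpy₂ hzy₂ hxy₂ hzy₁
  exact h.two_mem_of_isChainRatio hL hx hz (ringCarrier_mul (h.entry hx hy₁) (h.entry hp hy₂))
    (ringCarrier_mul (h.entry hp hy₁) (h.entry hz hy₂))
    ((hunit hx hy₁ hxy₁).mul (hunit hp hy₂ hpy₂)) ((hunit hp hy₁ hpy₁).mul (hunit hz hy₂ hzy₂))
    hxu hxv (hchain h.left hxu hzu) (hchain h.right hxv hzv)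

theorem IsPartialLift.two_mem_of_linked {n : ℕ} (h : IsPartialLift S T π s t u v B)
    (hL : IsLifting S T π) (hlink : Linked B s t n x z) :
    B x u * B z v - B x v * B z u ∈ ringCarrier R S := by
  induction n using Nat.strong_induction_on generalizing B with
  | _ n ih =>
  by_cases hmin : ∃ m < n, Linked B s t m x z
  · obtain ⟨m, hm, hlink'⟩ := hmin
    exact ih m hm h hlink'
  push Not at hmin
  have hx := hlink.left_mem
  have hz := hlink.right_mem
  by_cases h₀ : B x u = 0 ∨ B x v = 0 ∨ B z u = 0 ∨ B z v = 0
  · exact two_mem_ringCarrier_of_eq_zero (h.left.entry hx (Set.mem_insert _ _))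
      (h.right.entry hx (Set.mem_insert _ _)) (h.left.entry hz (Set.mem_insert _ _))
      (h.right.entry hz (Set.mem_insert _ _)) h₀
  push Not at h₀
  obtain ⟨hxu, hxv, hzu, hzv⟩ := h₀
  obtain _ | _ | _ | n := n
  · rw [hlink.eq, mul_comm, sub_self]
    exact zero_mem_ringCarrier
  · obtain ⟨y, hy, hxy, hzy⟩ := hlink.exists_common_column
    exact h.two_mem_of_common_column hL hx hz hy hxy hzy hxu hxv hzu hzv
  · exact h.two_mem_of_chain hL hlink (hmin 1 (by omega)) hxu hxv hzu hzv
  · obtain ⟨x₂, hx₂, y₂, hy₂, hx₂y₂, hxy₂, hzy₂, hpivot⟩ :=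
      hlink.exists_pivot_shorter_avoiding_ends (fun i hi j hj => h.entry hi hj) hmin
    have hxx₂ : x ≠ x₂ := by rintro rfl; exact hx₂y₂ hxy₂
    have hzx₂ : z ≠ x₂ := by rintro rfl; exact hx₂y₂ hzy₂
    have hminor := ih (n + 2) (by omega)
      (h.pivot hx₂ hy₂ (isUnit_of_mem_ringCarrier (h.entry hx₂ hy₂) hx₂y₂)) hpivot
    simpa only [pivot_apply_of_col_eq_zero hxx₂ hxy₂, pivot_apply_of_col_eq_zero hzx₂ hzy₂]
      using hminor

theorem IsPartialLift.minorsIn_pair (h : IsPartialLift S T π s t u v B) (hL : IsLifting S T π)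
    (hconn : ConnOn B s t) : MinorsIn (ringCarrier R S) s {u, v} B :=
  PartialField.minorsIn_pair (fun _ hx => h.left.entry hx (Set.mem_insert u t))
    (fun _ hx => h.right.entry hx (Set.mem_insert v t)) fun _ hx _ hz => by
      obtain ⟨n, hlink⟩ := hconn.exists_linked hx hz
      exact h.two_mem_of_linked hL hlink

theorem IsPartialLift.minorsIn_of_connOn [Nontrivial R] (h : IsPartialLift S T π s t u v B)
    (hL : IsLifting S T π) (hconn : ConnOn B s t) :
    MinorsIn (ringCarrier R S) s (insert u (insert v t)) B := by
  intro n
  induction n generalizing B with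
  | zero =>
    intro f g _ _
    rw [det_fin_zero]
    exact ringCarrier_one
  | succ n ih =>
    intro f g hf hg
    by_cases hgt : ∃ l, g l ∈ t
    · obtain ⟨l, hl⟩ := hgt
      refine det_submatrix_mem_of_forall_pivot l (fun k => h.entry (hf k) hl) fun k hunit => ?_
      exact ih (h.pivot (hf k) hl hunit) (hconn.pivot (hf k) hl hunit) _ _ (fun _ => hf _)
        fun _ => hg _
    · push Not at hgt
      exact h.minorsIn_pair hL hconn _ f g hf fun j =>
        (hg j).imp_right fun hj => hj.resolve_right (hgt j)

end Gluing

section Scaling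

variable {R K : Type*} [CommRing R] [CommRing K] {S : Set Rˣ} {T : Set Kˣ} {π : R →+* K}
  {X Y : Type*} {s : Set X} {t : Set Y} {B B' : Matrix X Y R}

/-- `B'` arises from `B` on `s × t` by scaling rows and columns with elements of `D` that are mapped
to `1` by `π`. -/
def ScalingEquivOn (D : Set R) (π : R →+* K) (s : Set X) (t : Set Y) (B B' : Matrix X Y R) : Prop :=
  ∃ (r : X → R) (c : Y → R), (∀ x, r x ∈ D ∧ π (r x) = 1) ∧ (∀ y, c y ∈ D ∧ π (c y) = 1) ∧
    ∀ x ∈ s, ∀ y ∈ t, B' x y = r x * B x y * c y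

theorem ScalingEquivOn.transpose {D : Set R} (h : ScalingEquivOn D π s t B B') :
    ScalingEquivOn D π t s Bᵀ B'ᵀ := by
  obtain ⟨r, c, hr, hc, h⟩ := h
  refine ⟨c, r, hc, hr, fun y hy x hx => ?_⟩
  rw [transpose_apply, transpose_apply, h x hx y hy]
  ring

theorem scalingEquivOn_of_isEmpty {D : Set R} (hD : 1 ∈ D) (h : s = ∅ ∨ t = ∅) :
    ScalingEquivOn D π s t B B' := by
  refine ⟨1, 1, fun _ => ⟨hD, map_one π⟩, fun _ => ⟨hD, map_one π⟩, ?_⟩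
  rcases h with rfl | rfl <;> simp

theorem isUnit_of_map_eq_one [Nontrivial K] {r : R} (hr : r ∈ ringCarrier R S) (h : π r = 1) :
    IsUnit r := by
  refine isUnit_of_mem_ringCarrier hr ?_
  rintro rfl
  simp at h

theorem IsLiftPair.exists_column_scale [Nontrivial K] {y : Y} (h : IsLiftPair S π s t y B B')
    (hL : IsLifting S T π) (hconn : ConnOn B s t) {x : X} (hx : x ∈ s) (hxy : B x y ≠ 0) :
    ∃ k ∈ ringCarrier R S, π k = 1 ∧ ∀ i ∈ s, B' i y = B i y * k := by
  have hyt : y ∈ insert y t := Set.mem_insert _ _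
  have hunit := isUnit_of_mem_ringCarrier (h.left.entry hx hyt) hxy
  refine ⟨B' x y * (B x y)⁻¹ʳ, ringCarrier_mul (h.right.entry hx hyt)
    (ringCarrier_inverse (h.left.entry hx hyt)), ?_, fun i hi => ?_⟩
  · rw [map_mul, ← h.map_eq x hx, ← map_mul, Ring.mul_inverse_cancel _ hunit, map_one]
  · rw [← mul_assoc, Ring.eq_mul_inverse_iff_mul_eq _ _ _ hunit]
    by_cases hiy : B i y = 0
    · rw [(h.eq_zero_iff hi).1 hiy, hiy, zero_mul, zero_mul]
    · obtain ⟨n, hlink⟩ := hconn.exists_linked hx hi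
      linear_combination -h.column_proportional hL hlink hxy hiy

theorem IsLifting.scalingEquivOn_insert_column [Nontrivial K] (hL : IsLifting S T π) {x : X}
    (hx : x ∈ s) {y : Y} (hy : y ∉ t) (hxy : B x y ≠ 0)
    (hB : MinorsIn (ringCarrier R S) s (insert y t) B)
    (hB' : MinorsIn (ringCarrier R S) s (insert y t) B')
    (hπ : ∀ x ∈ s, π (B x y) = π (B' x y)) (hconn : ConnOn B s t)
    (h : ScalingEquivOn (ringCarrier R S) π s t B B') :
    ScalingEquivOn (ringCarrier R S) π s (insert y t) B B' := by
  classical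
  obtain ⟨r, c, hr, hc, h⟩ := h
  have hrU : ∀ i, IsUnit (r i) := fun i => isUnit_of_map_eq_one (hr i).1 (hr i).2
  have hcU : ∀ j, IsUnit (c j) := fun j => isUnit_of_map_eq_one (hc j).1 (hc j).2
  have hscaled : ∀ i j, r i * B i j * c j ≠ 0 ↔ B i j ≠ 0 := fun i j => by
    rw [Ne, (hcU j).mul_left_eq_zero, (hrU i).mul_right_eq_zero]
  have hpair : IsLiftPair S π s t y (of fun i j => r i * B i j * c j) B' :=
    { notMem := hy
      left := hB.scale (fun i => (hr i).1) fun j => (hc j).1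
      right := hB'
      eq := fun i hi j hj => (h i hi j hj).symm
      map_eq := fun i hi => by simp [(hr i).2, (hc y).2, hπ i hi] }
  obtain ⟨k, hk, hπk, hkB⟩ := hpair.exists_column_scale hL
    (hconn.congr fun i _ j _ => (hscaled i j).2) hx ((hscaled x y).2 hxy)
  refine ⟨r, Function.update c y (c y * k), hr, fun j => ?_, fun i hi j hj => ?_⟩
  · obtain rfl | hj := eq_or_ne j y
    · simp [ringCarrier_mul (hc j).1 hk, (hc j).2, hπk]
    · simpa [hj] using hc j
  · obtain rfl | hj := hj
    · rw [Function.update_self, hkB i hi, of_apply, mul_assoc]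
    · rw [Function.update_of_ne (by rintro rfl; exact hy hj)]
      exact h i hi j hj

theorem IsLifting.scalingEquivOn [Nontrivial K] (hL : IsLifting S T π) (hs : s.Finite)
    (ht : t.Finite) (hB : MinorsIn (ringCarrier R S) s t B)
    (hB' : MinorsIn (ringCarrier R S) s t B')
    (hπ : ∀ x ∈ s, ∀ y ∈ t, π (B x y) = π (B' x y)) (hconn : ConnOn B s t) :
    ScalingEquivOn (ringCarrier R S) π s t B B' := by
  obtain rfl | ⟨x, hx⟩ := s.eq_empty_or_nonempty
  · exact scalingEquivOn_of_isEmpty ringCarrier_one (.inl rfl)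
  refine (hconn.induction_on (Q := fun s' t' => ConnOn B s' t' ∧
    ScalingEquivOn (ringCarrier R S) π s' t' B B') hs ht
    (Set.singleton_subset_iff.2 hx) (Set.empty_subset t) (Set.singleton_nonempty x)
    ⟨connOn_singleton_row (by simp), scalingEquivOn_of_isEmpty ringCarrier_one (.inr rfl)⟩ ?_ ?_).2
  · intro s' t' p y hs' ht' hp hy hpy ⟨hconn', h⟩
    exact ⟨hconn'.insert_row hy hpy, (hL.scalingEquivOn_insert_column (B := Bᵀ) (B' := B'ᵀ) hy hp
      hpy (hB.mono hs' ht').transpose (hB'.mono hs' ht').transpose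
      (fun j hj => hπ p (hs' (Set.mem_insert p s')) j (ht' hj)) hconn'.transpose
      h.transpose).transpose⟩
  · intro s' t' p y hs' ht' hp hy hpy ⟨hconn', h⟩
    exact ⟨hconn'.insert_column hp hpy, hL.scalingEquivOn_insert_column hp hy hpy
      (hB.mono hs' ht') (hB'.mono hs' ht')
      (fun i hi => hπ i (hs' hi) y (ht' (Set.mem_insert y t'))) hconn' h⟩

end Scaling

section Liftable

variable {R K : Type*} [CommRing R] [CommRing K] {S : Set Rˣ} {T : Set Kˣ} {π : R →+* K}
  {X Y : Type*} {s : Set X} {t : Set Y} {A : Matrix X Y K}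

/-- Some matrix over `R` with all minors in `D` is mapped to `A` by `π` on `s × t`. -/
def Liftable (D : Set R) (π : R →+* K) (A : Matrix X Y K) (s : Set X) (t : Set Y) : Prop :=
  ∃ B : Matrix X Y R, MinorsIn D s t B ∧ ∀ x ∈ s, ∀ y ∈ t, π (B x y) = A x y

theorem Liftable.transpose {D : Set R} (h : Liftable D π A s t) : Liftable D π Aᵀ t s := by
  obtain ⟨B, hB, hBA⟩ := h
  exact ⟨Bᵀ, hB.transpose, fun y hy x hx => hBA x hx y hy⟩

theorem liftable_of_pivot [Nontrivial K] {x : X} (hx : x ∈ s) {y : Y} (hy : y ∈ t)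
    (hxy : IsUnit (A x y)) (h : Liftable (ringCarrier R S) π (pivot A x y) s t) :
    Liftable (ringCarrier R S) π A s t := by
  obtain ⟨B, hB, hBA⟩ := h
  have hBxy : IsUnit (B x y) := by
    refine isUnit_of_mem_ringCarrier (hB.entry hx hy) fun h₀ => hxy.ringInverse.ne_zero ?_
    rw [← pivot_apply_self A, ← hBA x hx y hy, h₀, map_zero]
  refine ⟨pivot B x y, hB.pivot hx hy hBxy, fun i hi j hj => ?_⟩
  rw [← map_apply (f := π) (M := pivot B x y), pivot_map π hBxy, ← pivot_pivot hxy]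
  exact pivot_congr (hBA x hx y hy) (hBA i hi j hj) (hBA i hi y hy) (hBA x hx j hj)

theorem IsLifting.exists_isPartialLift [Nontrivial K] (hL : IsLifting S T π) (hs : s.Finite)
    (ht : t.Finite) {u v : Y} (hu : u ∉ t) (hv : v ∉ t) (huv : u ≠ v)
    (hA : MinorsIn (ringCarrier K T) s (insert u (insert v t)) A) (hconn : ConnOn A s t)
    (hAu : Liftable (ringCarrier R S) π A s (insert u t))
    (hAv : Liftable (ringCarrier R S) π A s (insert v t)) :
    ∃ B : Matrix X Y R, IsPartialLift S T π s t u v B ∧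
      ∀ x ∈ s, ∀ y ∈ insert u (insert v t), π (B x y) = A x y := by
  classical
  obtain ⟨B₁, hB₁, hBA₁⟩ := hAu
  obtain ⟨B₂, hB₂, hBA₂⟩ := hAv
  have htu : t ⊆ insert u t := Set.subset_insert u t
  have htv : t ⊆ insert v t := Set.subset_insert v t
  obtain ⟨r, c, hr, hc, h⟩ := hL.scalingEquivOn hs ht (hB₁.mono subset_rfl htu)
    (hB₂.mono subset_rfl htv)
    (fun x hx y hy => by rw [hBA₁ x hx y (htu hy), hBA₂ x hx y (htv hy)])
    (hconn.congr fun x hx y hy hxy h₀ => hxy (by rw [← hBA₁ x hx y (htu hy), h₀, map_zero]))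
  let B : Matrix X Y R := of fun x y => if y = v then B₂ x y else r x * B₁ x y * c y
  have hBv : ∀ x ∈ s, ∀ y ∈ insert v t, B₂ x y = B x y := by
    intro x hx y hy
    by_cases hyv : y = v
    · simp [B, hyv]
    · simpa [B, hyv] using h x hx y (hy.resolve_left hyv)
  have hBu : ∀ x ∈ s, ∀ y ∈ insert u t, r x * B₁ x y * c y = B x y := by
    intro x _ y hy
    have hyv : y ≠ v := by
      rintro rfl
      exact hy.elim huv.symm hv
    simp [B, hyv]
  have hBA : ∀ x ∈ s, ∀ y ∈ insert u (insert v t), π (B x y) = A x y := by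
    intro x hx y hy
    by_cases hyv : y ∈ insert v t
    · rw [← hBv x hx y hyv, hBA₂ x hx y hyv]
    · have hyu : y ∈ insert u t := .inl (hy.resolve_right hyv)
      rw [← hBu x hx y hyu, map_mul, map_mul, (hr x).2, (hc y).2, hBA₁ x hx y hyu, one_mul, mul_one]
  exact ⟨B, ⟨hu, hv, (hB₁.scale (fun x => (hr x).1) fun y => (hc y).1).congr hBu, hB₂.congr hBv,
    hA.congr fun x hx y hy => (hBA x hx y hy).symm⟩, hBA⟩

theorem IsLifting.liftable_of_two_columns [Nontrivial K] (hL : IsLifting S T π) (hs : s.Finite)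
    (ht : t.Finite) {u v : Y} (hu : u ∉ t) (hv : v ∉ t) (huv : u ≠ v)
    (hA : MinorsIn (ringCarrier K T) s (insert u (insert v t)) A) (hconn : ConnOn A s t)
    (hAu : Liftable (ringCarrier R S) π A s (insert u t))
    (hAv : Liftable (ringCarrier R S) π A s (insert v t)) :
    Liftable (ringCarrier R S) π A s (insert u (insert v t)) := by
  have := π.domain_nontrivial
  obtain ⟨B, hB, hBA⟩ := hL.exists_isPartialLift hs ht hu hv huv hA hconn hAu hAv
  refine ⟨B, hB.minorsIn_of_connOn hL (hconn.congr fun x hx y hy hxy h₀ => hxy ?_), hBA⟩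
  rw [← hBA x hx y (.inr (.inr hy)), h₀, map_zero]

end Liftable

section Blocks

variable {R : Type*} [CommRing R] {S : Set Rˣ} {X Y ι : Type*} {A : Matrix X Y R} {s : Set X}
  {t : Set Y} {p : X → ι} {q : Y → ι}

theorem pivot_block (hA : ∀ x ∈ s, ∀ y ∈ t, A x y ≠ 0 → p x = q y) {i x : X} (hi : i ∈ s)
    (hx : x ∈ s) {j y : Y} (hj : j ∈ t) (hy : y ∈ t) (hxy : A x y ≠ 0)
    (h : pivot A x y i j ≠ 0) : p i = q j := by
  by_contra hij
  have hxy' := hA x hx y hy hxy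
  have hAij : A i j = 0 := by
    by_contra h₀
    exact hij (hA i hi j hj h₀)
  have hcol : A i y = 0 ∨ A x j = 0 := by
    by_contra! h₀
    exact hij ((hA i hi y hy h₀.1).trans (hxy'.symm.trans (hA x hx j hj h₀.2)))
  obtain rfl | hix := eq_or_ne i x <;> obtain rfl | hjy := eq_or_ne j y
  · exact hij hxy'
  · exact h (by rw [pivot_apply_row _ hjy, hAij, mul_zero])
  · exact h (by rw [pivot_apply_col _ hix, hAij, zero_mul, neg_zero])
  · refine h ?_
    rw [pivot_apply_of_ne _ hix hjy, hAij]
    rcases hcol with h₀ | h₀ <;> simp [h₀]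

theorem MinorsIn.pivot_block (hA : ∀ x ∈ s, ∀ y ∈ t, A x y ≠ 0 → p x = q y) {x : X} (hx : x ∈ s)
    {y : Y} (hy : y ∈ t) (hpq : p x = q y) (hxy : IsUnit (A x y)) {b : ι}
    (h : MinorsIn (ringCarrier R S) {x ∈ s | p x = b} {y ∈ t | q y = b} A) :
    MinorsIn (ringCarrier R S) {x ∈ s | p x = b} {y ∈ t | q y = b} (PartialField.pivot A x y) := by
  by_cases hb : p x = b
  · exact h.pivot ⟨hx, hb⟩ ⟨hy, hpq ▸ hb⟩ hxy
  · refine h.congr fun i hi j _ => (pivot_apply_of_col_eq_zero ?_ ?_).symm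
    · rintro rfl
      exact hb hi.2
    · by_contra h₀
      exact hb (hpq.trans ((hA i hi.1 y hy h₀).symm.trans hi.2))

theorem minorsIn_of_blocks [Nontrivial R] (hA : ∀ x ∈ s, ∀ y ∈ t, A x y ≠ 0 → p x = q y)
    (h : ∀ b, MinorsIn (ringCarrier R S) {x ∈ s | p x = b} {y ∈ t | q y = b} A) :
    MinorsIn (ringCarrier R S) s t A := by
  intro n
  induction n generalizing A with
  | zero =>
    intro f g _ _
    rw [det_fin_zero]
    exact ringCarrier_one
  | succ n ih =>
    intro f g hf hg
    refine det_submatrix_mem_of_forall_pivot 0 (fun k => ?_) fun k hunit => ?_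
    · by_cases h₀ : A (f k) (g 0) = 0
      · rw [h₀]
        exact zero_mem_ringCarrier
      · exact (h _).entry ⟨hf k, rfl⟩ ⟨hg 0, (hA _ (hf k) _ (hg 0) h₀).symm⟩
    · have hpq := hA _ (hf k) _ (hg 0) hunit.ne_zero
      exact ih (fun i hi j hj => pivot_block hA hi (hf k) hj (hg 0) hunit.ne_zero)
        (fun b => (h b).pivot_block hA (hf k) (hg 0) hpq hunit) _ _ (fun _ => hf _) fun _ => hg _

end Blocks

section Lift

variable {R K : Type*} [CommRing R] [CommRing K] {S : Set Rˣ} {T : Set Kˣ} {π : R →+* K}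
  {X Y ι : Type*} {s : Set X} {t : Set Y} {A : Matrix X Y K}

theorem liftable_of_blocks [Nontrivial R] {p : X → ι} {q : Y → ι}
    (hA : ∀ x ∈ s, ∀ y ∈ t, A x y ≠ 0 → p x = q y)
    (h : ∀ b, Liftable (ringCarrier R S) π A {x ∈ s | p x = b} {y ∈ t | q y = b}) :
    Liftable (ringCarrier R S) π A s t := by
  classical
  choose B hB hBA using h
  have hblock : ∀ {x y}, p x = q y → B (p x) x y = if p x = q y then B (q y) x y else 0 :=
    fun hxy => by rw [if_pos hxy, hxy]
  refine ⟨of fun x y => if p x = q y then B (q y) x y else 0, minorsIn_of_blocks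
    (fun x _ y _ hxy => (ite_ne_right_iff.1 hxy).1) fun b => (hB b).congr ?_, fun x hx y hy => ?_⟩
  · rintro x ⟨-, rfl⟩ y ⟨-, hy⟩
    exact hblock hy.symm
  · by_cases hxy : p x = q y
    · rw [of_apply, if_pos hxy, hBA (q y) x ⟨hx, hxy⟩ y ⟨hy, rfl⟩]
    · rw [of_apply, if_neg hxy, map_zero, eq_comm]
      by_contra h₀
      exact hxy (hA x hx y hy h₀)

theorem IsLifting.liftable_of_subsingleton (hL : IsLifting S T π)
    (hA : MinorsIn (ringCarrier K T) s t A) (ht : t.Subsingleton) :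
    Liftable (ringCarrier R S) π A s t := by
  have hlift : ∀ x y, ∃ b ∈ ringCarrier R S, x ∈ s → y ∈ t → π b = A x y := fun x y => by
    by_cases h : x ∈ s ∧ y ∈ t
    · obtain ⟨b, hb, hbA⟩ := hL.surj _ (hA.entry h.1 h.2)
      exact ⟨b, hb, fun _ _ => hbA⟩
    · exact ⟨0, zero_mem_ringCarrier, fun hx hy => absurd ⟨hx, hy⟩ h⟩
  choose B hB hBA using hlift
  refine ⟨of B, ?_, fun x hx y hy => hBA x y hx hy⟩
  obtain rfl | ⟨y, rfl⟩ := ht.eq_empty_or_singleton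
  · rintro (_ | n) f g - hg
    · rw [det_fin_zero]
      exact ringCarrier_one
    · exact (hg 0).elim
  · rw [← Set.pair_eq_singleton]
    refine minorsIn_pair (fun x _ => hB x y) (fun x _ => hB x y) fun x _ z _ => ?_
    rw [sub_self]
    exact zero_mem_ringCarrier

theorem IsLifting.exists_lift_two_by_two [Nontrivial K] (hL : IsLifting S T π) {a b c d : K}
    (ha : a ∈ ringCarrier K T) (hb : b ∈ ringCarrier K T) (hc : c ∈ ringCarrier K T)
    (hd : d ∈ ringCarrier K T) (hau : IsUnit a) (hbu : IsUnit b) (hcu : IsUnit c) (hdu : IsUnit d)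
    (h : a * d - b * c ∈ ringCarrier K T) :
    ∃ a' ∈ ringCarrier R S, ∃ b' ∈ ringCarrier R S, ∃ c' ∈ ringCarrier R S,
      ∃ d' ∈ ringCarrier R S, (π a' = a ∧ π b' = b ∧ π c' = c ∧ π d' = d) ∧
        a' * d' - b' * c' ∈ ringCarrier R S := by
  obtain ⟨a', ha', rfl⟩ := hL.surj _ ha
  obtain ⟨b', hb', rfl⟩ := hL.surj _ hb
  obtain ⟨c', hc', rfl⟩ := hL.surj _ hc
  have hau' : IsUnit a' := isUnit_of_mem_ringCarrier ha' (by rintro rfl; simp at hau)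
  obtain ⟨q, ⟨hq, -, hq'⟩, hqπ⟩ := hL.fundamental_surj (isFundamental_div (ringCarrier_mul ha hd)
    (ringCarrier_mul hb hc) (hau.mul hdu) (hbu.mul hcu) (sub_mem_ringCarrier_comm.1 h))
  have haq : a' * (b' * c' * a'⁻¹ʳ * q) = b' * c' * q := by
    linear_combination b' * c' * q * Ring.mul_inverse_cancel a' hau'
  have hbc := ringCarrier_mul hb' hc'
  refine ⟨a', ha', b', hb', c', hc', b' * c' * a'⁻¹ʳ * q,
    ringCarrier_mul (ringCarrier_mul hbc (ringCarrier_inverse ha')) hq, ⟨rfl, rfl, rfl, ?_⟩, ?_⟩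
  · refine hau.mul_left_cancel ?_
    rw [← map_mul, haq, map_mul, map_mul, hqπ, mul_comm (π a' * d),
      Ring.mul_inverse_cancel_left _ _ (hbu.mul hcu)]
  · rw [haq, ← mul_sub_one, ← neg_sub, mul_neg, neg_mem_ringCarrier_iff]
    exact ringCarrier_mul hbc hq'

theorem IsLifting.liftable_pair [Nontrivial K] (hL : IsLifting S T π) {x z : X} {y w : Y}
    (hxz : x ≠ z) (hyw : y ≠ w) (hA : MinorsIn (ringCarrier K T) {x, z} {y, w} A)
    (hxy : A x y ≠ 0) (hxw : A x w ≠ 0) (hzy : A z y ≠ 0) (hzw : A z w ≠ 0) :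
    Liftable (ringCarrier R S) π A {x, z} {y, w} := by
  classical
  have hx : x ∈ ({x, z} : Set X) := .inl rfl
  have hz : z ∈ ({x, z} : Set X) := .inr rfl
  have hy : y ∈ ({y, w} : Set Y) := .inl rfl
  have hw : w ∈ ({y, w} : Set Y) := .inr rfl
  have hunit : ∀ {i j}, i ∈ ({x, z} : Set X) → j ∈ ({y, w} : Set Y) → A i j ≠ 0 → IsUnit (A i j) :=
    fun hi hj => isUnit_of_mem_ringCarrier (hA.entry hi hj)
  obtain ⟨a, ha, b, hb, c, hc, d, hd, ⟨haA, hbA, hcA, hdA⟩, hdet⟩ := hL.exists_lift_two_by_two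
    (hA.entry hx hy) (hA.entry hx hw) (hA.entry hz hy) (hA.entry hz hw) (hunit hx hy hxy)
    (hunit hx hw hxw) (hunit hz hy hzy) (hunit hz hw hzw) (hA.two hx hz hy hw)
  let B : Matrix X Y R :=
    of fun i j => if i = x then if j = y then a else b else if j = y then c else d
  have hBxy : B x y = a := by simp [B]
  have hBxw : B x w = b := by simp [B, hyw.symm]
  have hBzy : B z y = c := by simp [B, hxz.symm]
  have hBzw : B z w = d := by simp [B, hxz.symm, hyw.symm]
  have hminor : B x y * B z w - B x w * B z y ∈ ringCarrier R S := by rwa [hBxy, hBxw, hBzy, hBzw]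
  refine ⟨B, minorsIn_pair ?_ ?_ ?_, ?_⟩
  · rintro i (rfl | rfl)
    exacts [hBxy ▸ ha, hBzy ▸ hc]
  · rintro i (rfl | rfl)
    exacts [hBxw ▸ hb, hBzw ▸ hd]
  · rintro i (rfl | rfl) j (rfl | rfl)
    · rw [mul_comm, sub_self]
      exact zero_mem_ringCarrier
    · exact hminor
    · rwa [sub_mem_ringCarrier_comm, mul_comm, mul_comm (B i y)]
    · rw [mul_comm, sub_self]
      exact zero_mem_ringCarrier
  · rintro i (rfl | rfl) j (rfl | rfl)
    exacts [hBxy ▸ haA, hBxw ▸ hbA, hBzy ▸ hcA, hBzw ▸ hdA]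

theorem IsLifting.liftable_of_removable_columns [Nontrivial K] (hL : IsLifting S T π)
    (hs : s.Finite) (ht : t.Finite)
    (hsub : ∀ p < (s, t), Liftable (ringCarrier R S) π A p.1 p.2)
    (hA : MinorsIn (ringCarrier K T) s t A) {u v : Y} (hu : u ∈ t) (hv : v ∈ t) (huv : u ≠ v)
    (hconn : ConnOn A s (t \ {u, v})) : Liftable (ringCarrier R S) π A s t := by
  have hinsert : ∀ {a b : Y}, a ∈ t → a ≠ b → insert a (t \ {a, b}) = t \ {b} := by
    intro a b ha hab
    ext y
    by_cases h : y = a <;> simp_all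
  have hlt : ∀ {b : Y}, b ∈ t → (s, t \ {b}) < (s, t) := fun hb =>
    Prod.mk_lt_mk_iff_right.2 (Set.sdiff_singleton_ssubset.2 hb)
  have huvt : insert u (insert v (t \ {u, v})) = t := by
    rw [Set.pair_comm, hinsert hv huv.symm, Set.insert_sdiff_singleton, Set.insert_eq_of_mem hu]
  rw [← huvt]
  refine hL.liftable_of_two_columns hs ht.sdiff (by simp) (by simp) huv (by rwa [huvt]) hconn ?_ ?_
  · rw [hinsert hu huv]
    exact hsub _ (hlt hv)
  · rw [Set.pair_comm, hinsert hv huv.symm]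
    exact hsub _ (hlt hu)

theorem liftable_transpose_of_lt {D : Set R} (hsub : ∀ p < (s, t), Liftable D π A p.1 p.2) :
    ∀ p < (t, s), Liftable D π Aᵀ p.1 p.2 := fun p hp =>
  (hsub p.swap (Prod.swap_lt_swap.2 hp)).transpose

theorem IsLifting.liftable_of_three_le_degree [Nontrivial K] (hL : IsLifting S T π)
    (hs : s.Finite) (ht : t.Finite)
    (hsub : ∀ p < (s, t), Liftable (ringCarrier R S) π A p.1 p.2)
    (hA : MinorsIn (ringCarrier K T) s t A) (hconn : ConnOn A s t) {x : X} (hx : x ∈ s) {N : Set Y}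
    (hN : N ⊆ t) (hxN : ∀ y ∈ N, A x y ≠ 0) (hcard : 2 < N.encard) :
    Liftable (ringCarrier R S) π A s t := by
  obtain ⟨u, hu, v, hv, huv, h⟩ | ⟨u, hu, v, hv, huv, h⟩ :=
    hconn.exists_two_removable hs ht hx hN hxN hcard
  · exact (hL.liftable_of_removable_columns ht hs (liftable_transpose_of_lt hsub) hA.transpose hu hv
      huv h.transpose).transpose
  · exact hL.liftable_of_removable_columns hs ht hsub hA hu hv huv h

theorem IsLifting.liftable_of_four_cycle [Nontrivial K] (hL : IsLifting S T π)
    (hs : s.Finite) (ht : t.Finite)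
    (hsub : ∀ p < (s, t), Liftable (ringCarrier R S) π A p.1 p.2)
    (hA : MinorsIn (ringCarrier K T) s t A) (hconn : ConnOn A s t) {x z : X} {y w : Y} (hx : x ∈ s)
    (hz : z ∈ s) (hy : y ∈ t) (hw : w ∈ t) (hxz : x ≠ z) (hyw : y ≠ w) (hxy : A x y ≠ 0)
    (hxw : A x w ≠ 0) (hzy : A z y ≠ 0) (hzw : A z w ≠ 0) :
    Liftable (ringCarrier R S) π A s t := by
  have hcycle : ∀ i ∈ ({x, z} : Set X), ∀ j ∈ ({y, w} : Set Y), A i j ≠ 0 := by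
    rintro i (rfl | rfl) j (rfl | rfl) <;> assumption
  have hxz_sub : {x, z} ⊆ s := Set.pair_subset hx hz
  have hyw_sub : {y, w} ⊆ t := Set.pair_subset hy hw
  by_cases hclosed : ∀ i ∈ s, ∀ j ∈ t, A i j ≠ 0 → (i ∈ ({x, z} : Set X) ↔ j ∈ ({y, w} : Set Y))
  · obtain ⟨rfl, rfl⟩ := hconn _ hxz_sub _ hyw_sub (.inl ⟨x, .inl rfl⟩) hclosed
    exact hL.liftable_pair hxz hyw hA hxy hxw hzy hzw
  push Not at hclosed
  obtain ⟨i, hi, j, hj, hij, ⟨hixz, hjyw⟩ | ⟨hixz, hjyw⟩⟩ := hclosed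
  · refine hL.liftable_of_three_le_degree hs ht hsub hA hconn hi (Set.insert_subset hj hyw_sub)
      (Set.forall_mem_insert.2 ⟨hij, hcycle i hixz⟩) ?_
    rw [Set.encard_insert_of_notMem hjyw, Set.encard_pair hyw]
    norm_num
  · refine (hL.liftable_of_three_le_degree ht hs (liftable_transpose_of_lt hsub) hA.transpose
      hconn.transpose hj (Set.insert_subset hi hxz_sub)
      (Set.forall_mem_insert.2 ⟨hij, fun k hk => hcycle k hk j hjyw⟩) ?_).transpose
    rw [Set.encard_insert_of_notMem hixz, Set.encard_pair hxz]
    norm_num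

theorem liftable_of_not_connOn [Nontrivial R]
    (hsub : ∀ p < (s, t), Liftable (ringCarrier R S) π A p.1 p.2) (hconn : ¬ConnOn A s t) :
    Liftable (ringCarrier R S) π A s t := by
  rw [ConnOn] at hconn
  push Not at hconn
  obtain ⟨M, hM, N, hN, hne, hMN, hproper⟩ := hconn
  refine liftable_of_blocks (p := (· ∈ M)) (q := (· ∈ N))
    (fun i hi j hj hij => propext (hMN i hi j hj hij)) fun b =>
    hsub ({x ∈ s | (x ∈ M) = b}, {y ∈ t | (y ∈ N) = b})
      (lt_of_le_of_ne ⟨Set.sep_subset _ _, Set.sep_subset _ _⟩ fun heq => ?_)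
  rw [Prod.mk.injEq, Set.sep_eq_self_iff_mem_true, Set.sep_eq_self_iff_mem_true] at heq
  obtain ⟨hs, ht⟩ := heq
  by_cases hb : b
  · exact hproper (hM.antisymm fun x hx => (hs x hx).mpr hb)
      (hN.antisymm fun y hy => (ht y hy).mpr hb)
  · obtain ⟨x, hx⟩ | ⟨y, hy⟩ := hne
    exacts [hb ((hs x (hM hx)).mp hx), hb ((ht y (hN hy)).mp hy)]

theorem IsLifting.liftable_of_connOn [Nontrivial K] (hL : IsLifting S T π)
    (hs : s.Finite) (ht : t.Finite)
    (hsub : ∀ B : Matrix X Y K, MinorsIn (ringCarrier K T) s t B →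
      ∀ p < (s, t), Liftable (ringCarrier R S) π B p.1 p.2)
    (hA : MinorsIn (ringCarrier K T) s t A) (hconn : ConnOn A s t) :
    Liftable (ringCarrier R S) π A s t := by
  obtain hs₁ | hs₁ := s.subsingleton_or_nontrivial
  · exact (hL.liftable_of_subsingleton hA.transpose hs₁).transpose
  obtain ht₁ | ht₁ := t.subsingleton_or_nontrivial
  · exact hL.liftable_of_subsingleton hA ht₁
  obtain ⟨x, hx, z, hz, y, hy, w, hw, hxz, hyw, hxy, hxw, hzy⟩ := hconn.exists_path hs₁ ht₁
  obtain hzw | hzw := ne_or_eq (A z w) 0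
  · exact hL.liftable_of_four_cycle hs ht (hsub A hA) hA hconn hx hz hy hw hxz hyw hxy hxw hzy hzw
  have hunit : ∀ {i j}, i ∈ s → j ∈ t → A i j ≠ 0 → IsUnit (A i j) :=
    fun hi hj => isUnit_of_mem_ringCarrier (hA.entry hi hj)
  have hu := hunit hx hy hxy
  have hA' := hA.pivot hx hy hu
  refine liftable_of_pivot hx hy hu (hL.liftable_of_four_cycle hs ht (hsub _ hA') hA'
    (hconn.pivot hx hy hu) hx hz hy hw hxz hyw ?_ ?_ ?_ ?_)
  · rw [pivot_apply_self]
    exact hu.ringInverse.ne_zero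
  · rw [pivot_apply_row _ hyw.symm]
    exact (hu.ringInverse.mul (hunit hx hw hxw)).ne_zero
  · rw [pivot_apply_col _ hxz.symm]
    exact ((hunit hz hy hzy).mul hu.ringInverse).neg.ne_zero
  · rw [pivot_apply_of_ne _ hxz.symm hyw.symm, hzw, zero_sub]
    exact (((hunit hz hy hzy).mul hu.ringInverse).mul (hunit hx hw hxw)).neg.ne_zero

theorem IsLifting.liftable [Finite X] [Finite Y] [Nontrivial K] (hL : IsLifting S T π)
    (hA : MinorsIn (ringCarrier K T) s t A) : Liftable (ringCarrier R S) π A s t := by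
  have := π.domain_nontrivial
  obtain ⟨p, rfl, rfl⟩ : ∃ p : Set X × Set Y, p.1 = s ∧ p.2 = t := ⟨(s, t), rfl, rfl⟩
  induction p using WellFoundedLT.induction generalizing A with
  | ind p ih =>
    have hsub : ∀ B : Matrix X Y K, MinorsIn (ringCarrier K T) p.1 p.2 B →
        ∀ q < (p.1, p.2), Liftable (ringCarrier R S) π B q.1 q.2 :=
      fun B hB q hq => ih q hq (hB.mono hq.le.1 hq.le.2)
    by_cases hconn : ConnOn A p.1 p.2
    · exact hL.liftable_of_connOn p.1.toFinite p.2.toFinite hsub hA hconn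
    · exact liftable_of_not_connOn (hsub A hA) hconn

end Lift

section TwoPowers

theorem eq_one_and_eq_zero_of_two_pow_eq_one_add {k l : ℕ} (h : 2 ^ l = 1 + 2 ^ k) :
    l = 1 ∧ k = 0 := by
  have hl : l ≠ 0 := by
    rintro rfl
    simp at h
  have hk : k = 0 := by
    by_contra hk
    have hparity : Even (1 + 2 ^ k) := h ▸ Nat.even_pow.2 ⟨even_two, hl⟩
    simp [Nat.even_add, Nat.even_pow, hk] at hparity
  subst hk
  exact ⟨Nat.pow_right_injective le_rfl h, rfl⟩

theorem two_zpow_eq_add {a b c : ℤ} (h : (2 : ℚ) ^ a = 2 ^ b + 2 ^ c) : a = b + 1 ∧ b = c := by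
  wlog hbc : b ≤ c generalizing b c
  · have hcb := this (h.trans (add_comm _ _)) (le_of_not_ge hbc)
    omega
  have hba : b < a := by
    rw [← zpow_lt_zpow_iff_right₀ (one_lt_two (α := ℚ)), h]
    exact lt_add_of_pos_right _ (by positivity)
  obtain ⟨k, rfl⟩ := Int.le.dest hbc
  obtain ⟨l, rfl⟩ := Int.le.dest hba.le
  simp only [zpow_add₀ (two_ne_zero (α := ℚ)), zpow_natCast] at h
  have hnat : 2 ^ l = 1 + 2 ^ k := by
    have hcancel : (2 : ℚ) ^ l = 1 + 2 ^ k :=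
      mul_left_cancel₀ (zpow_ne_zero b (two_ne_zero (α := ℚ))) (by rw [h]; ring)
    exact_mod_cast hcancel
  obtain ⟨rfl, rfl⟩ := eq_one_and_eq_zero_of_two_pow_eq_one_add hnat
  simp

theorem exponent_of_one_sub_two_zpow {n m : ℤ}
    (h : 1 - (2 : ℚ) ^ n = 0 ∨ 1 - (2 : ℚ) ^ n = 2 ^ m ∨ 1 - (2 : ℚ) ^ n = -2 ^ m) :
    n = 0 ∨ n = 1 ∨ n = -1 := by
  rcases h with h | h | h
  · refine .inl (zpow_right_injective₀ two_pos (one_lt_two (α := ℚ)).ne' ?_)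
    exact (sub_eq_zero.1 h).symm.trans (zpow_zero 2).symm
  · have hsum := two_zpow_eq_add (a := 0) (b := n) (c := m) (by rw [zpow_zero, ← h]; ring)
    omega
  · have hsum := two_zpow_eq_add (a := n) (b := 0) (c := m) (by rw [zpow_zero]; linarith)
    omega

theorem exponent_of_one_add_two_zpow {n m : ℤ}
    (h : 1 + (2 : ℚ) ^ n = 0 ∨ 1 + (2 : ℚ) ^ n = 2 ^ m ∨ 1 + (2 : ℚ) ^ n = -2 ^ m) : n = 0 := by
  have hn : (0 : ℚ) < 2 ^ n := by positivity
  have hm : (0 : ℚ) < 2 ^ m := by positivity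
  have hsum : (2 : ℚ) ^ m = 2 ^ (0 : ℤ) + 2 ^ n := by
    rw [zpow_zero]
    rcases h with h | h | h <;> linarith
  exact (two_zpow_eq_add hsum).2.symm

end TwoPowers

section RingCarrierMap

variable {R K : Type*} [CommRing R] [CommRing K] {u : Rˣ} {v : Kˣ}

theorem mem_ringCarrier_singleton {x : R} :
    x ∈ ringCarrier R {u} ↔ x = 0 ∨ ∃ n : ℤ, x = ↑(u ^ n) ∨ x = -↑(u ^ n) := by
  unfold ringCarrier
  rw [Set.mem_ofPred_eq, Set.singleton_union]
  refine or_congr Iff.rfl ⟨?_, ?_⟩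
  · rintro ⟨g, hg, rfl⟩
    obtain ⟨m, n, rfl⟩ := Subgroup.mem_closure_pair.1 hg
    refine ⟨m, ?_⟩
    rcases Int.even_or_odd n with h | h
    · simp [h.neg_one_zpow]
    · simp [h.neg_one_zpow]
  · rintro ⟨n, rfl | rfl⟩
    · exact ⟨_, Subgroup.mem_closure_pair.2 ⟨n, 0, rfl⟩, by simp⟩
    · exact ⟨_, Subgroup.mem_closure_pair.2 ⟨n, 1, rfl⟩, by simp⟩

theorem self_mem_ringCarrier_singleton : (u : R) ∈ ringCarrier R {u} :=
  .inr ⟨u, Subgroup.subset_closure (.inl rfl), rfl⟩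

theorem image_ringCarrier_singleton (π : R →+* K) (huv : π u = v) :
    π '' ringCarrier R {u} = ringCarrier K {v} := by
  obtain rfl : v = Units.map (π : R →* K) u := Units.ext huv.symm
  ext x
  simp only [Set.mem_image, mem_ringCarrier_singleton, ← map_zpow, Units.coe_map,
    MonoidHom.coe_coe]
  constructor
  · rintro ⟨y, rfl | ⟨n, rfl | rfl⟩, rfl⟩
    · exact .inl (map_zero π)
    · exact .inr ⟨n, .inl rfl⟩
    · exact .inr ⟨n, .inr (map_neg π _)⟩
  · rintro (rfl | ⟨n, rfl | rfl⟩)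
    · exact ⟨0, .inl rfl, map_zero π⟩
    · exact ⟨_, .inr ⟨n, .inl rfl⟩, rfl⟩
    · exact ⟨_, .inr ⟨n, .inr rfl⟩, map_neg π _⟩

end RingCarrierMap

section DyadicRing

/-- The ring `ℤ[1/2]`. Its carrier generated by `2` is a copy of the dyadic partial field which maps
to every ring in which `2` is invertible. -/
abbrev DyadicRing : Type := Localization.Away (2 : ℤ)

namespace DyadicRing

/-- The element `2`, as a unit. -/
noncomputable def two : DyadicRingˣ :=
  (IsLocalization.Away.algebraMap_isUnit (S := DyadicRing) (2 : ℤ)).unit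

theorem val_two : (two : DyadicRing) = 2 := map_ofNat (algebraMap ℤ DyadicRing) 2

/-- The homomorphism from `ℤ[1/2]` to a ring in which `2` is invertible. -/
noncomputable def lift {K : Type*} [CommRing K] (h : IsUnit (2 : K)) : DyadicRing →+* K :=
  IsLocalization.Away.lift (2 : ℤ) (g := Int.castRingHom K) (by simpa using h)

/-- The embedding of `ℤ[1/2]` in `ℚ`. -/
noncomputable def toRat : DyadicRing →+* ℚ := lift (Units.mk0 (2 : ℚ) two_ne_zero).isUnit

theorem toRat_injective : Function.Injective toRat := by
  refine IsLocalization.injective_of_map_algebraMap_zero (M := Submonoid.powers (2 : ℤ)) _ toRat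
    fun n hn => ?_
  rw [eq_intCast, map_intCast, Int.cast_eq_zero] at hn
  rw [hn, map_zero]

instance : Nontrivial DyadicRing := toRat.domain_nontrivial

theorem image_ringCarrier {K : Type*} [CommRing K] (π : DyadicRing →+* K) {v : Kˣ}
    (hv : (v : K) = 2) : π '' ringCarrier DyadicRing {two} = ringCarrier K {v} :=
  image_ringCarrier_singleton π (by rw [val_two, hv, map_ofNat])

theorem toRat_two_zpow (n : ℤ) : toRat ↑(two ^ n) = 2 ^ n := by
  have hunit : toRat ↑(two ^ n) = ((Units.map (toRat : DyadicRing →* ℚ) two ^ n : ℚˣ) : ℚ) := by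
    rw [← map_zpow, Units.coe_map, MonoidHom.coe_coe]
  rw [hunit, Units.val_zpow_eq_zpow_val, Units.coe_map, MonoidHom.coe_coe, val_two, map_ofNat]

theorem toRat_of_mem_ringCarrier {x : DyadicRing} (hx : x ∈ ringCarrier DyadicRing {two}) :
    ∃ m : ℤ, toRat x = 0 ∨ toRat x = 2 ^ m ∨ toRat x = -2 ^ m := by
  rcases mem_ringCarrier_singleton.1 hx with rfl | ⟨m, rfl | rfl⟩
  · exact ⟨0, .inl (map_zero _)⟩
  · exact ⟨m, .inr (.inl (toRat_two_zpow m))⟩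
  · exact ⟨m, .inr (.inr (by rw [map_neg, toRat_two_zpow]))⟩

theorem two_pow_mem_ringCarrier (k : ℕ) : (2 : DyadicRing) ^ k ∈ ringCarrier DyadicRing {two} :=
  mem_ringCarrier_singleton.2 (.inr ⟨k, .inl (by rw [zpow_natCast, Units.val_pow_eq_pow_val,
    val_two])⟩)

theorem intCast_mem_ringCarrier {i : ℤ}
    (hi : i ∈ ({0, 1, -1, 2, -2, 4, -4, 8, -8} : Finset ℤ)) :
    (i : DyadicRing) ∈ ringCarrier DyadicRing {two} := by
  have hpow : ∀ i ∈ ({0, 1, -1, 2, -2, 4, -4, 8, -8} : Finset ℤ),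
      i = 0 ∨ ∃ k : Fin 4, i = 2 ^ (k : ℕ) ∨ i = -2 ^ (k : ℕ) := by decide
  obtain rfl | ⟨k, rfl | rfl⟩ := hpow i hi
  · exact .inl Int.cast_zero
  · simpa using two_pow_mem_ringCarrier k
  · simpa using ringCarrier_neg (two_pow_mem_ringCarrier k)

theorem mem_ringCarrier_of_two_mul_mem {x : DyadicRing}
    (h : 2 * x ∈ ringCarrier DyadicRing {two}) : x ∈ ringCarrier DyadicRing {two} := by
  rw [← val_two] at h
  exact (mul_mem_ringCarrier_iff self_mem_ringCarrier_singleton two.isUnit).1 h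

theorem exists_two_mul_eq_intCast_of_isFundamental {p : DyadicRing}
    (h : IsFundamental (ringCarrier DyadicRing {two}) p) :
    ∃ i ∈ ({1, 2, 4, -2} : Finset ℤ), 2 * p = i := by
  obtain ⟨hp, hunit, hsub⟩ := h
  obtain ⟨m, hm⟩ := toRat_of_mem_ringCarrier hsub
  rcases mem_ringCarrier_singleton.1 hp with rfl | ⟨n, rfl | rfl⟩
  · exact absurd hunit not_isUnit_zero
  · rw [map_sub, map_one, toRat_two_zpow] at hm
    rcases exponent_of_one_sub_two_zpow hm with rfl | rfl | rfl
    · exact ⟨2, by decide, by simp⟩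
    · exact ⟨4, by decide, by rw [zpow_one, val_two]; norm_num⟩
    · exact ⟨1, by decide, by rw [_root_.zpow_neg_one, ← val_two, Units.mul_inv, Int.cast_one]⟩
  · rw [map_sub, map_one, map_neg, toRat_two_zpow, sub_neg_eq_add] at hm
    obtain rfl := exponent_of_one_add_two_zpow hm
    exact ⟨-2, by decide, by norm_num⟩

theorem isFundamental_of_two_mul_eq_intCast {p : DyadicRing} {i : ℤ}
    (hi : i ∈ ({1, 2, 4, -2} : Finset ℤ)) (hp : 2 * p = i) :
    IsFundamental (ringCarrier DyadicRing {two}) p := by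
  obtain ⟨hi₀, hmem, hsub⟩ := (by decide : ∀ i ∈ ({1, 2, 4, -2} : Finset ℤ), i ≠ 0 ∧
    i ∈ ({0, 1, -1, 2, -2, 4, -4, 8, -8} : Finset ℤ) ∧
    2 - i ∈ ({0, 1, -1, 2, -2, 4, -4, 8, -8} : Finset ℤ)) i hi
  have hpD : p ∈ ringCarrier DyadicRing {two} :=
    mem_ringCarrier_of_two_mul_mem (hp ▸ intCast_mem_ringCarrier hmem)
  refine ⟨hpD, isUnit_of_mem_ringCarrier hpD ?_, mem_ringCarrier_of_two_mul_mem ?_⟩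
  · rintro rfl
    have hrat := congrArg toRat hp
    simp only [mul_zero, map_zero, map_intCast] at hrat
    exact hi₀ (Int.cast_eq_zero.1 hrat.symm)
  · have hcast := intCast_mem_ringCarrier hsub
    rwa [Int.cast_sub, ← hp, Int.cast_ofNat, ← mul_one_sub] at hcast

/-- The residues of an element of `ℤ[1/2]` modulo `3` and `5`. -/
noncomputable def toResidue : DyadicRing →+* ZMod 3 × ZMod 5 := lift (by decide)

/-- The element `2`, as a unit. -/
def residueTwo : (ZMod 3 × ZMod 5)ˣ := ⟨2, (2, 3), by decide, by decide⟩

theorem exists_eq_two_pow_of_fst_eq_zero_iff {x : ZMod 3 × ZMod 5} (h : x.1 = 0 ↔ x.2 = 0) :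
    x = 0 ∨ ∃ n : Fin 4, x = 2 ^ (n : ℕ) ∨ x = -2 ^ (n : ℕ) := by
  revert x
  decide

theorem mem_residueCarrier_iff {x : ZMod 3 × ZMod 5} :
    x ∈ ringCarrier (ZMod 3 × ZMod 5) {residueTwo} ↔ (x.1 = 0 ↔ x.2 = 0) := by
  constructor
  · rintro (rfl | ⟨g, -, rfl⟩)
    · decide
    · have hg := Prod.isUnit_iff.1 g.isUnit
      simp only [hg.1.ne_zero, hg.2.ne_zero]
  · intro h
    rw [mem_ringCarrier_singleton]
    refine (exists_eq_two_pow_of_fst_eq_zero_iff h).imp_right fun ⟨n, hn⟩ => ⟨n, ?_⟩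
    simpa [residueTwo] using hn

theorem mem_residueCarrier_of_mem {x : DyadicRing} (hx : x ∈ ringCarrier DyadicRing {two}) :
    (toResidue x).1 = 0 ↔ (toResidue x).2 = 0 :=
  mem_residueCarrier_iff.1 (image_ringCarrier toResidue (v := residueTwo) rfl ▸
    Set.mem_image_of_mem _ hx)

theorem intCast_residues_of_mem {i : ℤ} (hi : (i : DyadicRing) ∈ ringCarrier DyadicRing {two}) :
    (i : ZMod 3) = 0 ↔ (i : ZMod 5) = 0 := by
  simpa using mem_residueCarrier_of_mem hi

theorem exists_isFundamental_toResidue_eq {p : ZMod 3 × ZMod 5}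
    (h : IsFundamental (ringCarrier (ZMod 3 × ZMod 5) {residueTwo}) p) :
    ∃ q, IsFundamental (ringCarrier DyadicRing {two}) q ∧ toResidue q = p := by
  obtain ⟨hp, hunit, hsub⟩ := h
  rw [mem_residueCarrier_iff] at hp hsub
  obtain ⟨i, hi, hpi⟩ := (by decide : ∀ p : ZMod 3 × ZMod 5, (p.1 = 0 ↔ p.2 = 0) → p ≠ 0 →
    ((1 - p).1 = 0 ↔ (1 - p).2 = 0) → ∃ i ∈ ({1, 2, 4, -2} : Finset ℤ), 2 * p = i)
    p hp hunit.ne_zero hsub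
  have htwo : 2 * (↑two⁻¹ * (i : DyadicRing)) = i := by rw [← val_two, Units.mul_inv_cancel_left]
  refine ⟨_, isFundamental_of_two_mul_eq_intCast hi htwo, residueTwo.isUnit.mul_left_cancel ?_⟩
  have hπ := congrArg toResidue htwo
  rw [map_mul, map_ofNat, map_intCast, ← hpi] at hπ
  exact hπ

theorem eq_of_toResidue_eq_of_isFundamental {p q : DyadicRing}
    (hp : IsFundamental (ringCarrier DyadicRing {two}) p)
    (hq : IsFundamental (ringCarrier DyadicRing {two}) q) (h : toResidue p = toResidue q) :
    p = q := by
  obtain ⟨i, hi, hpi⟩ := exists_two_mul_eq_intCast_of_isFundamental hp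
  obtain ⟨j, hj, hqj⟩ := exists_two_mul_eq_intCast_of_isFundamental hq
  have hij : (i : ZMod 3 × ZMod 5) = j := by
    rw [← map_intCast toResidue, ← hpi, map_mul, h, ← map_mul, hqj, map_intCast]
  obtain rfl := (by decide : ∀ i ∈ ({1, 2, 4, -2} : Finset ℤ),
    ∀ j ∈ ({1, 2, 4, -2} : Finset ℤ), (i : ZMod 3 × ZMod 5) = j → i = j) i hi j hj hij
  exact two.isUnit.mul_left_cancel (by rw [val_two, hpi, hqj])

theorem exists_two_mul_eq_intCast_of_isChainRatio {p : DyadicRing}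
    (h : IsChainRatio (ringCarrier DyadicRing {two}) p) :
    ∃ i ∈ ({1, -1, 2, -2, 4, -4} : Finset ℤ), 2 * p = i := by
  rcases h with h | h | ⟨a, b, ha, hb, hab, rfl⟩
  · obtain ⟨i, hi, hpi⟩ := exists_two_mul_eq_intCast_of_isFundamental h
    exact ⟨i, (by decide : ({1, 2, 4, -2} : Finset ℤ) ⊆ {1, -1, 2, -2, 4, -4}) hi, hpi⟩
  · obtain ⟨i, hi, hpi⟩ := exists_two_mul_eq_intCast_of_isFundamental h
    refine ⟨-i, (by decide : ∀ i ∈ ({1, 2, 4, -2} : Finset ℤ),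
      -i ∈ ({1, -1, 2, -2, 4, -4} : Finset ℤ)) i hi, ?_⟩
    rw [Int.cast_neg, ← hpi]
    ring
  · obtain ⟨i, hi, hai⟩ := exists_two_mul_eq_intCast_of_isFundamental ha
    obtain ⟨j, hj, hbj⟩ := exists_two_mul_eq_intCast_of_isFundamental hb
    have hcast : ((i * j - 2 * i + 4 : ℤ) : DyadicRing) = 2 ^ 2 * (a * b - a + 1) := by
      push_cast
      rw [← hai, ← hbj]
      ring
    have hres := intCast_residues_of_mem
      (hcast ▸ ringCarrier_mul (two_pow_mem_ringCarrier 2) hab)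
    obtain ⟨k, hk, hijk⟩ := (by decide : ∀ i ∈ ({1, 2, 4, -2} : Finset ℤ),
      ∀ j ∈ ({1, 2, 4, -2} : Finset ℤ),
        (((i * j - 2 * i + 4 : ℤ) : ZMod 3) = 0 ↔ ((i * j - 2 * i + 4 : ℤ) : ZMod 5) = 0) →
        ∃ k ∈ ({1, -1, 2, -2, 4, -4} : Finset ℤ), i * j = 2 * k) i hi j hj hres
    refine ⟨k, hk, two.isUnit.mul_left_cancel ?_⟩
    have hprod : (i : DyadicRing) * j = 2 * k := by
      rw [← Int.cast_mul, hijk, Int.cast_mul, Int.cast_ofNat]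
    rw [val_two, ← hprod, ← hai, ← hbj]
    ring

theorem sub_mem_ringCarrier_of_isChainRatio {p q : DyadicRing}
    (hp : IsChainRatio (ringCarrier DyadicRing {two}) p)
    (hq : IsChainRatio (ringCarrier DyadicRing {two}) q)
    (h : toResidue (q - p) ∈ ringCarrier (ZMod 3 × ZMod 5) {residueTwo}) :
    q - p ∈ ringCarrier DyadicRing {two} := by
  obtain ⟨i, hi, hpi⟩ := exists_two_mul_eq_intCast_of_isChainRatio hp
  obtain ⟨j, hj, hqj⟩ := exists_two_mul_eq_intCast_of_isChainRatio hq
  have hcast : 2 * (q - p) = ((j - i : ℤ) : DyadicRing) := by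
    rw [Int.cast_sub, ← hpi, ← hqj, mul_sub]
  have hres := ringCarrier_mul (self_mem_ringCarrier_singleton (u := residueTwo)) h
  have htwo : (residueTwo : ZMod 3 × ZMod 5) = toResidue 2 := (map_ofNat toResidue 2).symm
  rw [htwo, ← map_mul, hcast, map_intCast, mem_residueCarrier_iff] at hres
  refine mem_ringCarrier_of_two_mul_mem (hcast ▸ intCast_mem_ringCarrier ?_)
  exact (by decide : ∀ i ∈ ({1, -1, 2, -2, 4, -4} : Finset ℤ),
    ∀ j ∈ ({1, -1, 2, -2, 4, -4} : Finset ℤ),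
      (((j - i : ℤ) : ZMod 3 × ZMod 5).1 = 0 ↔ ((j - i : ℤ) : ZMod 3 × ZMod 5).2 = 0) →
      j - i ∈ ({0, 1, -1, 2, -2, 4, -4, 8, -8} : Finset ℤ)) i hi j hj hres

theorem isLifting_toResidue : IsLifting {two} {residueTwo} toResidue where
  map_mem hx := mem_residueCarrier_iff.2 (mem_residueCarrier_of_mem hx)
  surj p hp := by rwa [← image_ringCarrier toResidue (v := residueTwo) rfl] at hp
  fundamental_inj := eq_of_toResidue_eq_of_isFundamental
  fundamental_surj := exists_isFundamental_toResidue_eq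
  chainRatio_sub := sub_mem_ringCarrier_of_isChainRatio

end DyadicRing

end DyadicRing

section Sums

theorem association_replace {P : Type*} {padd : P → P → Part P} {p q r x : P} (hr : r ∈ padd p q)
    {S : Multiset P} (h : Association padd S x) :
    ∀ T, S = r ::ₘ T → Association padd (p ::ₘ q ::ₘ T) x := by
  induction h with
  | leaf a =>
    intro T hT
    obtain ⟨rfl, rfl⟩ : r = a ∧ T = 0 := by
      simpa [eq_comm] using Multiset.cons_eq_cons.1 ((Multiset.cons_zero a).trans hT)
    exact .node (S := {p}) (T := {q}) (.leaf p) (.leaf q) hr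
  | @node S₁ S₂ u w x' h₁ h₂ hx ih₁ ih₂ =>
    intro T hT
    have hmem : r ∈ S₁ + S₂ := hT ▸ Multiset.mem_cons_self r T
    rcases Multiset.mem_add.1 hmem with hm | hm
    · obtain ⟨S', rfl⟩ := Multiset.exists_cons_of_mem hm
      rw [Multiset.cons_add, Multiset.cons_inj_right] at hT
      simpa only [← hT, Multiset.cons_add] using Association.node (ih₁ S' rfl) h₂ hx
    · obtain ⟨S', rfl⟩ := Multiset.exists_cons_of_mem hm
      rw [Multiset.add_cons, Multiset.cons_inj_right] at hT
      simpa only [← hT, Multiset.add_cons] using Association.node h₁ (ih₂ S' rfl) hx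

variable {P : Type*} [PartialField P]

theorem SumsTo.replace {p q r x : P} (hr : r ∈ padd p q) {T : Multiset P}
    (h : SumsTo (r ::ₘ T) x) : SumsTo (p ::ₘ q ::ₘ T) x := by
  obtain ⟨Z, hZ⟩ := h
  refine ⟨Z, ?_⟩
  rw [Multiset.cons_add, Multiset.cons_add]
  exact association_replace hr hZ _ (Multiset.cons_add _ _ _)

theorem sumsTo_cons_neg_cons_iff {z x : P} {T : Multiset P} :
    SumsTo (z ::ₘ (-z) ::ₘ T) x ↔ SumsTo T x := by
  constructor
  · rintro ⟨Z, hZ⟩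
    refine ⟨z ::ₘ Z, ?_⟩
    convert hZ using 1
    rw [Multiset.map_cons]
    simp only [← Multiset.singleton_add]
    abel
  · rintro ⟨Z, hZ⟩
    have hzero : Association padd ({z} + {-z}) (0 : P) :=
      .node (.leaf z) (.leaf (-z)) ((zero_mem_padd_iff _ _).2 rfl)
    refine ⟨Z, ?_⟩
    convert Association.node hzero hZ (by rw [padd_comm, padd_zero]; exact Part.mem_some x) using 1
    simp only [← Multiset.singleton_add]
    abel

theorem sumsTo_singleton (r : P) : SumsTo {r} r :=
  ⟨0, by simpa using Association.leaf r⟩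

theorem neg_mem_padd {p q r : P} (h : r ∈ padd p q) : p ∈ padd r (-q) := by
  have hzero : Association padd ({q} + {-q}) (0 : P) :=
    .node (.leaf q) (.leaf (-q)) ((zero_mem_padd_iff _ _).2 rfl)
  have hp : Association padd ({p} + ({q} + {-q})) p :=
    .node (.leaf p) hzero (by rw [padd_zero]; exact Part.mem_some p)
  exact associative_law _ _ hp _ _ _ _ (add_assoc _ _ _) (.node (.leaf p) (.leaf q) h) (.leaf _)

theorem sumsTo_replace_iff {p q r x : P} (hr : r ∈ padd p q) {T : Multiset P} :
    SumsTo (p ::ₘ q ::ₘ T) x ↔ SumsTo (r ::ₘ T) x := by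
  refine ⟨fun hT => ?_, fun hT => hT.replace hr⟩
  have hrq := hT.replace (neg_mem_padd hr)
  rwa [Multiset.cons_swap (-q), Multiset.cons_swap r, Multiset.cons_swap r,
    sumsTo_cons_neg_cons_iff] at hrq

/-- Two multisets are congruent if they can be exchanged in all sums. -/
def sumCon (P : Type*) [PartialField P] : AddCon (Multiset P) where
  r S T := ∀ U x, SumsTo (S + U) x ↔ SumsTo (T + U) x
  iseqv := ⟨fun _ _ _ => Iff.rfl, fun h U x => (h U x).symm, fun h h' U x => (h U x).trans (h' U x)⟩
  add' := fun {S S' T T'} h h' U x => by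
    rw [add_assoc, h, ← add_assoc, add_comm S' T, add_assoc, h', ← add_assoc, add_comm T' S']

/-- The class of `{p}` modulo `sumCon P`. It is invertible, its inverse being the class of `{-p}`,
so that sums in `P` can be computed in an abelian group. -/
def sumClass (p : P) : AddUnits (sumCon P).Quotient where
  val := (({p} : Multiset P) : (sumCon P).Quotient)
  neg := (({-p} : Multiset P) : (sumCon P).Quotient)
  val_neg := (AddCon.eq _).2 fun U x => by
    simpa [Multiset.singleton_add] using sumsTo_cons_neg_cons_iff
  neg_val := (AddCon.eq _).2 fun U x => by
    simpa [Multiset.singleton_add, Multiset.cons_swap (-p)] using sumsTo_cons_neg_cons_iff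

theorem sumClass_eq_add {p q r : P} (hr : r ∈ padd p q) :
    sumClass r = sumClass p + sumClass q :=
  AddUnits.ext ((AddCon.eq _).2 fun U x => by
    simpa [Multiset.singleton_add] using (sumsTo_replace_iff hr).symm)

theorem sumClass_zero : sumClass (0 : P) = 0 := by
  simpa using sumClass_eq_add (p := (0 : P)) (q := 0) (r := 0)
    (by rw [padd_zero]; exact Part.mem_some 0)

theorem sumClass_neg (p : P) : sumClass (-p) = -sumClass p := by
  have hzero := sumClass_eq_add ((zero_mem_padd_iff p (-p)).2 rfl)
  rw [sumClass_zero] at hzero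
  exact (neg_eq_of_add_eq_zero_right hzero.symm).symm

theorem val_sum_map_sumClass (S : Multiset P) :
    ((S.map sumClass).sum : AddUnits (sumCon P).Quotient).val = (S : (sumCon P).Quotient) := by
  induction S using Multiset.induction_on with
  | empty => rfl
  | cons p S ih =>
    rw [Multiset.map_cons, Multiset.sum_cons, AddUnits.val_add, ih, ← Multiset.singleton_add]
    rfl

theorem sumsTo_of_sum_map_sumClass_eq {S : Multiset P} {r : P}
    (h : (S.map sumClass).sum = sumClass r) : SumsTo S r := by
  have hclass := congrArg AddUnits.val h
  rw [val_sum_map_sumClass] at hclass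
  simpa [sumsTo_singleton] using (AddCon.eq _).1 hclass 0 r

end Sums

section Realization

variable {P R : Type*} [PartialField P] [CommRing R] {val : P →*₀ R}

/-- The partial field `P` is contained in the ring `R`, and `p + q` is defined if and only if it
lies in `P`. -/
structure IsRingEmbedding (val : P →*₀ R) : Prop where
  injective : Function.Injective val
  mem_padd : ∀ {p q r}, r ∈ padd p q ↔ val r = val p + val q

/-- The partial field `P` is contained in the ring `R`, and a sum of any number of elements of `P`
is defined if and only if it lies in `P`. -/
structure IsRealization (val : P →*₀ R) : Prop where
  injective : Function.Injective val
  sumsTo_iff : ∀ {S : Multiset P} {r : P}, SumsTo S r ↔ (S.map val).sum = val r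

theorem IsRingEmbedding.map_neg (h : IsRingEmbedding val) (p : P) : val (-p) = -val p := by
  have hzero := h.mem_padd.1 ((zero_mem_padd_iff p (-p)).2 rfl)
  rw [map_zero] at hzero
  exact (neg_eq_of_add_eq_zero_right hzero.symm).symm

theorem IsRingEmbedding.sum_eq_of_association (h : IsRingEmbedding val) {S : Multiset P} {r : P}
    (hS : Association padd S r) : (S.map val).sum = val r := by
  induction hS with
  | leaf p => simp
  | node _ _ hr h₁ h₂ => rw [Multiset.map_add, Multiset.sum_add, h₁, h₂, h.mem_padd.1 hr]

theorem IsRingEmbedding.sum_eq_of_sumsTo (h : IsRingEmbedding val) {S : Multiset P} {r : P}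
    (hS : SumsTo S r) : (S.map val).sum = val r := by
  obtain ⟨Z, hZ⟩ := hS
  have hneg : (val ∘ fun z => -z) = fun z => -val z := funext h.map_neg
  rw [← h.sum_eq_of_association hZ, Multiset.map_add, Multiset.map_add, Multiset.sum_add,
    Multiset.sum_add, Multiset.map_map, hneg, Multiset.sum_map_neg, add_neg_cancel, add_zero]

theorem IsRealization.map_neg (h : IsRealization val) (p : P) : val (-p) = -val p := by
  have hzero := h.sumsTo_iff.1 (sumsTo_cons_neg_cons_iff (z := p).2 (sumsTo_singleton 0))
  simp only [Multiset.map_cons, Multiset.sum_cons, Multiset.map_singleton, Multiset.sum_singleton,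
    map_zero, add_zero] at hzero
  exact (neg_eq_of_add_eq_zero_right hzero).symm

theorem IsRealization.map_signed (h : IsRealization val) (ε : ℤˣ) (p : P) :
    val (signed ε p) = ε • val p := by
  rcases Int.units_eq_one_or ε with rfl | rfl
  · rw [signed, if_pos rfl, one_smul]
  · rw [signed, if_neg (by decide), h.map_neg, Units.neg_smul, one_smul]

theorem IsRealization.hasDet_iff (h : IsRealization val) {n : ℕ} {A : Matrix (Fin n) (Fin n) P}
    {d : P} : HasDet A d ↔ (A.map val).det = val d := by
  rw [HasDet, h.sumsTo_iff, Multiset.map_map, ← det_transpose, det_apply]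
  simp only [Function.comp_def, h.map_signed, map_prod, transpose_apply, map_apply]
  rfl

/-- The value of `p` in the ring `R`, together with its class in the group of formal sums. -/
def valClass (val : P →*₀ R) (p : P) : R × AddUnits (sumCon P).Quotient :=
  (val p, sumClass p)

theorem sum_map_valClass (S : Multiset P) :
    (S.map (valClass val)).sum = ((S.map val).sum, (S.map sumClass).sum) := by
  induction S using Multiset.induction_on with
  | empty => rfl
  | cons p S ih => simp only [Multiset.map_cons, Multiset.sum_cons, ih, valClass, Prod.mk_add_mk]

/-- The subgroup generated by the elements standing for `1`, `1/2`, `1/4`, …. -/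
def halvesSubgroup (val : P →*₀ R) (two : P) : AddSubgroup (R × AddUnits (sumCon P).Quotient) :=
  ⨆ m : ℕ, AddSubgroup.zmultiples (valClass val (two⁻¹ ^ m))

namespace IsRingEmbedding

variable {two : P} {u : Rˣ}

theorem sumClass_two_mul (h : IsRingEmbedding val) (htwo : val two = 2) (p : P) :
    sumClass (two * p) = 2 • sumClass p := by
  rw [two_nsmul]
  exact sumClass_eq_add (h.mem_padd.2 (by rw [map_mul, htwo, two_mul]))

theorem valClass_two_mul (h : IsRingEmbedding val) (htwo : val two = 2) (p : P) :
    valClass val (two * p) = 2 • valClass val p := by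
  rw [valClass, h.sumClass_two_mul htwo, map_mul, htwo, two_mul, ← two_nsmul]
  rfl

theorem mem_halvesSubgroup_iff (h : IsRingEmbedding val) (htwo : val two = 2) (htwo₀ : two ≠ 0)
    {x : R × AddUnits (sumCon P).Quotient} : x ∈ halvesSubgroup val two ↔
      ∃ (m : ℕ) (N : ℤ), N • valClass val (two⁻¹ ^ m) = x := by
  refine AddSubgroup.mem_iSup_of_directed (Monotone.directed_le (monotone_nat_of_le_succ ?_))
  intro m
  rw [AddSubgroup.zmultiples_le, ← mul_inv_cancel_left₀ htwo₀ (two⁻¹ ^ m), ← pow_succ',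
    h.valClass_two_mul htwo]
  exact nsmul_mem (AddSubgroup.mem_zmultiples _) 2

theorem valClass_zpow_mem (h : IsRingEmbedding val) (htwo : val two = 2) (htwo₀ : two ≠ 0)
    (n : ℤ) : valClass val (two ^ n) ∈ halvesSubgroup val two := by
  obtain ⟨m, rfl | rfl⟩ := n.eq_nat_or_neg
  · rw [zpow_natCast]
    induction m with
    | zero => exact (h.mem_halvesSubgroup_iff htwo htwo₀).2 ⟨0, 1, by simp⟩
    | succ m ih =>
      rw [pow_succ', h.valClass_two_mul htwo]
      exact nsmul_mem ih 2
  · refine (h.mem_halvesSubgroup_iff htwo htwo₀).2 ⟨m, 1, ?_⟩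
    rw [one_zsmul, _root_.zpow_neg, zpow_natCast, inv_pow]

theorem valClass_mem (h : IsRingEmbedding val) (htwo : val two = 2) (htwo₀ : two ≠ 0)
    (hu : (u : R) = 2) {p : P} (hp : val p ∈ ringCarrier R {u}) :
    valClass val p ∈ halvesSubgroup val two := by
  have hzpow (n : ℤ) : ((u ^ n : Rˣ) : R) = val (two ^ n) := by
    have huval : u = Units.map (val : P →* R) (Units.mk0 two htwo₀) :=
      Units.ext (hu.trans htwo.symm)
    rw [huval, ← map_zpow, Units.coe_map, Units.val_zpow_eq_zpow_val, Units.val_mk0]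
    rfl
  rcases mem_ringCarrier_singleton.1 hp with hp | ⟨n, hp | hp⟩
  · obtain rfl := h.injective (hp.trans (map_zero val).symm)
    rw [valClass, map_zero, sumClass_zero]
    exact zero_mem _
  · obtain rfl := h.injective (hp.trans (hzpow n))
    exact h.valClass_zpow_mem htwo htwo₀ n
  · rw [hzpow, ← h.map_neg] at hp
    obtain rfl := h.injective hp
    rw [valClass, h.map_neg, sumClass_neg]
    exact neg_mem (h.valClass_zpow_mem htwo htwo₀ n)

/-- Modulo the given sums, a formal sum is an integral multiple `N • 2⁻ᵐ`, so it vanishes as soon as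
`N` vanishes in `R`. -/
theorem snd_eq_zero_of_mem_halvesSubgroup (h : IsRingEmbedding val) (htwo : val two = 2)
    (htwo₀ : two ≠ 0) (hchar : ∀ (p : P) (N : ℤ), (N : R) = 0 → N • sumClass p = 0)
    {x : R × AddUnits (sumCon P).Quotient} (hx : x ∈ halvesSubgroup val two) (hx₁ : x.1 = 0) :
    x.2 = 0 := by
  obtain ⟨m, N, rfl⟩ := (h.mem_halvesSubgroup_iff htwo htwo₀).1 hx
  have hunit : IsUnit (val (two⁻¹ ^ m)) :=
    (Units.mk0 _ (pow_ne_zero m (inv_ne_zero htwo₀))).isUnit.map val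
  have hN : (N : R) * val (two⁻¹ ^ m) = 0 := by rw [← zsmul_eq_mul]; exact hx₁
  exact hchar _ N (hunit.mul_left_eq_zero.1 hN)

theorem ne_zero_of_map_eq_two (h : IsRingEmbedding val) (htwo : val two = 2)
    (h₂ : IsUnit (2 : R)) : two ≠ 0 := by
  rintro rfl
  rw [← htwo, map_zero, isUnit_zero_iff] at h₂
  exact zero_ne_one (h.injective (by rw [map_zero, map_one, h₂]))

theorem isRealization (h : IsRingEmbedding val) (hu : (u : R) = 2)
    (hrange : Set.range val = ringCarrier R {u})
    (hchar : ∀ (p : P) (N : ℤ), (N : R) = 0 → N • sumClass p = 0) : IsRealization val where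
  injective := h.injective
  sumsTo_iff {S r} := by
    refine ⟨h.sum_eq_of_sumsTo, fun hS => sumsTo_of_sum_map_sumClass_eq (sub_eq_zero.1 ?_)⟩
    obtain ⟨two, htwo⟩ : (u : R) ∈ Set.range val := hrange ▸ self_mem_ringCarrier_singleton
    rw [hu] at htwo
    have htwo₀ := h.ne_zero_of_map_eq_two htwo (hu ▸ u.isUnit)
    have hmem (p : P) : valClass val p ∈ halvesSubgroup val two :=
      h.valClass_mem htwo htwo₀ hu (hrange ▸ Set.mem_range_self p)
    have hsum : (S.map (valClass val)).sum - valClass val r ∈ halvesSubgroup val two :=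
      sub_mem (multiset_sum_mem _ (Multiset.forall_mem_map_iff.2 fun p _ => hmem p)) (hmem r)
    rw [sum_map_valClass] at hsum
    exact h.snd_eq_zero_of_mem_halvesSubgroup htwo htwo₀ hchar hsum (sub_eq_zero.2 hS)

end IsRingEmbedding

end Realization

section Instances

/-- The inclusion of the partial field of `R` and `S` in the ring `R`. -/
def OfRing.valHom (R : Type*) [CommRing R] [Nontrivial R] (S : Set Rˣ) : OfRing R S →*₀ R where
  toFun := OfRing.val
  map_zero' := rfl
  map_one' := rfl
  map_mul' _ _ := rfl

/-- The inclusion of the direct product of two fields in the product ring. -/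
def DirectProduct.prodHom (F G : Type*) [Field F] [Field G] : DirectProduct F G →*₀ F × G where
  toFun x := (x.fst, x.snd)
  map_zero' := rfl
  map_one' := rfl
  map_mul' _ _ := rfl

theorem isRealization_field (F : Type*) [Field F] : IsRealization (MonoidWithZeroHom.id F) where
  injective := Function.injective_id
  sumsTo_iff {S r} := by
    have hid : IsRingEmbedding (MonoidWithZeroHom.id F) :=
      ⟨Function.injective_id, Part.mem_some_iff⟩
    refine ⟨hid.sum_eq_of_sumsTo, fun hS => sumsTo_of_sum_map_sumClass_eq ?_⟩
    obtain rfl : S.sum = r := by simpa using hS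
    clear hS
    induction S using Multiset.induction_on with
    | empty => exact sumClass_zero.symm
    | cons a S ih =>
      rw [Multiset.map_cons, Multiset.sum_cons, Multiset.sum_cons, ih]
      exact (sumClass_eq_add (Part.mem_some _)).symm

theorem isRingEmbedding_ofRing {R : Type*} [CommRing R] [Nontrivial R] (S : Set Rˣ) :
    IsRingEmbedding (OfRing.valHom R S) where
  injective _ _ h := OfRing.ext h
  mem_padd := mem_ofRing_padd

theorem isRingEmbedding_directProduct (F G : Type*) [Field F] [Field G] :
    IsRingEmbedding (DirectProduct.prodHom F G) where
  injective _ _ h := DirectProduct.ext (congrArg Prod.fst h) (congrArg Prod.snd h)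
  mem_padd {p q r} := by
    refine DirectProduct.mem_add.trans (Iff.trans ?_ Prod.ext_iff.symm)
    exact and_congr Part.mem_some_iff Part.mem_some_iff

theorem range_valHom {R : Type*} [CommRing R] [Nontrivial R] (S : Set Rˣ) :
    Set.range (OfRing.valHom R S) = ringCarrier R S :=
  Set.Subset.antisymm (Set.range_subset_iff.2 OfRing.mem) fun x hx => ⟨⟨x, hx⟩, rfl⟩

theorem isRealization_dyadic :
    IsRealization (OfRing.valHom ℚ {Units.mk0 (2 : ℚ) two_ne_zero}) := by
  refine (isRingEmbedding_ofRing _).isRealization (Units.val_mk0 _) (range_valHom _) ?_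
  intro p N hN
  rw [Int.cast_eq_zero.1 hN, zero_zsmul]

theorem range_prodHom_residues :
    Set.range (DirectProduct.prodHom (ZMod 3) (ZMod 5)) =
      ringCarrier (ZMod 3 × ZMod 5) {DyadicRing.residueTwo} := by
  ext x
  rw [DyadicRing.mem_residueCarrier_iff]
  constructor
  · rintro ⟨p, rfl⟩
    exact p.eq_zero_iff
  · exact fun hx => ⟨⟨x.1, x.2, not_congr hx⟩, rfl⟩

theorem isRealization_residues : IsRealization (DirectProduct.prodHom (ZMod 3) (ZMod 5)) := by
  have hprod := isRingEmbedding_directProduct (ZMod 3) (ZMod 5)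
  refine hprod.isRealization (u := DyadicRing.residueTwo) rfl range_prodHom_residues ?_
  intro p N hN
  have hfifteen : (15 : ℤ) • sumClass p = 0 := by
    obtain ⟨two, htwo⟩ : 2 ∈ Set.range (DirectProduct.prodHom (ZMod 3) (ZMod 5)) :=
      range_prodHom_residues ▸ self_mem_ringCarrier_singleton
    have hcycle : two * (two * (two * (two * p))) = p := hprod.injective (by
      simp only [map_mul, htwo, ← mul_assoc]
      rw [show (2 * 2 * 2 * 2 : ZMod 3 × ZMod 5) = 1 by decide, one_mul])
    have hclass := congrArg sumClass hcycle
    simp only [hprod.sumClass_two_mul htwo] at hclass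
    linear_combination (norm := module) hclass
  obtain ⟨k, rfl⟩ : (15 : ℤ) ∣ N := by
    have h₃ := (ZMod.intCast_zmod_eq_zero_iff_dvd N 3).1 (congrArg Prod.fst hN)
    have h₅ := (ZMod.intCast_zmod_eq_zero_iff_dvd N 5).1 (congrArg Prod.snd hN)
    omega
  rw [mul_comm, mul_zsmul, hfifteen, zsmul_zero]

end Instances

section Transfer

variable {P R K X Y : Type*} [PartialField P] [CommRing R] [CommRing K] {val : P →*₀ R}
  {φ : K →+* R} {A : Matrix X Y P} {B : Matrix X Y K} {S : Set Kˣ} {n : ℕ}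

theorem IsRealization.minorsIn_range (h : IsRealization val) (hA : IsPMatrix A) (s : Set X)
    (t : Set Y) : MinorsIn (Set.range val) s t (A.map val) := by
  intro n f g _ _
  by_cases hinj : Function.Injective f ∧ Function.Injective g
  · obtain ⟨d, hd⟩ := hA n ⟨f, hinj.1⟩ ⟨g, hinj.2⟩
    exact ⟨d, (h.hasDet_iff.1 hd).symm⟩
  · rw [det_submatrix_eq_zero_of_not_injective hinj]
    exact ⟨0, map_zero val⟩

theorem IsRealization.hasDet_submatrix_iff (h : IsRealization val) (hAB : A.map val = B.map φ)
    {f : Fin n → X} {g : Fin n → Y} {d : P} :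
    HasDet (A.submatrix f g) d ↔ φ (B.submatrix f g).det = val d := by
  rw [h.hasDet_iff, ← submatrix_map, hAB, submatrix_map, RingHom.map_det, RingHom.mapMatrix_apply]

theorem IsRealization.isPMatrix (h : IsRealization val) (hAB : A.map val = B.map φ)
    (hB : MinorsIn (ringCarrier K S) Set.univ Set.univ B)
    (hφ : φ '' ringCarrier K S ⊆ Set.range val) : IsPMatrix A := by
  intro n f g
  obtain ⟨d, hd⟩ := hφ ⟨_, hB n f g (fun _ => trivial) (fun _ => trivial), rfl⟩
  exact ⟨d, (h.hasDet_submatrix_iff hAB).2 hd.symm⟩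

theorem IsRealization.hasNonzeroDet_submatrix_iff [Nontrivial R] (h : IsRealization val)
    (hAB : A.map val = B.map φ) (hB : MinorsIn (ringCarrier K S) Set.univ Set.univ B)
    (hφ : φ '' ringCarrier K S ⊆ Set.range val) {f : Fin n → X} {g : Fin n → Y} :
    HasNonzeroDet (A.submatrix f g) ↔ (B.submatrix f g).det ≠ 0 := by
  have hdet := hB n f g (fun _ => trivial) (fun _ => trivial)
  obtain ⟨d, hd⟩ := hφ ⟨_, hdet, rfl⟩
  have hzero (d : P) : val d = 0 ↔ d = 0 :=
    ⟨fun hd => h.injective (hd.trans (map_zero val).symm), fun hd => hd ▸ map_zero val⟩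
  simp only [HasNonzeroDet, h.hasDet_submatrix_iff hAB]
  rw [ne_eq, ← map_eq_zero_iff_of_mem_ringCarrier (π := φ) hdet]
  constructor
  · rintro ⟨d, hd₀, hd⟩
    rwa [hd, hzero]
  · intro hd₀
    exact ⟨d, (hzero d).not.1 (hd ▸ hd₀), hd.symm⟩

theorem exists_map_eq_map (hB : MinorsIn (ringCarrier K S) Set.univ Set.univ B)
    (hφ : φ '' ringCarrier K S ⊆ Set.range val) : ∃ A : Matrix X Y P, A.map val = B.map φ := by
  choose A hA using fun x y => hφ ⟨_, hB.entry (Set.mem_univ x) (Set.mem_univ y), rfl⟩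
  exact ⟨A, by ext x y; exact hA x y⟩

end Transfer

section Representations

variable {α : Type*} {M : Matroid α}

theorem rank_eq_of_hasNonzeroDet {P E : Type*} [PartialField P] {r : ℕ} {A : Matrix (Fin r) E P}
    {g : Fin r ↪ E} (hg : HasNonzeroDet (A.submatrix id g)) : rank A = r := by
  refine IsGreatest.csSup_eq ⟨⟨Function.Embedding.refl _, g, hg⟩, ?_⟩
  rintro k ⟨f, -⟩
  simpa using Fintype.card_le_of_embedding f

theorem exists_mem_bases {P : Type*} [PartialField P] {r : ℕ} {A : Matrix (Fin r) M.E P}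
    (hbase : ∀ B : Set M.E, M.IsBase (Subtype.val '' B) ↔ B ∈ bases A) : ∃ B, B ∈ bases A := by
  obtain ⟨B, hB⟩ := M.exists_isBase
  refine ⟨Subtype.val ⁻¹' B, (hbase _).1 ?_⟩
  rwa [Subtype.image_preimage_coe, Set.inter_eq_right.2 hB.subset_ground]

theorem IsRepresentable.of_hasNonzeroDet_iff {P Q : Type*} [PartialField P] [PartialField Q] {r : ℕ}
    {A : Matrix (Fin r) M.E P}
    (hbase : ∀ B : Set M.E, M.IsBase (Subtype.val '' B) ↔ B ∈ bases A)
    {A' : Matrix (Fin r) M.E Q} (hA' : IsPMatrix A')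
    (h : ∀ g : Fin r ↪ M.E,
      HasNonzeroDet (A.submatrix id g) ↔ HasNonzeroDet (A'.submatrix id g)) :
    IsRepresentable Q M := by
  obtain ⟨_, g, -, hg⟩ := exists_mem_bases hbase
  refine ⟨r, A', hA', rank_eq_of_hasNonzeroDet ((h g).1 hg), fun B => ?_⟩
  rw [hbase]
  exact exists_congr fun g => and_congr_right fun _ => h g

theorem IsRepresentable.of_liftable {P Q R R' K : Type*} [PartialField P] [PartialField Q]
    [CommRing R] [Nontrivial R] [CommRing R'] [Nontrivial R'] [CommRing K] {S : Set Kˣ}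
    {val : P →*₀ R} {val' : Q →*₀ R'} (hval : IsRealization val) (hval' : IsRealization val')
    {φ : K →+* R} {ψ : K →+* R'} (hφ : φ '' ringCarrier K S ⊆ Set.range val)
    (hψ : ψ '' ringCarrier K S ⊆ Set.range val')
    (hlift : ∀ {r : ℕ} {A : Matrix (Fin r) M.E R},
      MinorsIn (Set.range val) Set.univ Set.univ A →
        Liftable (ringCarrier K S) φ A Set.univ Set.univ)
    (h : IsRepresentable P M) : IsRepresentable Q M := by
  obtain ⟨r, A, hA, -, hbase⟩ := h
  obtain ⟨B, hB, hBA⟩ := hlift (hval.minorsIn_range hA _ _)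
  have hAB : A.map val = B.map φ := by
    ext x y
    exact (hBA x trivial y trivial).symm
  obtain ⟨A', hA'B⟩ := exists_map_eq_map (val := val') hB hψ
  refine .of_hasNonzeroDet_iff hbase (hval'.isPMatrix hA'B hB hψ) fun g => ?_
  rw [hval.hasNonzeroDet_submatrix_iff hAB hB hφ, hval'.hasNonzeroDet_submatrix_iff hA'B hB hψ]

theorem liftable_of_injective {R K X Y : Type*} [CommRing R] [CommRing K] {D : Set K}
    {φ : K →+* R} (hφ : Function.Injective φ) {A : Matrix X Y R}
    (hA : MinorsIn (φ '' D) Set.univ Set.univ A) : Liftable D φ A Set.univ Set.univ := by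
  choose B _ hBA using fun x y => hA.entry (Set.mem_univ x) (Set.mem_univ y)
  have hBA : (Matrix.of B).map φ = A := by
    ext x y
    exact hBA x y
  refine ⟨Matrix.of B, fun n f g hf hg => hφ.mem_set_image.1 ?_, fun x _ y _ => ?_⟩
  · rw [RingHom.map_det, RingHom.mapMatrix_apply, ← submatrix_map, hBA]
    exact hA n f g hf hg
  · exact congrFun₂ hBA x y

theorem isRepresentable_dyadic_of_residues [M.Finite]
    (h : IsRepresentable (DirectProduct (ZMod 3) (ZMod 5)) M) :
    IsRepresentable DyadicPartialField M := by
  have := M.ground_finite.to_subtype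
  refine h.of_liftable isRealization_residues isRealization_dyadic
    (S := {DyadicRing.two}) (φ := DyadicRing.toResidue) (ψ := DyadicRing.toRat) ?_ ?_ ?_
  · rw [DyadicRing.image_ringCarrier _ (v := DyadicRing.residueTwo) rfl, range_prodHom_residues]
  · rw [DyadicRing.image_ringCarrier _ (Units.val_mk0 _), range_valHom]
  · intro r A hA
    rw [range_prodHom_residues] at hA
    exact DyadicRing.isLifting_toResidue.liftable hA

theorem isRepresentable_of_dyadic {F : Type*} [Field F] (h₂ : (2 : F) ≠ 0)
    (h : IsRepresentable DyadicPartialField M) : IsRepresentable F M := by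
  have himage : DyadicRing.toRat '' ringCarrier DyadicRing {DyadicRing.two} =
      Set.range (OfRing.valHom ℚ {Units.mk0 (2 : ℚ) two_ne_zero}) := by
    rw [DyadicRing.image_ringCarrier _ (Units.val_mk0 _), range_valHom]
  refine h.of_liftable isRealization_dyadic (isRealization_field F) himage.subset
    (ψ := DyadicRing.lift h₂.isUnit) (fun x _ => ⟨x, rfl⟩) fun hA => ?_
  exact liftable_of_injective DyadicRing.toRat_injective (himage ▸ hA)

theorem hasNonzeroDet_field_iff {F : Type*} [Field F] {n : ℕ} {A : Matrix (Fin n) (Fin n) F} :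
    HasNonzeroDet A ↔ A.det ≠ 0 := by
  simp only [HasNonzeroDet, (isRealization_field F).hasDet_iff]
  exact ⟨fun ⟨_, hd, h⟩ => h ▸ hd, fun h => ⟨_, h, rfl⟩⟩

theorem isPMatrix_field {F X Y : Type*} [Field F] (A : Matrix X Y F) : IsPMatrix A :=
  fun _ _ _ => ⟨_, (isRealization_field F).hasDet_iff.2 rfl⟩

theorem IsRepresentable.of_ringHom {F G : Type*} [Field F] [Field G] (φ : F →+* G)
    (h : IsRepresentable F M) : IsRepresentable G M := by
  obtain ⟨r, A, -, -, hbase⟩ := h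
  refine .of_hasNonzeroDet_iff hbase (A' := A.map φ) (isPMatrix_field _) fun g => ?_
  have hdet : ((A.map φ).submatrix id g).det = φ (A.submatrix id g).det :=
    (RingHom.map_det φ _).symm
  rw [hasNonzeroDet_field_iff, hasNonzeroDet_field_iff, hdet, map_ne_zero]

theorem det_ne_zero_iff_range_mem_bases {F E : Type*} [Field F] {r : ℕ} {A : Matrix (Fin r) E F}
    {h : Fin r → E} :
    (A.submatrix id h).det ≠ 0 ↔ Function.Injective h ∧ Set.range h ∈ bases A := by
  constructor
  · intro hdet
    have hinj : Function.Injective h := by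
      by_contra hinj
      exact hdet (det_submatrix_eq_zero_of_not_injective fun h => hinj h.2)
    exact ⟨hinj, ⟨h, hinj⟩, rfl, hasNonzeroDet_field_iff.2 hdet⟩
  · rintro ⟨hinj, g, hg, hdet⟩
    obtain ⟨σ, hσ⟩ : ∃ σ : Equiv.Perm (Fin r), h = g ∘ σ := by
      refine ⟨(Equiv.ofInjective h hinj).trans
        ((Equiv.setCongr hg.symm).trans (Equiv.ofInjective g g.injective).symm), ?_⟩
      funext i
      simp [Equiv.apply_ofInjective_symm g.injective]
    have hperm : A.submatrix id h = (A.submatrix id g).submatrix id σ := hσ ▸ rfl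
    rw [hperm, det_permute']
    have hsign : (Equiv.Perm.sign σ : F) ≠ 0 :=
      ((Equiv.Perm.sign σ).isUnit.map (Int.castRingHom F)).ne_zero
    exact mul_ne_zero hsign (hasNonzeroDet_field_iff.1 hdet)

end Representations

section StandardForm

variable {F G α : Type*} [Field F] [Field G] {M : Matroid α} {r : ℕ} {g : Fin r → M.E}

/-- `C` represents `M` over a field and is in standard form: the columns selected by `g` are those
of the identity matrix. -/
structure IsStandardForm (M : Matroid α) (g : Fin r → M.E) (C : Matrix (Fin r) M.E F) : Prop where
  submatrix_eq_one : C.submatrix id g = 1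
  isBase_iff (B : Set M.E) : M.IsBase (Subtype.val '' B) ↔ B ∈ bases C

theorem exists_isStandardForm {A : Matrix (Fin r) M.E F}
    (hbase : ∀ B : Set M.E, M.IsBase (Subtype.val '' B) ↔ B ∈ bases A)
    (hg : (A.submatrix id g).det ≠ 0) : ∃ C : Matrix (Fin r) M.E F, IsStandardForm M g C := by
  have hunit : IsUnit (A.submatrix id g).det := isUnit_iff_ne_zero.2 hg
  have hmul (h : Fin r → M.E) : ((A.submatrix id g)⁻¹ * A).submatrix id h =
      (A.submatrix id g)⁻¹ * A.submatrix id h := rfl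
  refine ⟨(A.submatrix id g)⁻¹ * A, ?_, fun B => (hbase B).trans <|
    exists_congr fun h => and_congr_right fun _ => ?_⟩
  · rw [hmul, nonsing_inv_mul _ hunit]
  · rw [hasNonzeroDet_field_iff, hasNonzeroDet_field_iff, hmul, det_mul, mul_ne_zero_iff]
    exact (and_iff_right (isUnit_nonsing_inv_det _ hunit).ne_zero).symm

open Classical in
/-- The columns `g` of an identity matrix, those belonging to the rows `f` being replaced by the
columns `k`: the `f × k` submatrix has the same determinant as the square submatrix with all rows
and with these columns. -/
noncomputable def completeColumns {E : Type*} {n : ℕ} (f : Fin n → Fin r) (k : Fin n → E)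
    (g : Fin r → E) (i : Fin r) : E :=
  if h : ∃ j, f j = i then k h.choose else g i

theorem completeColumns_apply {E : Type*} {n : ℕ} {f : Fin n → Fin r} (hf : Function.Injective f)
    (k : Fin n → E) (g : Fin r → E) (j : Fin n) : completeColumns f k g (f j) = k j := by
  have h : ∃ j', f j' = f j := ⟨j, rfl⟩
  rw [completeColumns, dif_pos h, hf h.choose_spec]

theorem det_completeColumns {R E : Type*} [CommRing R] {n : ℕ} {A : Matrix (Fin r) E R}
    {g : Fin r → E} (hg : A.submatrix id g = 1) {f : Fin n → Fin r} (hf : Function.Injective f)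
    (k : Fin n → E) :
    (A.submatrix id (completeColumns f k g)).det = (A.submatrix f k).det := by
  classical
  have hentry (i : Fin r) (j : {j // ¬ ∃ l, f l = j}) :
      A i (completeColumns f k g j) = (1 : Matrix (Fin r) (Fin r) R) i j := by
    rw [completeColumns, dif_neg j.2, ← hg, submatrix_apply, id]
  rw [twoBlockTriangular_det' _ (fun i => ∃ j, f j = i)]
  · have hone : toSquareBlockProp (A.submatrix id (completeColumns f k g))
        (fun i => ¬ ∃ j, f j = i) = 1 := by
      ext i j
      exact (hentry i j).trans (by simp [one_apply, Subtype.ext_iff])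
    let e : Fin n ≃ {i // ∃ j, f j = i} := Equiv.ofInjective f hf
    rw [hone, det_one, mul_one, ← det_submatrix_equiv_self e]
    congr 1
    ext i j
    exact congrArg (A (f i)) (completeColumns_apply hf k g j)
  · intro i hi j hj
    have hij : i ≠ j := fun hij => hj (hij ▸ hi)
    exact (hentry i ⟨j, hj⟩).trans (one_apply_ne hij)

theorem IsStandardForm.det_submatrix_eq_zero_iff {C : Matrix (Fin r) M.E F}
    {D : Matrix (Fin r) M.E G} (hC : IsStandardForm M g C) (hD : IsStandardForm M g D) {n : ℕ}
    (f : Fin n → Fin r) (k : Fin n → M.E) :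
    (C.submatrix f k).det = 0 ↔ (D.submatrix f k).det = 0 := by
  by_cases hf : Function.Injective f
  · rw [← det_completeColumns hC.submatrix_eq_one hf, ← det_completeColumns hD.submatrix_eq_one hf,
      ← not_iff_not, ← ne_eq, ← ne_eq, det_ne_zero_iff_range_mem_bases,
      det_ne_zero_iff_range_mem_bases, ← hC.isBase_iff, ← hD.isBase_iff]
  · simp only [det_submatrix_eq_zero_of_not_injective fun h => hf h.1]

theorem det_of_prod {R S : Type*} [CommRing R] [CommRing S] {n : ℕ} (C : Matrix (Fin n) (Fin n) R)
    (D : Matrix (Fin n) (Fin n) S) : (of fun i j => (C i j, D i j)).det = (C.det, D.det) :=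
  Prod.ext (RingHom.map_det (RingHom.fst R S) _) (RingHom.map_det (RingHom.snd R S) _)

theorem exists_isStandardForm_pair (hF : IsRepresentable F M) (hG : IsRepresentable G M) :
    ∃ (r : ℕ) (g : Fin r → M.E) (C : Matrix (Fin r) M.E F) (D : Matrix (Fin r) M.E G),
      IsStandardForm M g C ∧ IsStandardForm M g D := by
  obtain ⟨r, A, -, -, hA⟩ := hF
  obtain ⟨r', A', -, -, hA'⟩ := hG
  obtain ⟨B, hB⟩ := exists_mem_bases hA
  have hbase := (hA' B).1 ((hA B).2 hB)
  obtain ⟨g, rfl, hg⟩ := hB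
  obtain ⟨g', hrange, -⟩ := id hbase
  obtain rfl : r = r' := by
    have hcard := congrArg Set.ncard hrange
    simpa [Set.ncard_range_of_injective, g.injective, g'.injective] using hcard.symm
  obtain ⟨C, hC⟩ := exists_isStandardForm hA (hasNonzeroDet_field_iff.1 hg)
  obtain ⟨D, hD⟩ :=
    exists_isStandardForm hA' (det_ne_zero_iff_range_mem_bases.2 ⟨g.injective, hbase⟩)
  exact ⟨r, g, C, D, hC, hD⟩

theorem isRepresentable_residues_of_fields (h₃ : IsRepresentable (ZMod 3) M)
    (h₅ : IsRepresentable (ZMod 5) M) : IsRepresentable (DirectProduct (ZMod 3) (ZMod 5)) M := by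
  obtain ⟨r, g, C, D, hC, hD⟩ := exists_isStandardForm_pair h₃ h₅
  let CD : Matrix (Fin r) M.E (ZMod 3 × ZMod 5) := of fun x y => (C x y, D x y)
  have hdet {n : ℕ} (f : Fin n → Fin r) (k : Fin n → M.E) :
      (CD.submatrix f k).det = ((C.submatrix f k).det, (D.submatrix f k).det) :=
    det_of_prod _ _
  have hminors : MinorsIn (ringCarrier (ZMod 3 × ZMod 5) {DyadicRing.residueTwo})
      Set.univ Set.univ CD := fun n f k _ _ => by
    rw [DyadicRing.mem_residueCarrier_iff, hdet]
    exact hC.det_submatrix_eq_zero_iff hD f k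
  have himage : RingHom.id _ '' ringCarrier (ZMod 3 × ZMod 5) {DyadicRing.residueTwo} ⊆
      Set.range (DirectProduct.prodHom (ZMod 3) (ZMod 5)) := by
    rw [range_prodHom_residues, RingHom.coe_id, Set.image_id]
  obtain ⟨A, hA⟩ := exists_map_eq_map hminors himage
  refine .of_hasNonzeroDet_iff hC.isBase_iff
    (isRealization_residues.isPMatrix hA hminors himage) fun k => ?_
  rw [isRealization_residues.hasNonzeroDet_submatrix_iff hA hminors himage, hasNonzeroDet_field_iff,
    hdet, ne_eq, ne_eq, Prod.mk_eq_zero, ← hC.det_submatrix_eq_zero_iff hD, and_self_iff]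

end StandardForm

theorem isRepresentable_zmod_of_forall {α : Type*} {M : Matroid α}
    (h : ∀ (F : Type v) [Field F], ringChar F ≠ 2 → IsRepresentable F M) (p : ℕ) [Fact p.Prime]
    (hp : p ≠ 2) : IsRepresentable (ZMod p) M := by
  refine (h (ULift.{v} (ZMod p)) ?_).of_ringHom
    (ULift.ringEquiv : ULift.{v} (ZMod p) ≃+* ZMod p).toRingHom
  rwa [ringChar.eq (ULift.{v} (ZMod p)) p]

end PartialField

/-- For a (finite) matroid `M` the following are equivalent: `M` is representable over the direct
product of `GF(3)` and `GF(5)`; `M` is representable over the dyadic partial field; `M` is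
representable over every field of characteristic other than `2`. -/
theorem mainTheorem8 {α : Type u} (M : Matroid α) [M.Finite] :
    List.TFAE [
      PartialField.IsRepresentable (PartialField.DirectProduct (ZMod 3) (ZMod 5)) M,
      PartialField.IsRepresentable DyadicPartialField M,
      ∀ (F : Type v) [Field F], ringChar F ≠ 2 → PartialField.IsRepresentable F M] := by
  tfae_have 1 → 2 := PartialField.isRepresentable_dyadic_of_residues
  tfae_have 2 → 3 := fun h F _ hF =>
    PartialField.isRepresentable_of_dyadic (Ring.two_ne_zero hF) h
  tfae_have 3 → 1 := fun h => PartialField.isRepresentable_residues_of_fields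
    (PartialField.isRepresentable_zmod_of_forall h 3 (by norm_num))
    (PartialField.isRepresentable_zmod_of_forall h 5 (by norm_num))
  tfae_finish
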